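/- **Theorem (Maximum Principle and Bellman Equation).** *Setting.* Let $n,d\ge 0$ be integers, $T>0$, $k_0>0$. Let $\mathcal P_2(\mathbb R^n)$ be the set of Borel probability measures on $\mathbb R^n$ with finite second moment, with the topology of the Wasserstein distance $W_2$; put $\|\mu\|_p=(\int|x|^p\,d\mu)^{1/p}$, and let $X\#\mu$ be the push-forward. Fix a probability space $(\Omega,\mathcal F,\mathbb P)$ on which every $\mu\in\mathcal P_2(\mathbb R^n)$ is the law $\mathbb L_\xi$ of some $\xi\in L^2(\Omega;\mathbb R^n)$. A function $\Phi$ on $\mathcal P_2(\mathbb R^n)$ with values in some $\mathbb R^q$ is *$L$-differentiable* at $\mu$ with $L$-derivative $\partial_\mu\Phi(\mu)(\cdot)\in L^2_\mu$ if at every $\xi\in L^2(\Omega;\mathbb R^n)$ with law $\mu$ the lift $\eta\mapsto\Phi(\mathbb L_\eta)$ is Fréchet differentiable with derivative $\eta\mapsto\mathbb E[\partial_\mu\Phi(\mu)(\xi)\,\eta]$. $\Phi$ has *linear functional derivative* $\frac{\delta\Phi}{\delta\mu}$ if this function is continuous on $\mathcal P_2(\mathbb R^n)\times\mathbb R^n$,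 $|\frac{\delta\Phi}{\delta\mu}(\mu)(x)|\le c(\mu)(1+|x|^2)$ with $c$ bounded on bounded sets, $\int\frac{\delta\Phi}{\delta\mu}(\mu)\,d\mu=0$, and $\Phi(\nu_1)-\Phi(\nu_2)=\int_0^1\!\int\frac{\delta\Phi}{\delta\mu}(\theta\nu_1+(1-\theta)\nu_2)(x)\,d(\nu_1-\nu_2)(x)\,d\theta$ for all $\nu_1,\nu_2$. $\Phi$ is *regularly differentiable* if moreover $\frac{\delta\Phi}{\delta\mu}$ is differentiable in $x$, and $\partial_\mu\Phi(\mu)(x):=\partial_x\frac{\delta\Phi}{\delta\mu}(\mu)(x)$ is jointly continuous and bounded by $c(\mu)(1+|x|)$ with $c$ bounded on bounded sets. *Coefficients.* Let $f:\mathbb R^n\times\mathcal P_2(\mathbb R^n)\times\mathbb R^d\to\mathbb R^n$, $g:\mathbb R^n\times\mathcal P_2(\mathbb R^n)\times\mathbb R^d\to\mathbb R$ and $k:\mathbb R^n\times\mathcal P_2(\mathbb R^n)\to\mathbb R$ be jointly continuous, differentiable in $x$ (and in $\alpha$, for $f,g$) and regularly differentiable in $\mu$, all first derivatives being jointly continuous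 in all their arguments. Assume that $\partial_xf,\partial_\alpha f,\partial_\mu f$ are bounded and that, for some constant $L$, $|\partial_xg|,|\partial_\alpha g|\le L(1+|x|+\|\mu\|_1+|\alpha|)$, $|\partial_\mu g(x,\mu,\alpha)(\tilde x)|\le L(1+|x|+\|\mu\|_1+|\alpha|+|\tilde x|)$, $|\partial_xk|\le L(1+|x|+\|\mu\|_1)$ and $|\partial_\mu k(x,\mu)(\tilde x)|\le L(1+|x|+\|\mu\|_1+|\tilde x|)$. *Control.* Let $\mathcal C=\{(x,\mu,z):|z|<\tfrac12k_0(1+|x|+\|\mu\|_1)\}$. Let $\alpha(x,\mu,z)\in\mathbb R^d$ be continuous on $\mathcal C$ with $|\alpha(x,\mu,z)|\le L_\alpha(1+|x|+\|\mu\|_1+|z|)$ there, differentiable in $(x,z)$ and $L$-differentiable in $\mu$ at the points of $\mathcal C$ with jointly continuous derivatives (the $L$-derivative being continuous on $\mathcal C\times\mathbb R^n$), and satisfy the first order condition $\partial_\alpha f(x,\mu,\alpha(x,\mu,z))\cdot z+\partial_\alpha g(x,\mu,\alpha(x,\mu,z))=0$ on $\mathcal C$. *Forward-backward system.* For all $0\le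 t\le s\le T$, $m\in\mathcal P_2(\mathbb R^n)$, $x\in\mathbb R^n$, let $X^{t,m}_s(x),Z^{t,m}_s(x)\in\mathbb R^n$ be given. Put $\mu_s=X^{t,m}_s\#m$ and $\alpha_s(x)=\alpha(X^{t,m}_s(x),\mu_s,Z^{t,m}_s(x))$. Assume that $X^{t,m}_s\in L^2_m$, $\sup_{s\in[t,T]}\|X^{t,m}_s\|_{L^2_m}<\infty$, $(X^{t,m}_s(x),\mu_s,Z^{t,m}_s(x))\in\mathcal C$, and that for all $t,m,x$ and $s\in[t,T]$ $$\tfrac{d}{ds}X^{t,m}_s(x)=f(X^{t,m}_s(x),\mu_s,\alpha_s(x)),\qquad X^{t,m}_t(x)=x,$$ $$\begin{aligned}\tfrac{d}{ds}Z^{t,m}_s(x)=&-\int\Big(\partial_\mu f(X^{t,m}_s(\tilde x),\mu_s,\alpha_s(\tilde x))(X^{t,m}_s(x))\cdot Z^{t,m}_s(\tilde x)+\partial_\mu g(X^{t,m}_s(\tilde x),\mu_s,\alpha_s(\tilde x))(X^{t,m}_s(x))\Big)dm(\tilde x)\\&-\partial_xf(X^{t,m}_s(x),\mu_s,\alpha_s(x))\cdot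 Z^{t,m}_s(x)-\partial_xg(X^{t,m}_s(x),\mu_s,\alpha_s(x)),\end{aligned}$$ $$Z^{t,m}_T(x)=\int\partial_\mu k(X^{t,m}_T(\tilde x),\mu_T)(X^{t,m}_T(x))\,dm(\tilde x)+\partial_xk(X^{t,m}_T(x),\mu_T).$$ Here $A\cdot z$, for a derivative $A$ of $f$, is $A^{\top}z$, and derivatives in time at end points are one-sided. Assume also that $X$ and $Z$ are jointly continuous in $(t,s,m,x)$, differentiable in $t\in[0,s]$, differentiable in $x$ and $L$-differentiable in $m$, the derivatives $\partial_t,\partial_x$ being jointly continuous in $(t,s,m,x)$ and the derivatives $\partial_m(\cdot)(y)$ jointly continuous in $(t,s,m,x,y)$, on $0\le t\le s\le T$. *Conclusion.* Define $$v(t,m)=\int k(X^{t,m}_T(x),X^{t,m}_T\#m)\,dm(x)+\int_t^T\!\!\int g\big(X^{t,m}_s(x),X^{t,m}_s\#m,\alpha_s(x)\big)\,dm(x)\,ds .$$ Then all these integrals converge absolutely; for every $t\in[0,T]$, $v(t,\cdot)$ is $L$-differentiable on $\mathcal P_2(\mathbb R^n)$ with $\partial_mv(t,m)(x)=Z^{t,m}_t(x)$;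 and $v$ is a classical solution of the Bellman equation, that is, $v$ is differentiable in $t\in[0,T]$, $L$-differentiable in $m$, and for all $t\in[0,T]$ and $m\in\mathcal P_2(\mathbb R^n)$ $$\partial_tv(t,m)+\int H\big(x,m,\partial_mv(t,m)(x)\big)dm(x)=0,\qquad v(T,m)=\int k(x,m)\,dm(x),$$ with $H(x,\mu,z)=f(x,\mu,\alpha(x,\mu,z))\cdot z+g(x,\mu,\alpha(x,\mu,z))$, where the integrals of $H$ and of $k$ converge absolutely. If moreover $\alpha(x,\mu,z)$ minimises $a\mapsto f(x,\mu,a)\cdot z+g(x,\mu,a)$ over $\mathbb R^d$ for every $(x,\mu,z)\in\mathcal C$, then $v$ is also a classical solution of this equation with $H$ replaced by the Hamiltonian $h(x,\mu,z)=\min_a\big(f(x,\mu,a)\cdot z+g(x,\mu,a)\big)$. -/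

import Mathlib

open MeasureTheory Set Filter Topology
open scoped RealInnerProductSpace

noncomputable section

namespace MFC

/-- The Euclidean space `ℝⁿ`. -/
abbrev Euc (n : ℕ) : Type := EuclideanSpace ℝ (Fin n)

/-! ### The space of square-integrable probability measures -/

/-- Probability measures on `ℝⁿ` with finite second moment. -/
structure P2 (n : ℕ) where
  toMeasure : Measure (Euc n)
  isProb : IsProbabilityMeasure toMeasure
  memLp : MemLp (fun x : Euc n => x) 2 toMeasure

instance (n : ℕ) : Coe (P2 n) (Measure (Euc n)) := ⟨P2.toMeasure⟩

instance {n : ℕ} (μ : P2 n) : IsProbabilityMeasure μ.toMeasure := μ.isProb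

namespace P2

variable {n : ℕ}

/-- The first moment `‖μ‖₁ = ∫ |x| dμ(x)`. -/
def norm1 (μ : P2 n) : ℝ := ∫ x, ‖x‖ ∂(μ : Measure (Euc n))

/-- `‖μ‖₂ = (∫ |x|² dμ(x))^{1/2}`. -/
def norm2 (μ : P2 n) : ℝ := √(∫ x, ‖x‖ ^ 2 ∂(μ : Measure (Euc n)))

/-- `π` is a coupling of `μ` and `ν`. -/
def IsCoupling (μ ν : P2 n) (π : Measure (Euc n × Euc n)) : Prop :=
  π.map Prod.fst = μ ∧ π.map Prod.snd = ν

/-- The Wasserstein distance of order two. -/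
def W2 (μ ν : P2 n) : ℝ :=
  √(sInf {c : ℝ | ∃ π : Measure (Euc n × Euc n), IsCoupling μ ν π ∧
    c = ∫ p, ‖p.1 - p.2‖ ^ 2 ∂π})

/-- The topology of the Wasserstein distance. -/
instance : TopologicalSpace (P2 n) where
  IsOpen U := ∀ μ ∈ U, ∃ ε > 0, ∀ ν, W2 μ ν < ε → ν ∈ U
  isOpen_univ := fun _ _ => ⟨1, one_pos, fun _ _ => mem_univ _⟩
  isOpen_inter := by
    rintro U V hU hV μ ⟨h1, h2⟩
    obtain ⟨a, ha, hUa⟩ := hU μ h1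
    obtain ⟨b, hb, hVb⟩ := hV μ h2
    exact ⟨min a b, lt_min ha hb, fun ν hν =>
      ⟨hUa ν (hν.trans_le (min_le_left _ _)), hVb ν (hν.trans_le (min_le_right _ _))⟩⟩
  isOpen_sUnion := by
    rintro S hS μ ⟨U, hU, hμ⟩
    obtain ⟨a, ha, hUa⟩ := hS U hU μ hμ
    exact ⟨a, ha, fun ν hν => ⟨U, hU, hUa ν hν⟩⟩

/-- The law of a random variable under a probability measure, when the variable is
square-integrable. -/
def ofMap {Ω : Type*} [MeasurableSpace Ω] (P : Measure Ω) [IsProbabilityMeasure P]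
    (X : Ω → Euc n) (hX : MemLp X 2 P) : P2 n where
  toMeasure := P.map X
  isProb := Measure.isProbabilityMeasure_map hX.aestronglyMeasurable.aemeasurable
  memLp := by
    rw [memLp_map_measure_iff (by fun_prop) hX.aestronglyMeasurable.aemeasurable]
    exact hX

/-- The law of an element of `L²(Ω; ℝⁿ)`. -/
def law {Ω : Type*} [MeasurableSpace Ω] (P : Measure Ω) [IsProbabilityMeasure P]
    (X : Lp (Euc n) 2 P) : P2 n :=
  ofMap P X (Lp.memLp X)

open Classical in
/-- The push-forward `Φ # μ` for `Φ ∈ L²_μ` (and `μ`, by convention, for other maps `Φ`). -/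
def push (Φ : Euc n → Euc n) (μ : P2 n) : P2 n :=
  if h : MemLp Φ 2 (μ : Measure (Euc n)) then ofMap (μ : Measure (Euc n)) Φ h else μ

/-- The mixture `θ μ + (1 - θ) ν`, `θ ∈ [0,1]`. -/
def mix (θ : unitInterval) (μ ν : P2 n) : P2 n where
  toMeasure := ENNReal.ofReal θ • (μ : Measure (Euc n)) +
    ENNReal.ofReal (1 - θ) • (ν : Measure (Euc n))
  isProb := ⟨by
    simp only [Measure.coe_add, Measure.coe_smul, Pi.add_apply, Pi.smul_apply, measure_univ,
      smul_eq_mul, mul_one]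
    rw [← ENNReal.ofReal_add θ.2.1 (sub_nonneg.2 θ.2.2)]
    simp⟩
  memLp := by
    rw [memLp_two_iff_integrable_sq_norm (by fun_prop)]
    exact (μ.memLp.integrable_norm_pow two_ne_zero |>.smul_measure ENNReal.ofReal_ne_top).add_measure
      (ν.memLp.integrable_norm_pow two_ne_zero |>.smul_measure ENNReal.ofReal_ne_top)

end P2

/-! ### Derivatives with respect to a measure -/

section Derivatives

variable {n : ℕ} {F : Type*} [NormedAddCommGroup F] [NormedSpace ℝ F]

/-- `c` is bounded on bounded subsets of `P2 n`. -/
def BoundedOnBounded (c : P2 n → ℝ) : Prop :=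
  ∀ R : ℝ, ∃ C : ℝ, ∀ μ : P2 n, μ.norm2 ≤ R → c μ ≤ C

/-- `δ` is the (normalised) linear functional derivative of `Φ`. -/
structure IsLinFunDeriv (Φ : P2 n → F) (δ : P2 n → Euc n → F) : Prop where
  continuous : Continuous fun p : P2 n × Euc n => δ p.1 p.2
  growth : ∃ c : P2 n → ℝ, BoundedOnBounded c ∧ ∀ μ x, ‖δ μ x‖ ≤ c μ * (1 + ‖x‖ ^ 2)
  sub_eq : ∀ ν₁ ν₂ : P2 n, Φ ν₁ - Φ ν₂ =
    ∫ θ : unitInterval, ((∫ x, δ (P2.mix θ ν₁ ν₂) x ∂(ν₁ : Measure (Euc n))) -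
      ∫ x, δ (P2.mix θ ν₁ ν₂) x ∂(ν₂ : Measure (Euc n)))
  normalised : ∀ μ : P2 n, ∫ x, δ μ x ∂(μ : Measure (Euc n)) = 0

open Classical in
/-- The linear functional derivative `δΦ/δμ (μ)(x)` (zero if `Φ` has none). -/
def linFunDeriv (Φ : P2 n → F) : P2 n → Euc n → F :=
  if h : ∃ δ, IsLinFunDeriv Φ δ then h.choose else 0

/-- The derivative `∂_μ Φ(μ)(x) = ∂_x (δΦ/δμ)(μ)(x)`. -/
def dMu (Φ : P2 n → F) (μ : P2 n) (x : Euc n) : Euc n →L[ℝ] F :=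
  fderiv ℝ (linFunDeriv Φ μ) x

/-- `Φ` is regularly (linear-functionally) differentiable. -/
structure RegularlyDifferentiable (Φ : P2 n → F) : Prop where
  exists_deriv : ∃ δ, IsLinFunDeriv Φ δ
  differentiable : ∀ μ, Differentiable ℝ (linFunDeriv Φ μ)
  continuous : Continuous fun p : P2 n × Euc n => dMu Φ p.1 p.2
  growth : ∃ c : P2 n → ℝ, BoundedOnBounded c ∧ ∀ μ x, ‖dMu Φ μ x‖ ≤ c μ * (1 + ‖x‖)

variable {Ω : Type*} [MeasurableSpace Ω]

/-- `Φ` is `L`-differentiable at `μ` with `L`-derivative `D`: at every `X ∈ L²(Ω; ℝⁿ)` with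
law `μ` the lift `Y ↦ Φ(law Y)` is Fréchet differentiable, and its derivative is represented
by `D(X)`. -/
def HasLDerivAt (P : Measure Ω) [IsProbabilityMeasure P] (Φ : P2 n → F)
    (D : Euc n → Euc n →L[ℝ] F) (μ : P2 n) : Prop :=
  MemLp D 2 (μ : Measure (Euc n)) ∧
  ∀ X : Lp (Euc n) 2 P, P2.law P X = μ →
    ∃ L : Lp (Euc n) 2 P →L[ℝ] F, (∀ Y, L Y = ∫ ω, D (X ω) (Y ω) ∂P) ∧
      HasFDerivAt (fun Y : Lp (Euc n) 2 P => Φ (P2.law P Y)) L X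

/-- The probability space carries a square-integrable random vector of every law. -/
def RichSpace (n : ℕ) (P : Measure Ω) [IsProbabilityMeasure P] : Prop :=
  ∀ μ : P2 n, ∃ X : Lp (Euc n) 2 P, P2.law P X = μ

end Derivatives

/-! ### Regularity of the coefficients and of the feedback control -/

section Coefficients

variable {n d : ℕ} {F : Type*} [NormedAddCommGroup F] [NormedSpace ℝ F]

/-- `φ(x,μ,a)` is continuous, differentiable in `x` and in `a` and regularly differentiable
in `μ`, with jointly continuous first derivatives. -/
structure RegularCoefficient (φ : Euc n → P2 n → Euc d → F) : Prop where
  continuous : Continuous fun p : Euc n × P2 n × Euc d => φ p.1 p.2.1 p.2.2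
  diff_x : ∀ μ a, Differentiable ℝ fun x => φ x μ a
  diff_a : ∀ x μ, Differentiable ℝ fun a => φ x μ a
  diff_mu : ∀ x a, RegularlyDifferentiable fun μ => φ x μ a
  continuous_dx : Continuous fun p : Euc n × P2 n × Euc d =>
    fderiv ℝ (fun x => φ x p.2.1 p.2.2) p.1
  continuous_da : Continuous fun p : Euc n × P2 n × Euc d =>
    fderiv ℝ (fun a => φ p.1 p.2.1 a) p.2.2
  continuous_dmu : Continuous fun p : Euc n × P2 n × Euc d × Euc n =>
    dMu (fun μ => φ p.1 μ p.2.2.1) p.2.1 p.2.2.2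

/-- The analogue of `RegularCoefficient` for functions `k(x,μ)`. -/
structure RegularTerminal (k : Euc n → P2 n → F) : Prop where
  continuous : Continuous fun p : Euc n × P2 n => k p.1 p.2
  diff_x : ∀ μ, Differentiable ℝ fun x => k x μ
  diff_mu : ∀ x, RegularlyDifferentiable fun μ => k x μ
  continuous_dx : Continuous fun p : Euc n × P2 n => fderiv ℝ (fun x => k x p.2) p.1
  continuous_dmu : Continuous fun p : Euc n × P2 n × Euc n =>
    dMu (fun μ => k p.1 μ) p.2.1 p.2.2

/-- The first derivatives of `f` are bounded. -/
def BoundedDerivs (f : Euc n → P2 n → Euc d → Euc n) : Prop :=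
  ∃ Λ : ℝ, ∀ x μ a, ‖fderiv ℝ (fun x => f x μ a) x‖ ≤ Λ ∧ ‖fderiv ℝ (fun a => f x μ a) a‖ ≤ Λ ∧
    ∀ y, ‖dMu (fun μ => f x μ a) μ y‖ ≤ Λ

/-- The first derivatives of the running cost `g` have at most linear growth. -/
def LinearGrowthDerivs (g : Euc n → P2 n → Euc d → ℝ) : Prop :=
  ∃ L : ℝ, ∀ x μ a,
    ‖fderiv ℝ (fun x => g x μ a) x‖ ≤ L * (1 + ‖x‖ + μ.norm1 + ‖a‖) ∧
    ‖fderiv ℝ (fun a => g x μ a) a‖ ≤ L * (1 + ‖x‖ + μ.norm1 + ‖a‖) ∧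
    ∀ y, ‖dMu (fun μ => g x μ a) μ y‖ ≤ L * (1 + ‖x‖ + μ.norm1 + ‖a‖ + ‖y‖)

/-- The first derivatives of the terminal cost `k` have at most linear growth. -/
def LinearGrowthDerivsTerminal (k : Euc n → P2 n → ℝ) : Prop :=
  ∃ L : ℝ, ∀ x μ,
    ‖fderiv ℝ (fun x => k x μ) x‖ ≤ L * (1 + ‖x‖ + μ.norm1) ∧
    ∀ y, ‖dMu (fun μ => k x μ) μ y‖ ≤ L * (1 + ‖x‖ + μ.norm1 + ‖y‖)

/-- The (open) cone `|z| < (k₀/2)(1 + |x| + ‖μ‖₁)`. -/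
def cone (n : ℕ) (k₀ : ℝ) : Set (Euc n × P2 n × Euc n) :=
  {p | ‖p.2.2‖ < k₀ / 2 * (1 + ‖p.1‖ + p.2.1.norm1)}

/-- On the cone, `α(x,μ,z)` is continuous with at most linear growth, differentiable in
`(x,z)` and `L`-differentiable in `μ`, with jointly continuous derivatives. -/
structure RegularControl {Ω : Type*} [MeasurableSpace Ω] (P : Measure Ω)
    [IsProbabilityMeasure P] (k₀ : ℝ) (α : Euc n → P2 n → Euc n → Euc d) : Prop where
  continuousOn : ContinuousOn (fun p : Euc n × P2 n × Euc n => α p.1 p.2.1 p.2.2) (cone n k₀)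
  growth : ∃ L : ℝ, ∀ x μ z, (x, μ, z) ∈ cone n k₀ →
    ‖α x μ z‖ ≤ L * (1 + ‖x‖ + μ.norm1 + ‖z‖)
  diff_xz : ∀ x μ z, (x, μ, z) ∈ cone n k₀ →
    DifferentiableAt ℝ (fun p : Euc n × Euc n => α p.1 μ p.2) (x, z)
  continuousOn_dxz : ContinuousOn (fun q : Euc n × P2 n × Euc n =>
    fderiv ℝ (fun p : Euc n × Euc n => α p.1 q.2.1 p.2) (q.1, q.2.2)) (cone n k₀)
  diff_mu : ∃ αμ : Euc n → P2 n → Euc n → Euc n → Euc n →L[ℝ] Euc d,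
    (∀ x μ z, (x, μ, z) ∈ cone n k₀ → HasLDerivAt P (fun ν => α x ν z) (αμ x μ z) μ) ∧
    ContinuousOn (fun q : (Euc n × P2 n × Euc n) × Euc n => αμ q.1.1 q.1.2.1 q.1.2.2 q.2)
      (cone n k₀ ×ˢ univ)

/-- The first order condition `∂_α f(x,μ,α)·z + ∂_α g(x,μ,α) = 0` at `α = α(x,μ,z)`, for
`(x,μ,z)` in the cone. -/
def FirstOrderCondition (k₀ : ℝ) (f : Euc n → P2 n → Euc d → Euc n)
    (g : Euc n → P2 n → Euc d → ℝ) (α : Euc n → P2 n → Euc n → Euc d) : Prop :=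
  ∀ x μ z, (x, μ, z) ∈ cone n k₀ →
    ContinuousLinearMap.adjoint (fderiv ℝ (fun a => f x μ a) (α x μ z)) z +
      gradient (fun a => g x μ a) (α x μ z) = 0

/-- `α(x,μ,z)` minimises `a ↦ f(x,μ,a)·z + g(x,μ,a)`, for `(x,μ,z)` in the cone. -/
def IsMinimiser (k₀ : ℝ) (f : Euc n → P2 n → Euc d → Euc n)
    (g : Euc n → P2 n → Euc d → ℝ) (α : Euc n → P2 n → Euc n → Euc d) : Prop :=
  ∀ x μ z, (x, μ, z) ∈ cone n k₀ →
    ∀ a, ⟪f x μ (α x μ z), z⟫ + g x μ (α x μ z) ≤ ⟪f x μ a, z⟫ + g x μ a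

end Coefficients

/-! ### The forward-backward system -/

section System

variable {n d : ℕ}

/-- The law `X^{t,m}_s # m`; families are written `X t s m x = X^{t,m}_s(x)`. -/
def flow (X : ℝ → ℝ → P2 n → Euc n → Euc n) (t s : ℝ) (m : P2 n) : P2 n :=
  P2.push (X t s m) m

/-- The control `α(X^{t,m}_s(x), X^{t,m}_s # m, Z^{t,m}_s(x))`. -/
def ctrl (α : Euc n → P2 n → Euc n → Euc d) (X Z : ℝ → ℝ → P2 n → Euc n → Euc n)
    (t s : ℝ) (m : P2 n) (x : Euc n) : Euc d :=
  α (X t s m x) (flow X t s m) (Z t s m x)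

/-- The couple `(X,Z)` solves, for every `t ∈ [0,T]` and every `m`, the forward-backward
system, and stays in the cone on which `α` is the optimal control. -/
structure SolvesFBODE (T k₀ : ℝ) (f : Euc n → P2 n → Euc d → Euc n)
    (g : Euc n → P2 n → Euc d → ℝ) (k : Euc n → P2 n → ℝ)
    (α : Euc n → P2 n → Euc n → Euc d) (X Z : ℝ → ℝ → P2 n → Euc n → Euc n) : Prop where
  memLp : ∀ t ∈ Icc 0 T, ∀ m : P2 n, ∀ s ∈ Icc t T, MemLp (X t s m) 2 (m : Measure (Euc n))
  bounded : ∀ t ∈ Icc 0 T, ∀ m : P2 n, ∃ C : ℝ, ∀ s ∈ Icc t T,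
    ∫ x, ‖X t s m x‖ ^ 2 ∂(m : Measure (Euc n)) ≤ C
  mem_cone : ∀ t ∈ Icc 0 T, ∀ m : P2 n, ∀ s ∈ Icc t T, ∀ x,
    (X t s m x, flow X t s m, Z t s m x) ∈ cone n k₀
  forward : ∀ t ∈ Icc 0 T, ∀ m : P2 n, ∀ s ∈ Icc t T, ∀ x,
    HasDerivWithinAt (fun r => X t r m x)
      (f (X t s m x) (flow X t s m) (ctrl α X Z t s m x)) (Icc t T) s
  initial : ∀ t ∈ Icc 0 T, ∀ m : P2 n, ∀ x, X t t m x = x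
  backward : ∀ t ∈ Icc 0 T, ∀ m : P2 n, ∀ s ∈ Icc t T, ∀ x,
    HasDerivWithinAt (fun r => Z t r m x)
      (-(∫ y, (ContinuousLinearMap.adjoint
              (dMu (fun μ => f (X t s m y) μ (ctrl α X Z t s m y)) (flow X t s m) (X t s m x))
              (Z t s m y) +
            (InnerProductSpace.toDual ℝ (Euc n)).symm
              (dMu (fun μ => g (X t s m y) μ (ctrl α X Z t s m y)) (flow X t s m) (X t s m x)))
          ∂(m : Measure (Euc n)))
        - ContinuousLinearMap.adjoint
            (fderiv ℝ (fun ξ => f ξ (flow X t s m) (ctrl α X Z t s m x)) (X t s m x)) (Z t s m x)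
        - gradient (fun ξ => g ξ (flow X t s m) (ctrl α X Z t s m x)) (X t s m x))
      (Icc t T) s
  terminal : ∀ t ∈ Icc 0 T, ∀ m : P2 n, ∀ x,
    Z t T m x =
      (∫ y, (InnerProductSpace.toDual ℝ (Euc n)).symm
          (dMu (fun μ => k (X t T m y) μ) (flow X t T m) (X t T m x)) ∂(m : Measure (Euc n)))
      + gradient (fun ξ => k ξ (flow X t T m)) (X t T m x)

/-- The parameters `(t,s,m,x)` with `0 ≤ t ≤ s ≤ T`. -/
def triangle (n : ℕ) (T : ℝ) : Set (ℝ × ℝ × P2 n × Euc n) :=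
  {p | 0 ≤ p.1 ∧ p.1 ≤ p.2.1 ∧ p.2.1 ≤ T}

/-- The family `Y^{t,m}_s(x)`, `0 ≤ t ≤ s ≤ T`, is jointly continuous, differentiable in `t`
and in `x` and `L`-differentiable in `m`, with jointly continuous derivatives. -/
structure RegularFamily {Ω : Type*} [MeasurableSpace Ω] (P : Measure Ω)
    [IsProbabilityMeasure P] (T : ℝ) (Y : ℝ → ℝ → P2 n → Euc n → Euc n) : Prop where
  continuousOn : ContinuousOn
    (fun p : ℝ × ℝ × P2 n × Euc n => Y p.1 p.2.1 p.2.2.1 p.2.2.2) (triangle n T)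
  diff_t : ∃ Yt : ℝ → ℝ → P2 n → Euc n → Euc n,
    (∀ t s m x, (t, s, m, x) ∈ triangle n T →
      HasDerivWithinAt (fun r => Y r s m x) (Yt t s m x) (Icc 0 s) t) ∧
    ContinuousOn (fun p : ℝ × ℝ × P2 n × Euc n => Yt p.1 p.2.1 p.2.2.1 p.2.2.2) (triangle n T)
  diff_x : ∃ Yx : ℝ → ℝ → P2 n → Euc n → Euc n →L[ℝ] Euc n,
    (∀ t s m x, (t, s, m, x) ∈ triangle n T →
      HasFDerivAt (fun ξ => Y t s m ξ) (Yx t s m x) x) ∧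
    ContinuousOn (fun p : ℝ × ℝ × P2 n × Euc n => Yx p.1 p.2.1 p.2.2.1 p.2.2.2) (triangle n T)
  diff_m : ∃ Ym : ℝ → ℝ → P2 n → Euc n → Euc n → Euc n →L[ℝ] Euc n,
    (∀ t s m x, (t, s, m, x) ∈ triangle n T →
      HasLDerivAt P (fun ν => Y t s ν x) (Ym t s m x) m) ∧
    ContinuousOn (fun q : (ℝ × ℝ × P2 n × Euc n) × Euc n =>
      Ym q.1.1 q.1.2.1 q.1.2.2.1 q.1.2.2.2 q.2) (triangle n T ×ˢ univ)

/-- The terminal cost plus the integrated running cost along the couple `(X,Z)`. -/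
def valueAlong (T : ℝ) (g : Euc n → P2 n → Euc d → ℝ) (k : Euc n → P2 n → ℝ)
    (α : Euc n → P2 n → Euc n → Euc d) (X Z : ℝ → ℝ → P2 n → Euc n → Euc n)
    (t : ℝ) (m : P2 n) : ℝ :=
  (∫ x, k (X t T m x) (flow X t T m) ∂(m : Measure (Euc n))) +
    ∫ s in t..T, ∫ x, g (X t s m x) (flow X t s m) (ctrl α X Z t s m x) ∂(m : Measure (Euc n))

/-- All integrals in `valueAlong` converge. -/
def ValueWellDefined (T : ℝ) (g : Euc n → P2 n → Euc d → ℝ) (k : Euc n → P2 n → ℝ)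
    (α : Euc n → P2 n → Euc n → Euc d) (X Z : ℝ → ℝ → P2 n → Euc n → Euc n) : Prop :=
  ∀ t ∈ Icc 0 T, ∀ m : P2 n,
    Integrable (fun x => k (X t T m x) (flow X t T m)) (m : Measure (Euc n)) ∧
    (∀ s ∈ Icc t T, Integrable
      (fun x => g (X t s m x) (flow X t s m) (ctrl α X Z t s m x)) (m : Measure (Euc n))) ∧
    IntervalIntegrable (fun s => ∫ x, g (X t s m x) (flow X t s m) (ctrl α X Z t s m x)
      ∂(m : Measure (Euc n))) volume t T

end System

/-! ### The Bellman equation -/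

section Bellman

variable {n d : ℕ}

/-- `f(x,μ,α(x,μ,z))·z + g(x,μ,α(x,μ,z))`. -/
def feedbackHamiltonian (f : Euc n → P2 n → Euc d → Euc n) (g : Euc n → P2 n → Euc d → ℝ)
    (α : Euc n → P2 n → Euc n → Euc d) (x : Euc n) (μ : P2 n) (z : Euc n) : ℝ :=
  ⟪f x μ (α x μ z), z⟫ + g x μ (α x μ z)

/-- The Hamiltonian `h(x,μ,z) = min_a (f(x,μ,a)·z + g(x,μ,a))`. -/
def hamiltonian (f : Euc n → P2 n → Euc d → Euc n) (g : Euc n → P2 n → Euc d → ℝ)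
    (x : Euc n) (μ : P2 n) (z : Euc n) : ℝ :=
  ⨅ a : Euc d, (⟪f x μ a, z⟫ + g x μ a)

/-- `v` is `L`-differentiable on the whole of `P2 n`, with derivative `∂_m v(m)(x) = D m x`. -/
def HasLGradient {Ω : Type*} [MeasurableSpace Ω] (P : Measure Ω) [IsProbabilityMeasure P]
    (v : P2 n → ℝ) (D : P2 n → Euc n → Euc n) : Prop :=
  ∀ m : P2 n, HasLDerivAt P v (fun x => innerSL ℝ (D m x)) m

/-- `v` is a classical solution on `[0,T]` of
`∂_t v(t,m) + ∫ H(x,m,∂_m v(t,m)(x)) dm(x) = 0`, `v(T,m) = ∫ k(x,m) dm(x)`. -/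
def IsClassicalSolution {Ω : Type*} [MeasurableSpace Ω] (P : Measure Ω)
    [IsProbabilityMeasure P] (T : ℝ) (H : Euc n → P2 n → Euc n → ℝ) (k : Euc n → P2 n → ℝ)
    (v : ℝ → P2 n → ℝ) : Prop :=
  ∃ (vt : ℝ → P2 n → ℝ) (vm : ℝ → P2 n → Euc n → Euc n),
    (∀ t ∈ Icc 0 T, ∀ m, HasDerivWithinAt (fun r => v r m) (vt t m) (Icc 0 T) t) ∧
    (∀ t ∈ Icc 0 T, HasLGradient P (v t) (vm t)) ∧
    (∀ t ∈ Icc 0 T, ∀ m : P2 n,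
      Integrable (fun x => H x m (vm t m x)) (m : Measure (Euc n)) ∧
      vt t m + ∫ x, H x m (vm t m x) ∂(m : Measure (Euc n)) = 0) ∧
    ∀ m : P2 n, Integrable (fun x => k x m) (m : Measure (Euc n)) ∧
      v T m = ∫ x, k x m ∂(m : Measure (Euc n))

end Bellman

end MFC

end

set_option linter.unusedSectionVars false

noncomputable section

namespace MFC

namespace P2

variable {n : ℕ}

/-! The proof is Pontryagin's costate argument carried out on finitely supported laws, followed by
an extension by density.

Fix a finite measurable partition of `Ω`. A random vector constant on its cells has a law with fixed
weights `w i` and atoms `x i`, and the flow moves the atoms while keeping the weights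
(`flow_atoms`). On such laws the forward-backward system is an ordinary differential system for
finitely many particles, integrals are weighted sums, and derivatives in the measure become ordinary
partial derivatives in the positions.

Write `R` for the mean running cost, `F` for the drift and `ζ` for the costates along a reference
trajectory. The derivative of `R + ⟨ζ, F⟩` in states and controls, evaluated on that trajectory, is
`-⟨ζ', δq⟩`. Indeed the control variations cancel by the first order condition, and the mean-field
terms match the adjoint equation after exchanging a double sum (`hamiltonian_deriv_eq`,
`exists_adjoint_deriv`). If a second trajectory `q` stays within `O(ε)` of the reference `q₀`, the
function `∫ (γ - γ₀) + ⟨ζ, q - q₀⟩` therefore has derivative `o(ε)` (`cost_expansion`), and the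
terminal condition accounts for the terminal cost. The outcome is `value_expansion`: starting from
`x'` at time `t'`, the value equals the remaining reference cost plus `⟨ζ(t'), x' - q₀(t')⟩` up to
`o(ε)`. The derivatives of `X` and `Z` in the initial data enter only through Lipschitz bounds.
Taking `t' = t` gives the derivative in the atoms; taking `x' = x` and `t'` decreasing to `t` gives
the right derivative in time.

For the extension, simple random vectors are dense in `L²`, and any two of them share a partition,
so the segment between them is covered by the particle result. The growth bound `exists_growth` and
dominated convergence along subsequences show that the lifted value and both candidate derivatives
are continuous. The mean value inequalities on simple vectors then pass to all of `L²`
(`hasFDerivAt_of_dense`, `hasDerivWithinAt_of_dense`). -/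

theorem ext' {μ ν : P2 n} (h : (μ : Measure (Euc n)) = ν) : μ = ν := by
  cases μ; cases ν; cases h; rfl

/-! ### Wasserstein estimates and the lift of laws to `L²`. -/

theorem W2_le_of_isCoupling {μ ν : P2 n} {π : Measure (Euc n × Euc n)} (h : IsCoupling μ ν π) :
    W2 μ ν ≤ √(∫ p, ‖p.1 - p.2‖ ^ 2 ∂π) := by
  refine Real.sqrt_le_sqrt (csInf_le ⟨0, ?_⟩ ⟨π, h, rfl⟩)
  rintro c ⟨ρ, -, rfl⟩
  positivity

/-- By the definition of the topology, an open set contains a `W2`-ball about each of its points.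
Only this direction is needed, so neither the triangle inequality for `W2` nor openness of balls is
ever used. -/
theorem tendsto_of_W2 {β : Type*} {l : Filter β} {u : β → P2 n} {μ : P2 n} {b : β → ℝ}
    (hb : Tendsto b l (𝓝 0)) (h : ∀ᶠ j in l, W2 μ (u j) ≤ b j) : Tendsto u l (𝓝 μ) := by
  rw [tendsto_nhds]
  intro U hU hμ
  obtain ⟨ε, hε, hUε⟩ := hU μ hμ
  filter_upwards [h, hb.eventually_lt_const hε] with j h1 h2
  exact hUε _ (h1.trans_lt h2)

variable {Ω : Type*} [MeasurableSpace Ω] {P : Measure Ω} [IsProbabilityMeasure P]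

theorem integral_law {F : Type*} [NormedAddCommGroup F] [NormedSpace ℝ F] (ξ : Lp (Euc n) 2 P)
    {φ : Euc n → F} (hφ : AEStronglyMeasurable φ (law P ξ : Measure (Euc n))) :
    ∫ x, φ x ∂(law P ξ : Measure (Euc n)) = ∫ ω, φ (ξ ω) ∂P :=
  integral_map (Lp.aestronglyMeasurable ξ).aemeasurable hφ

theorem integrable_law_iff {F : Type*} [NormedAddCommGroup F] (ξ : Lp (Euc n) 2 P)
    {φ : Euc n → F} (hφ : AEStronglyMeasurable φ (law P ξ : Measure (Euc n))) :
    Integrable φ (law P ξ : Measure (Euc n)) ↔ Integrable (fun ω => φ (ξ ω)) P :=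
  integrable_map_measure hφ (Lp.aestronglyMeasurable ξ).aemeasurable

theorem norm_sq_Lp (ξ : Lp (Euc n) 2 P) : ‖ξ‖ ^ 2 = ∫ ω, ‖ξ ω‖ ^ 2 ∂P := by
  rw [← real_inner_self_eq_norm_sq, L2.inner_def]
  simp

theorem integral_norm_sub_sq (ξ η : Lp (Euc n) 2 P) :
    ∫ ω, ‖ξ ω - η ω‖ ^ 2 ∂P = ‖ξ - η‖ ^ 2 := by
  rw [norm_sq_Lp]
  refine integral_congr_ae ?_
  filter_upwards [Lp.coeFn_sub ξ η] with ω h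
  rw [h, Pi.sub_apply]

theorem norm1_law (ξ : Lp (Euc n) 2 P) : (law P ξ).norm1 = ∫ ω, ‖ξ ω‖ ∂P :=
  integral_law ξ (by fun_prop)

theorem integrable_norm_Lp (ξ : Lp (Euc n) 2 P) : Integrable (fun ω => ‖ξ ω‖) P :=
  ((Lp.memLp ξ).integrable one_le_two).norm

theorem integrable_norm_sq_Lp (ξ : Lp (Euc n) 2 P) : Integrable (fun ω => ‖ξ ω‖ ^ 2) P :=
  (Lp.memLp ξ).integrable_norm_pow two_ne_zero

theorem integral_norm_le_norm (ξ : Lp (Euc n) 2 P) : ∫ ω, ‖ξ ω‖ ∂P ≤ ‖ξ‖ := by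
  have h1 : ∫ ω, ‖ξ ω‖ ∂P = (eLpNorm ξ 1 P).toReal := by
    rw [eLpNorm_one_eq_lintegral_enorm, integral_norm_eq_lintegral_enorm
      (Lp.aestronglyMeasurable ξ)]
  rw [h1, Lp.norm_def]
  exact ENNReal.toReal_mono (Lp.eLpNorm_ne_top ξ)
    (eLpNorm_le_eLpNorm_of_exponent_le one_le_two (Lp.aestronglyMeasurable ξ))

theorem norm1_nonneg (μ : P2 n) : 0 ≤ μ.norm1 := integral_nonneg fun _ => norm_nonneg _

theorem abs_norm1_law_sub_le (ξ η : Lp (Euc n) 2 P) :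
    |(law P ξ).norm1 - (law P η).norm1| ≤ ‖ξ - η‖ := by
  rw [norm1_law, norm1_law, ← integral_sub (integrable_norm_Lp ξ) (integrable_norm_Lp η)]
  refine (abs_integral_le_integral_abs).trans ((integral_mono_ae ?_ (integrable_norm_Lp (ξ - η))
    ?_).trans (integral_norm_le_norm _))
  · exact ((integrable_norm_Lp ξ).sub (integrable_norm_Lp η)).abs
  · filter_upwards [Lp.coeFn_sub ξ η] with ω h
    rw [h, Pi.sub_apply]
    exact abs_norm_sub_norm_le _ _

theorem continuous_norm1_law : Continuous fun ξ : Lp (Euc n) 2 P => (law P ξ).norm1 := by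
  rw [continuous_iff_continuousAt]
  intro η
  rw [ContinuousAt, tendsto_iff_norm_sub_tendsto_zero]
  refine squeeze_zero (fun _ => norm_nonneg _) (fun ξ => abs_norm1_law_sub_le ξ η) ?_
  have : Continuous fun ξ : Lp (Euc n) 2 P => ‖ξ - η‖ := by fun_prop
  simpa using this.tendsto η

/-- An explicit coupling: mass `a` stays on `ξ`, mass `b` stays on `η`, mass `c` travels from `ξ` to
`η` and mass `e` from `η` to `ξ`. Only the mass `c + e` pays the cost `‖ξ - η‖ ^ 2`. -/
theorem W2_mix_le_aux (ξ η : Lp (Euc n) 2 P) (θ θ' : unitInterval) {a b c e : ℝ}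
    (ha : 0 ≤ a) (hb : 0 ≤ b) (hc : 0 ≤ c) (he : 0 ≤ e) (h1 : a + c = θ) (h2 : b + e = 1 - θ)
    (h3 : a + e = θ') (h4 : b + c = 1 - θ') :
    W2 (mix θ (law P ξ) (law P η)) (mix θ' (law P ξ) (law P η)) ≤ √(c + e) * ‖ξ - η‖ := by
  have mξ : AEMeasurable ξ P := (Lp.aestronglyMeasurable ξ).aemeasurable
  have mη : AEMeasurable η P := (Lp.aestronglyMeasurable η).aemeasurable
  let π : Measure (Euc n × Euc n) :=
    ENNReal.ofReal a • P.map (fun ω => (ξ ω, ξ ω)) + ENNReal.ofReal b • P.map (fun ω => (η ω, η ω))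
      + ENNReal.ofReal c • P.map (fun ω => (ξ ω, η ω))
      + ENNReal.ofReal e • P.map (fun ω => (η ω, ξ ω))
  have hfst : ∀ u v : Ω → Euc n, AEMeasurable u P → AEMeasurable v P →
      (P.map (fun ω => (u ω, v ω))).map Prod.fst = P.map u := by
    intro u v hu hv
    rw [AEMeasurable.map_map_of_aemeasurable (by fun_prop) (by fun_prop)]
    rfl
  have hsnd : ∀ u v : Ω → Euc n, AEMeasurable u P → AEMeasurable v P →
      (P.map (fun ω => (u ω, v ω))).map Prod.snd = P.map v := by
    intro u v hu hv
    rw [AEMeasurable.map_map_of_aemeasurable (by fun_prop) (by fun_prop)]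
    rfl
  have hπ : IsCoupling (mix θ (law P ξ) (law P η)) (mix θ' (law P ξ) (law P η)) π := by
    constructor
    · simp only [π, Measure.map_add _ _ measurable_fst, Measure.map_smul, mix, law, ofMap]
      rw [hfst _ _ mξ mξ, hfst _ _ mη mη, hfst _ _ mξ mη, hfst _ _ mη mξ, ← h2, ← h1,
        ENNReal.ofReal_add ha hc, ENNReal.ofReal_add hb he, add_smul, add_smul]
      abel
    · simp only [π, Measure.map_add _ _ measurable_snd, Measure.map_smul, mix, law, ofMap]
      rw [hsnd _ _ mξ mξ, hsnd _ _ mη mη, hsnd _ _ mξ mη, hsnd _ _ mη mξ, ← h4, ← h3,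
        ENNReal.ofReal_add ha he, ENNReal.ofReal_add hb hc, add_smul, add_smul]
      abel
  have hint : ∀ u v : Lp (Euc n) 2 P,
      Integrable (fun p : Euc n × Euc n => ‖p.1 - p.2‖ ^ 2) (P.map (fun ω => (u ω, v ω))) := by
    intro u v
    have mu : AEMeasurable u P := (Lp.aestronglyMeasurable u).aemeasurable
    have mv : AEMeasurable v P := (Lp.aestronglyMeasurable v).aemeasurable
    rw [integrable_map_measure (by fun_prop) (by fun_prop)]
    refine (integrable_norm_sq_Lp (u - v)).congr ?_
    filter_upwards [Lp.coeFn_sub u v] with ω h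
    rw [h]
    rfl
  have hval : ∀ u v : Lp (Euc n) 2 P,
      ∫ p, ‖p.1 - p.2‖ ^ 2 ∂(P.map (fun ω => (u ω, v ω))) = ‖u - v‖ ^ 2 := by
    intro u v
    have mu : AEMeasurable u P := (Lp.aestronglyMeasurable u).aemeasurable
    have mv : AEMeasurable v P := (Lp.aestronglyMeasurable v).aemeasurable
    rw [integral_map (by fun_prop) (by fun_prop)]
    exact integral_norm_sub_sq u v
  refine (W2_le_of_isCoupling hπ).trans (le_of_eq ?_)
  have hval' : ∫ p, ‖p.1 - p.2‖ ^ 2 ∂π = (c + e) * ‖ξ - η‖ ^ 2 := by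
    have i1 := (hint ξ ξ).smul_measure (c := ENNReal.ofReal a) ENNReal.ofReal_ne_top
    have i2 := (hint η η).smul_measure (c := ENNReal.ofReal b) ENNReal.ofReal_ne_top
    have i3 := (hint ξ η).smul_measure (c := ENNReal.ofReal c) ENNReal.ofReal_ne_top
    have i4 := (hint η ξ).smul_measure (c := ENNReal.ofReal e) ENNReal.ofReal_ne_top
    rw [integral_add_measure ((i1.add_measure i2).add_measure i3) i4,
      integral_add_measure (i1.add_measure i2) i3, integral_add_measure i1 i2]
    simp only [integral_smul_measure, hval, ENNReal.toReal_ofReal ha, ENNReal.toReal_ofReal hb,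
      ENNReal.toReal_ofReal hc, ENNReal.toReal_ofReal he, smul_eq_mul, norm_sub_rev η ξ]
    simp
    ring
  rw [hval', Real.sqrt_mul (by positivity), Real.sqrt_sq (norm_nonneg _)]

theorem W2_mix_le (ξ η : Lp (Euc n) 2 P) (θ θ' : unitInterval) :
    W2 (mix θ (law P ξ) (law P η)) (mix θ' (law P ξ) (law P η)) ≤
      √|(θ : ℝ) - θ'| * ‖ξ - η‖ := by
  rcases le_total (θ : ℝ) θ' with h | h
  · have := W2_mix_le_aux ξ η θ θ' θ.2.1 (sub_nonneg.2 θ'.2.2) le_rfl (sub_nonneg.2 h)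
      (by ring) (by ring) (by ring) (by ring)
    rwa [zero_add, ← abs_of_nonneg (sub_nonneg.2 h), abs_sub_comm] at this
  · have := W2_mix_le_aux ξ η θ θ' θ'.2.1 (sub_nonneg.2 θ.2.2) (sub_nonneg.2 h) le_rfl
      (by ring) (by ring) (by ring) (by ring)
    rwa [add_zero, ← abs_of_nonneg (sub_nonneg.2 h)] at this

theorem mix_zero (μ ν : P2 n) : mix 0 μ ν = ν := ext' (by simp [mix])

theorem mix_one (μ ν : P2 n) : mix 1 μ ν = μ := ext' (by simp [mix])

/-- The bound is uniform in `θ`: all mixtures of two nearby laws stay near either of them, which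
controls the path in the definition of the linear functional derivative. -/
theorem W2_right_mix_le (ξ η : Lp (Euc n) 2 P) (θ : unitInterval) :
    W2 (law P η) (mix θ (law P ξ) (law P η)) ≤ ‖ξ - η‖ := by
  have h := W2_mix_le ξ η 0 θ
  rw [mix_zero] at h
  refine h.trans (mul_le_of_le_one_left (norm_nonneg _) (Real.sqrt_le_one.2 ?_))
  simpa [abs_of_nonneg θ.2.1] using θ.2.2

theorem W2_law_le (ξ η : Lp (Euc n) 2 P) : W2 (law P η) (law P ξ) ≤ ‖ξ - η‖ := by
  have h := W2_right_mix_le ξ η 1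
  rwa [mix_one] at h

theorem continuous_law : Continuous fun ξ : Lp (Euc n) 2 P => law P ξ := by
  rw [continuous_iff_continuousAt]
  intro η
  have : Continuous fun ξ : Lp (Euc n) 2 P => ‖ξ - η‖ := by fun_prop
  exact tendsto_of_W2 (b := fun ξ => ‖ξ - η‖) (by simpa using this.tendsto η)
    (Eventually.of_forall fun ξ => W2_law_le ξ η)

theorem continuous_mix_law (ξ η : Lp (Euc n) 2 P) :
    Continuous fun θ : unitInterval => mix θ (law P ξ) (law P η) := by
  rw [continuous_iff_continuousAt]
  intro θ
  have : Continuous fun θ' : unitInterval => √|(θ : ℝ) - θ'| * ‖ξ - η‖ := by fun_prop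
  exact tendsto_of_W2 (b := fun θ' : unitInterval => √|(θ : ℝ) - θ'| * ‖ξ - η‖)
    (by simpa using this.tendsto θ) (Eventually.of_forall fun θ' => W2_mix_le ξ η θ θ')

/-- The composition of `Φ ∈ L²` of the law of `ξ` with `ξ`. -/
def compLp (ξ : Lp (Euc n) 2 P) (Φ : Euc n → Euc n)
    (h : MemLp Φ 2 (law P ξ : Measure (Euc n))) : Lp (Euc n) 2 P :=
  (((memLp_map_measure_iff h.aestronglyMeasurable
    (Lp.aestronglyMeasurable ξ).aemeasurable).1 h).toLp (Φ ∘ ξ))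

theorem coeFn_compLp (ξ : Lp (Euc n) 2 P) (Φ : Euc n → Euc n)
    (h : MemLp Φ 2 (law P ξ : Measure (Euc n))) : compLp ξ Φ h =ᵐ[P] fun ω => Φ (ξ ω) :=
  MemLp.coeFn_toLp _

theorem push_law (ξ : Lp (Euc n) 2 P) (Φ : Euc n → Euc n)
    (h : MemLp Φ 2 (law P ξ : Measure (Euc n))) : push Φ (law P ξ) = law P (compLp ξ Φ h) := by
  rw [push, dif_pos h]
  refine ext' ?_
  change (P.map ξ).map Φ = P.map (compLp ξ Φ h)
  rw [AEMeasurable.map_map_of_aemeasurable h.aestronglyMeasurable.aemeasurable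
    (Lp.aestronglyMeasurable ξ).aemeasurable]
  exact (Measure.map_congr (coeFn_compLp ξ Φ h)).symm

theorem push_id (μ : P2 n) {Φ : Euc n → Euc n} (h : ∀ x, Φ x = x) : push Φ μ = μ := by
  obtain rfl : Φ = id := funext h
  rw [push, dif_pos (show MemLp id 2 (μ : Measure (Euc n)) from μ.memLp)]
  exact ext' Measure.map_id

/-! ### Laws of random vectors that are constant on the cells of a finite partition. -/

section Atoms

variable {ι : Type*} [Fintype ι]

/-- The weights of the atoms of a finite partition. -/
def wt (P : Measure Ω) (σ : SimpleFunc Ω ι) (i : ι) : ℝ := P.real (σ ⁻¹' {i})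

/-- The random vector with value `x i` on the `i`-th set of a finite partition. -/
def atomLp (P : Measure Ω) [IsProbabilityMeasure P] (σ : SimpleFunc Ω ι) :
    (ι → Euc n) →L[ℝ] Lp (Euc n) 2 P :=
  LinearMap.toContinuousLinearMap
    { toFun := fun x => ((σ.map x).memLp_of_isFiniteMeasure 2 P).toLp
      map_add' := fun _ _ => rfl
      map_smul' := fun _ _ => rfl }

theorem coeFn_atomLp (σ : SimpleFunc Ω ι) (x : ι → Euc n) :
    atomLp P σ x =ᵐ[P] fun ω => x (σ ω) :=
  MemLp.coeFn_toLp ((σ.map x).memLp_of_isFiniteMeasure 2 P)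

theorem wt_nonneg (σ : SimpleFunc Ω ι) (i : ι) : 0 ≤ wt P σ i := measureReal_nonneg

theorem integral_atoms {F : Type*} [NormedAddCommGroup F] [NormedSpace ℝ F] [CompleteSpace F]
    (σ : SimpleFunc Ω ι) (φ : ι → F) : ∫ ω, φ (σ ω) ∂P = ∑ i, wt P σ i • φ i := by
  classical
  have h := SimpleFunc.integral_eq_sum_of_subset (f := σ.map φ) (μ := P)
    (s := Finset.univ.image φ) (by intro y; simp; tauto)
  have h1 : ∀ ω, φ (σ ω) = ∑ i, (σ ⁻¹' {i}).indicator (fun _ => φ i) ω := by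
    intro ω
    rw [Finset.sum_eq_single (σ ω)]
    · simp
    · intro b _ hb
      simp [Set.indicator, Ne.symm hb]
    · simp
  simp_rw [h1]
  rw [integral_finsetSum]
  · refine Finset.sum_congr rfl fun i _ => ?_
    rw [integral_indicator (σ.measurableSet_fiber i)]
    simp [wt]
  · intro i _
    exact (integrable_const _).indicator (σ.measurableSet_fiber i)

theorem sum_wt (σ : SimpleFunc Ω ι) : ∑ i, wt P σ i = 1 := by
  have := integral_atoms (P := P) σ (fun _ => (1 : ℝ))
  simpa using this.symm

/-- The law is carried by the finite set `range x`, on which any function agrees with a finite sum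
of indicators. No regularity of `φ` is needed. -/
theorem aestronglyMeasurable_law_atomLp {F : Type*} [NormedAddCommGroup F]
    (σ : SimpleFunc Ω ι) (x : ι → Euc n) (φ : Euc n → F) :
    AEStronglyMeasurable φ (law P (atomLp P σ x) : Measure (Euc n)) := by
  classical
  have hfin : (range x).Finite := finite_range x
  have hae : ∀ᵐ y ∂(law P (atomLp P σ x) : Measure (Euc n)), y ∈ range x := by
    change ∀ᵐ y ∂(P.map _), _
    refine (ae_map_iff (p := fun y => y ∈ range x) (Lp.aestronglyMeasurable _).aemeasurable
      hfin.measurableSet).2 ?_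
    filter_upwards [coeFn_atomLp (P := P) σ x] with ω h
    rw [h]
    exact mem_range_self _
  refine ⟨∑ y ∈ hfin.toFinset, (Set.indicator {y} fun _ => φ y), ?_, ?_⟩
  · exact Finset.stronglyMeasurable_sum _ fun y _ =>
      stronglyMeasurable_const.indicator (measurableSet_singleton y)
  · filter_upwards [hae] with y hy
    rw [Finset.sum_apply, Finset.sum_eq_single y]
    · simp
    · intro b _ hb
      simp [Set.indicator, Ne.symm hb]
    · intro h
      exact absurd (hfin.mem_toFinset.2 hy) h

theorem integral_law_atomLp {F : Type*} [NormedAddCommGroup F] [NormedSpace ℝ F] [CompleteSpace F]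
    (σ : SimpleFunc Ω ι) (x : ι → Euc n) (φ : Euc n → F) :
    ∫ y, φ y ∂(law P (atomLp P σ x) : Measure (Euc n)) = ∑ i, wt P σ i • φ (x i) := by
  rw [integral_law _ (aestronglyMeasurable_law_atomLp σ x φ), ← integral_atoms σ fun i => φ (x i)]
  refine integral_congr_ae ?_
  filter_upwards [coeFn_atomLp (P := P) σ x] with ω h
  rw [h]

theorem integrable_law_atomLp {F : Type*} [NormedAddCommGroup F]
    (σ : SimpleFunc Ω ι) (x : ι → Euc n) (φ : Euc n → F) :
    Integrable φ (law P (atomLp P σ x) : Measure (Euc n)) := by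
  rw [integrable_law_iff _ (aestronglyMeasurable_law_atomLp σ x φ)]
  refine ((SimpleFunc.integrable_of_isFiniteMeasure (σ.map fun i => φ (x i)))).congr ?_
  filter_upwards [coeFn_atomLp (P := P) σ x] with ω h
  rw [h]
  rfl

/-- Square-integrability is automatic for finitely many atoms, so the default branch of `push` never
occurs here. -/
theorem push_law_atomLp (σ : SimpleFunc Ω ι) (x : ι → Euc n) (Φ : Euc n → Euc n) :
    push Φ (law P (atomLp P σ x)) = law P (atomLp P σ fun i => Φ (x i)) := by
  have h : MemLp Φ 2 (law P (atomLp P σ x) : Measure (Euc n)) := by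
    rw [memLp_two_iff_integrable_sq_norm (aestronglyMeasurable_law_atomLp σ x Φ)]
    exact integrable_law_atomLp σ x _
  rw [push_law _ _ h]
  congr 1
  refine Lp.ext ?_
  filter_upwards [coeFn_compLp _ Φ h, coeFn_atomLp (P := P) σ x,
    coeFn_atomLp (P := P) σ fun i => Φ (x i)] with ω h1 h2 h3
  rw [h1, h2, h3]

end Atoms

end P2

/-! ### Consequences of the linear functional derivative. -/

section LinearDerivative

variable {n : ℕ} {F : Type*} [NormedAddCommGroup F] [NormedSpace ℝ F] [CompleteSpace F]
variable {Ω : Type*} [MeasurableSpace Ω] {P : Measure Ω} [IsProbabilityMeasure P]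

theorem RegularlyDifferentiable.isLinFunDeriv {Φ : P2 n → F} (h : RegularlyDifferentiable Φ) :
    IsLinFunDeriv Φ (linFunDeriv Φ) := by
  rw [linFunDeriv, dif_pos h.exists_deriv]
  exact h.exists_deriv.choose_spec

theorem RegularlyDifferentiable.hasFDerivAt {Φ : P2 n → F} (h : RegularlyDifferentiable Φ)
    (μ : P2 n) (x : Euc n) : HasFDerivAt (linFunDeriv Φ μ) (dMu Φ μ x) x :=
  (h.differentiable μ x).hasFDerivAt

/-- Differentiability along finitely supported measures with fixed weights. -/
theorem RegularlyDifferentiable.hasFDerivAt_atoms {ι : Type*} [Fintype ι] {Φ : P2 n → F}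
    (h : RegularlyDifferentiable Φ) (σ : SimpleFunc Ω ι) (q : ι → Euc n) :
    HasFDerivAt (fun q : ι → Euc n => Φ (P2.law P (P2.atomLp P σ q)))
      (∑ i, P2.wt P σ i • (dMu Φ (P2.law P (P2.atomLp P σ q)) (q i)).comp
        (ContinuousLinearMap.proj (R := ℝ) (φ := fun _ : ι => Euc n) i)) q := by
  set ℓ : (ι → Euc n) → P2 n := fun q => P2.law P (P2.atomLp P σ q) with hℓ
  rw [hasFDerivAt_iff_isLittleO, Asymptotics.isLittleO_iff]
  intro ε hε
  have hlin := h.isLinFunDeriv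
  -- the derivative is close to its value at the base point on small mixtures
  have hcont : ∀ i, ∀ᶠ q' in 𝓝 q, ∀ θ : unitInterval, ∀ w ∈ segment ℝ (q i) (q' i),
      ‖dMu Φ (P2.mix θ (ℓ q') (ℓ q)) w - dMu Φ (ℓ q) (q i)‖ ≤ ε := by
    intro i
    have hc := (h.continuous.tendsto (ℓ q, q i))
    have hev := hc (Metric.closedBall_mem_nhds _ hε)
    rw [mem_map, mem_nhds_prod_iff] at hev
    obtain ⟨U, hU, V, hV, hUV⟩ := hev
    obtain ⟨U', hU'U, hU'o, hqU'⟩ := mem_nhds_iff.1 hU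
    -- The definition of the topology turns the open set into a `W2`-radius, which then bounds the
    -- allowed displacement in `L²`.
    obtain ⟨δ, hδ, hδU⟩ := hU'o _ hqU'
    obtain ⟨r, hr, hrV⟩ := Metric.mem_nhds_iff.1 hV
    have e1 : ∀ᶠ q' in 𝓝 q, ‖P2.atomLp P σ q' - P2.atomLp P σ q‖ < δ := by
      have : Continuous fun q' : ι → Euc n => ‖P2.atomLp P σ q' - P2.atomLp P σ q‖ := by fun_prop
      have h0 := this.tendsto q
      simp only [sub_self, norm_zero] at h0
      exact h0.eventually_lt_const hδ
    have e2 : ∀ᶠ q' in 𝓝 q, q' i ∈ Metric.ball (q i) r :=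
      (continuous_apply i).tendsto q (Metric.ball_mem_nhds _ hr)
    filter_upwards [e1, e2] with q' h1 h2 θ w hw
    have hwV : w ∈ V := hrV ((convex_ball _ _).segment_subset (Metric.mem_ball_self hr) h2 hw)
    have hmU : P2.mix θ (ℓ q') (ℓ q) ∈ U :=
      hU'U (hδU _ ((P2.W2_right_mix_le _ _ θ).trans_lt h1))
    have := hUV (Set.mk_mem_prod hmU hwV)
    simpa [dist_eq_norm] using this
  filter_upwards [eventually_all.2 hcont] with q' hq'
  have hsub := hlin.sub_eq (ℓ q') (ℓ q)
  set D := ∑ i, P2.wt P σ i • (dMu Φ (ℓ q) (q i)).comp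
        (ContinuousLinearMap.proj (R := ℝ) (φ := fun _ : ι => Euc n) i) with hD
  have hDa : D (q' - q) = ∑ i, P2.wt P σ i • dMu Φ (ℓ q) (q i) (q' i - q i) := by
    simp [hD]
  -- Both laws have the same weights, so the difference of the two integrals is a weighted sum of
  -- increments of the functional derivative from `q i` to `q' i`.
  have hsub' : Φ (ℓ q') - Φ (ℓ q) = ∫ θ : unitInterval, ∑ i, P2.wt P σ i •
      (linFunDeriv Φ (P2.mix θ (ℓ q') (ℓ q)) (q' i) -
        linFunDeriv Φ (P2.mix θ (ℓ q') (ℓ q)) (q i)) := by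
    rw [hsub]
    refine integral_congr_ae (Eventually.of_forall fun θ => ?_)
    simp only [hℓ, P2.integral_law_atomLp, smul_sub, Finset.sum_sub_distrib]
  have hmix : Continuous fun θ : unitInterval => P2.mix θ (ℓ q') (ℓ q) :=
    P2.continuous_mix_law _ _
  have hci : Continuous fun θ : unitInterval => ∑ i, P2.wt P σ i •
      (linFunDeriv Φ (P2.mix θ (ℓ q') (ℓ q)) (q' i) -
        linFunDeriv Φ (P2.mix θ (ℓ q') (ℓ q)) (q i)) := by
    refine continuous_finsetSum _ fun i _ => Continuous.const_smul (Continuous.sub ?_ ?_) _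
    · exact hlin.continuous.comp (hmix.prodMk continuous_const)
    · exact hlin.continuous.comp (hmix.prodMk continuous_const)
  have hii : Integrable (fun θ : unitInterval => ∑ i, P2.wt P σ i •
      (linFunDeriv Φ (P2.mix θ (ℓ q') (ℓ q)) (q' i) -
        linFunDeriv Φ (P2.mix θ (ℓ q') (ℓ q)) (q i))) :=
    hci.integrable_of_hasCompactSupport (HasCompactSupport.of_compactSpace _)
  have hconst : D (q' - q) = ∫ _ : unitInterval, D (q' - q) := by simp
  rw [hsub', hconst, ← integral_sub hii (integrable_const _)]
  refine (norm_integral_le_of_norm_le_const (C := ε * ‖q' - q‖)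
    (Eventually.of_forall fun θ => ?_)).trans (by simp)
  rw [hDa, ← Finset.sum_sub_distrib]
  calc _ ≤ ∑ i, P2.wt P σ i * (ε * ‖q' - q‖) := by
        refine norm_sum_le_of_le _ fun i _ => ?_
        rw [← smul_sub, norm_smul, Real.norm_of_nonneg (P2.wt_nonneg σ i)]
        refine mul_le_mul_of_nonneg_left ?_ (P2.wt_nonneg σ i)
        -- Mean value inequality for the functional derivative at the mixture, on the segment from
        -- `q i` to `q' i`, where its gradient is within `ε` of the gradient at the base point.
        refine ((convex_segment (q i) (q' i)).norm_image_sub_le_of_norm_hasFDerivWithin_le'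
          (fun w _ => (h.hasFDerivAt _ w).hasFDerivWithinAt) (fun w hw => hq' i θ w hw)
          (left_mem_segment _ _ _) (right_mem_segment _ _ _)).trans ?_
        exact mul_le_mul_of_nonneg_left (norm_le_pi_norm (q' - q) i) hε.le
    _ = ε * ‖q' - q‖ := by rw [← Finset.sum_mul, P2.sum_wt, one_mul]

/-- The unit mass at the origin. -/
def P2.diracZero (n : ℕ) : P2 n where
  toMeasure := Measure.dirac 0
  isProb := inferInstance
  memLp := by
    rw [memLp_two_iff_integrable_sq_norm (by fun_prop)]
    exact integrable_dirac (by simp)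

theorem P2.integrable_sq (μ : P2 n) : Integrable (fun y => ‖y‖ ^ 2) (μ : Measure (Euc n)) :=
  μ.memLp.integrable_norm_pow two_ne_zero

theorem P2.integrable_norm (μ : P2 n) : Integrable (fun y => ‖y‖) (μ : Measure (Euc n)) :=
  (μ.memLp.integrable one_le_two).norm

theorem P2.norm1_mix_diracZero_le (θ : unitInterval) (μ : P2 n) :
    (P2.mix θ μ (P2.diracZero n)).norm1 ≤ μ.norm1 := by
  have i1 := μ.integrable_norm.smul_measure (c := ENNReal.ofReal θ) ENNReal.ofReal_ne_top
  have i2 := (P2.diracZero n).integrable_norm.smul_measure (c := ENNReal.ofReal (1 - θ))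
    ENNReal.ofReal_ne_top
  have : (P2.mix θ μ (P2.diracZero n)).norm1 = θ * μ.norm1 := by
    simp only [P2.norm1, P2.mix]
    rw [integral_add_measure i1 i2]
    simp [P2.diracZero, ENNReal.toReal_ofReal θ.2.1]
  rw [this]
  exact mul_le_of_le_one_left μ.norm1_nonneg θ.2.2

/-- Along the mixtures with the unit mass at `0`, the increment of `Φ` is the mean of `δ(y) - δ(0)`
under `μ`. The mean value inequality on the ball of radius `‖y‖` bounds this by `B ‖y‖ + L ‖y‖ ^ 2`.
In this way bounds on derivatives become growth bounds on coefficients. -/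
theorem RegularlyDifferentiable.norm_sub_diracZero_le {Φ : P2 n → F}
    (h : RegularlyDifferentiable Φ) (μ : P2 n) {B L : ℝ} (hL : 0 ≤ L)
    (hB : ∀ (θ : unitInterval) y, ‖dMu Φ (P2.mix θ μ (P2.diracZero n)) y‖ ≤ B + L * ‖y‖) :
    ‖Φ μ - Φ (P2.diracZero n)‖ ≤ B * μ.norm1 + L * ∫ y, ‖y‖ ^ 2 ∂(μ : Measure (Euc n)) := by
  have hlin := h.isLinFunDeriv
  rw [hlin.sub_eq]
  refine (norm_integral_le_of_norm_le_const
    (C := B * μ.norm1 + L * ∫ y, ‖y‖ ^ 2 ∂(μ : Measure (Euc n)))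
    (Eventually.of_forall fun θ => ?_)).trans (by simp)
  set ν := P2.mix θ μ (P2.diracZero n)
  have h0 : ∫ x, linFunDeriv Φ ν x ∂((P2.diracZero n : P2 n) : Measure (Euc n)) =
      ∫ _, linFunDeriv Φ ν 0 ∂(μ : Measure (Euc n)) := by
    simp [P2.diracZero, integral_dirac]
  have hcont : Continuous (linFunDeriv Φ ν) := (h.differentiable ν).continuous
  have hint : Integrable (linFunDeriv Φ ν) (μ : Measure (Euc n)) := by
    obtain ⟨c, -, hc⟩ := hlin.growth
    refine Integrable.mono' (((integrable_const (1 : ℝ)).add μ.integrable_sq).const_mul (c ν))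
      hcont.aestronglyMeasurable (Eventually.of_forall fun x => ?_)
    simpa using hc ν x
  rw [h0, ← integral_sub hint (integrable_const _)]
  have hb : ∀ y, ‖linFunDeriv Φ ν y - linFunDeriv Φ ν 0‖ ≤ B * ‖y‖ + L * ‖y‖ ^ 2 := by
    intro y
    have := (convex_closedBall (0 : Euc n) ‖y‖).norm_image_sub_le_of_norm_hasFDerivWithin_le
      (f := linFunDeriv Φ ν) (C := B + L * ‖y‖)
      (fun w _ => (h.hasFDerivAt ν w).hasFDerivWithinAt)
      (fun w hw => (hB θ w).trans (by
        have : ‖w‖ ≤ ‖y‖ := by simpa using hw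
        gcongr)) (x := 0) (y := y) (by simp) (by simp)
    rw [sub_zero] at this
    nlinarith
  refine (norm_integral_le_of_norm_le
    ((μ.integrable_norm.const_mul B).add (μ.integrable_sq.const_mul L))
    (Eventually.of_forall hb)).trans (le_of_eq ?_)
  simp only [Pi.add_apply]
  rw [integral_add (μ.integrable_norm.const_mul B) (μ.integrable_sq.const_mul L),
    integral_const_mul, integral_const_mul]
  rfl

end LinearDerivative

/-! ### Growth of the coefficients. -/

section Growth

variable {n d : ℕ}

theorem norm_sub_zero_le_of_fderiv {E F : Type*} [NormedAddCommGroup E] [NormedSpace ℝ E]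
    [NormedAddCommGroup F] [NormedSpace ℝ F] {φ : E → F} (hφ : Differentiable ℝ φ) {C : ℝ} {x : E}
    (h : ∀ w, ‖w‖ ≤ ‖x‖ → ‖fderiv ℝ φ w‖ ≤ C) : ‖φ x - φ 0‖ ≤ C * ‖x‖ := by
  have := (convex_closedBall (0 : E) ‖x‖).norm_image_sub_le_of_norm_fderiv_le (f := φ) (C := C)
      (𝕜 := ℝ) (fun w _ => hφ w) (fun w hw => h w (by simpa using hw)) (x := 0) (y := x)
      (by simp) (by simp)
  simpa using this

/-- One variable is changed at a time: `(x, μ, a)`, `(0, μ, a)`, `(0, μ, 0)`, `(0, δ₀, 0)`. -/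
theorem RegularCoefficient.growth_of_bounded {f : Euc n → P2 n → Euc d → Euc n}
    (hf : RegularCoefficient f) (hf' : BoundedDerivs f) :
    ∃ C : ℝ, 0 ≤ C ∧ ∀ x μ a, ‖f x μ a‖ ≤ C * (1 + ‖x‖ + μ.norm1 + ‖a‖) := by
  obtain ⟨Λ, hΛ⟩ := hf'
  have hΛ0 : 0 ≤ Λ := (norm_nonneg _).trans (hΛ 0 (P2.diracZero n) 0).1
  refine ⟨Λ + ‖f 0 (P2.diracZero n) 0‖, by positivity, fun x μ a => ?_⟩
  have h1 : ‖f x μ a - f 0 μ a‖ ≤ Λ * ‖x‖ :=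
    norm_sub_zero_le_of_fderiv (hf.diff_x μ a) fun w _ => (hΛ w μ a).1
  have h2 : ‖f 0 μ a - f 0 μ 0‖ ≤ Λ * ‖a‖ :=
    norm_sub_zero_le_of_fderiv (hf.diff_a 0 μ) fun w _ => (hΛ 0 μ w).2.1
  have h3 : ‖f 0 μ 0 - f 0 (P2.diracZero n) 0‖ ≤ Λ * μ.norm1 := by
    have := (hf.diff_mu 0 0).norm_sub_diracZero_le μ le_rfl (B := Λ)
      (fun θ y => by simpa using (hΛ 0 _ 0).2.2 y)
    simpa using this
  have h4 : ‖f x μ a‖ ≤ ‖f x μ a - f 0 μ a‖ + ‖f 0 μ a - f 0 μ 0‖ +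
      ‖f 0 μ 0 - f 0 (P2.diracZero n) 0‖ + ‖f 0 (P2.diracZero n) 0‖ := by
    have : f x μ a = (f x μ a - f 0 μ a) + (f 0 μ a - f 0 μ 0) +
      (f 0 μ 0 - f 0 (P2.diracZero n) 0) + f 0 (P2.diracZero n) 0 := by abel
    conv_lhs => rw [this]
    exact norm_add₄_le
  have := μ.norm1_nonneg
  have := norm_nonneg (f 0 (P2.diracZero n) 0)
  have : 0 ≤ ‖f 0 (P2.diracZero n) 0‖ * (‖x‖ + μ.norm1 + ‖a‖) := by positivity
  nlinarith

/-- The path is the same as for bounded derivatives. The second moment of `μ` appears because the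
measure derivative may itself grow linearly in the point where it is evaluated. -/
theorem RegularCoefficient.growth_of_linear {g : Euc n → P2 n → Euc d → ℝ}
    (hg : RegularCoefficient g) (hg' : LinearGrowthDerivs g) :
    ∃ C : ℝ, 0 ≤ C ∧ ∀ x μ a, ‖g x μ a‖ ≤
      C * ((1 + ‖x‖ + μ.norm1 + ‖a‖) ^ 2 + ∫ y, ‖y‖ ^ 2 ∂(μ : Measure (Euc n))) := by
  obtain ⟨L, hL⟩ := hg'
  have hL0 : 0 ≤ L := by
    have h := (norm_nonneg _).trans (hL 0 (P2.diracZero n) 0).1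
    have := (P2.diracZero n).norm1_nonneg
    by_contra hneg
    have : L * (1 + ‖(0 : Euc n)‖ + (P2.diracZero n).norm1 + ‖(0 : Euc d)‖) < 0 :=
      mul_neg_of_neg_of_pos (not_le.1 hneg) (by positivity)
    linarith
  refine ⟨3 * L + ‖g 0 (P2.diracZero n) 0‖, by positivity, fun x μ a => ?_⟩
  have hμ := μ.norm1_nonneg
  set R := 1 + ‖x‖ + μ.norm1 + ‖a‖ with hR
  have hI : 0 ≤ ∫ y, ‖y‖ ^ 2 ∂(μ : Measure (Euc n)) := by positivity
  have hx := norm_nonneg x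
  have ha := norm_nonneg a
  have h1 : ‖g x μ a - g 0 μ a‖ ≤ L * R * ‖x‖ :=
    norm_sub_zero_le_of_fderiv (hg.diff_x μ a) fun w hw => (hL w μ a).1.trans (by rw [hR]; gcongr)
  have h2 : ‖g 0 μ a - g 0 μ 0‖ ≤ L * R * ‖a‖ :=
    norm_sub_zero_le_of_fderiv (hg.diff_a 0 μ) fun w hw => (hL 0 μ w).2.1.trans (by
      rw [hR, norm_zero]; gcongr)
  have h3 : ‖g 0 μ 0 - g 0 (P2.diracZero n) 0‖ ≤
      L * R * μ.norm1 + L * ∫ y, ‖y‖ ^ 2 ∂(μ : Measure (Euc n)) := by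
    refine (hg.diff_mu 0 0).norm_sub_diracZero_le μ hL0 (B := L * R) fun θ y => ?_
    refine ((hL 0 _ 0).2.2 y).trans ?_
    have := P2.norm1_mix_diracZero_le θ μ
    rw [← mul_add]
    refine mul_le_mul_of_nonneg_left ?_ hL0
    simp only [norm_zero]
    linarith
  have h4 : ‖g x μ a‖ ≤ ‖g x μ a - g 0 μ a‖ + ‖g 0 μ a - g 0 μ 0‖ +
      ‖g 0 μ 0 - g 0 (P2.diracZero n) 0‖ + ‖g 0 (P2.diracZero n) 0‖ := by
    have : g x μ a = (g x μ a - g 0 μ a) + (g 0 μ a - g 0 μ 0) +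
      (g 0 μ 0 - g 0 (P2.diracZero n) 0) + g 0 (P2.diracZero n) 0 := by abel
    conv_lhs => rw [this]
    exact norm_add₄_le
  have hR1 : 1 ≤ R := by rw [hR]; linarith
  generalize (∫ y, ‖y‖ ^ 2 ∂(μ : Measure (Euc n))) = I at hI h3 ⊢
  have hb := norm_nonneg (g 0 (P2.diracZero n) 0)
  generalize ‖g 0 (P2.diracZero n) 0‖ = b at hb h4 ⊢
  have e1 : L * R * ‖x‖ + L * R * ‖a‖ + L * R * μ.norm1 ≤ L * R * R := by
    rw [← mul_add, ← mul_add]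
    exact mul_le_mul_of_nonneg_left (by linarith) (mul_nonneg hL0 (by linarith))
  have e2 : 0 ≤ L * R * R := mul_nonneg (mul_nonneg hL0 (by linarith)) (by linarith)
  have e3 : b ≤ b * R ^ 2 := le_mul_of_one_le_right hb (one_le_pow₀ hR1)
  have e4 : 0 ≤ b * I := mul_nonneg hb hI
  have e5 : 0 ≤ L * I := mul_nonneg hL0 hI
  calc ‖g x μ a‖ ≤ L * R * R + L * I + b * R ^ 2 := by linarith
    _ ≤ (3 * L + b) * (R ^ 2 + I) := by
      have : (3 * L + b) * (R ^ 2 + I) = 3 * (L * R * R) + 3 * (L * I) + b * R ^ 2 + b * I := by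
        ring
      linarith

/-- A terminal cost as a running cost which does not depend on the (trivial) control. -/
theorem RegularTerminal.growth {k : Euc n → P2 n → ℝ}
    (hk : RegularTerminal k) (hk' : LinearGrowthDerivsTerminal k) :
    ∃ C : ℝ, 0 ≤ C ∧ ∀ x μ, ‖k x μ‖ ≤
      C * ((1 + ‖x‖ + μ.norm1) ^ 2 + ∫ y, ‖y‖ ^ 2 ∂(μ : Measure (Euc n))) := by
  obtain ⟨L, hL⟩ := hk'
  have hg : RegularCoefficient (d := 0) fun x μ _ => k x μ :=
    { continuous := hk.continuous.comp (by fun_prop :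
        Continuous fun p : Euc n × P2 n × Euc 0 => (p.1, p.2.1))
      diff_x := fun μ _ => hk.diff_x μ
      diff_a := fun _ _ => differentiable_const _
      diff_mu := fun x _ => hk.diff_mu x
      continuous_dx := hk.continuous_dx.comp (by fun_prop :
        Continuous fun p : Euc n × P2 n × Euc 0 => (p.1, p.2.1))
      continuous_da := by simpa using continuous_const
      continuous_dmu := hk.continuous_dmu.comp (by fun_prop :
        Continuous fun p : Euc n × P2 n × Euc 0 × Euc n => (p.1, p.2.1, p.2.2.2)) }
  have hL0 : ∀ x (μ : P2 n), 0 ≤ L * (1 + ‖x‖ + μ.norm1) :=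
    fun x μ => (norm_nonneg _).trans (hL x μ).1
  have hg' : LinearGrowthDerivs (d := 0) fun x μ _ => k x μ := by
    refine ⟨L, fun x μ a => ?_⟩
    have ha : ‖a‖ = 0 := by simp [Subsingleton.elim a 0]
    simp only [ha, add_zero]
    exact ⟨(hL x μ).1, by simpa using hL0 x μ, (hL x μ).2⟩
  obtain ⟨C, hC0, hC⟩ := hg.growth_of_linear hg'
  exact ⟨C, hC0, fun x μ => by simpa using hC x μ 0⟩

end Growth

/-! ### Differentiability uniform along a compact set of parameters. -/

section UniformDifferentiability

variable {S E F : Type*} [TopologicalSpace S] [NormedAddCommGroup E] [NormedSpace ℝ E]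
  [NormedAddCommGroup F] [NormedSpace ℝ F]

/-- A family of functions with jointly continuous derivatives near `K × {0}`, `K` compact, is
differentiable at `0` uniformly on `K`. -/
theorem exists_uniform_expansion {K : Set S} (hK : IsCompact K) {H : S → E → F}
    {H' : S → E → E →L[ℝ] F}
    (hd : ∀ s ∈ K, ∀ᶠ p in 𝓝[K] s ×ˢ 𝓝 (0 : E), HasFDerivAt (H p.1) (H' p.1 p.2) p.2)
    (hc : ∀ s ∈ K, Tendsto (fun p : S × E => H' p.1 p.2) (𝓝[K] s ×ˢ 𝓝 0) (𝓝 (H' s 0)))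
    {ε : ℝ} (hε : 0 < ε) :
    ∃ r > 0, ∀ s ∈ K, ∀ y, ‖y‖ < r → ‖H s y - H s 0 - H' s 0 y‖ ≤ ε * ‖y‖ := by
  refine hK.induction_on (p := fun A => ∃ r > 0, ∀ s ∈ A, ∀ y, ‖y‖ < r →
    ‖H s y - H s 0 - H' s 0 y‖ ≤ ε * ‖y‖) ⟨1, one_pos, by simp⟩ ?_ ?_ ?_
  · rintro A B hAB ⟨r, hr, h⟩
    exact ⟨r, hr, fun s hs => h s (hAB hs)⟩
  · rintro A B ⟨r, hr, h⟩ ⟨r', hr', h'⟩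
    refine ⟨min r r', lt_min hr hr', ?_⟩
    rintro s (hs | hs) y hy
    · exact h s hs y (hy.trans_le (min_le_left _ _))
    · exact h' s hs y (hy.trans_le (min_le_right _ _))
  -- Near `(s, 0)` every value of `H'` lies within `ε / 2` of `H' s 0`, hence within `ε` of `H' s'
  -- 0` for the nearby parameter `s'`; the mean value inequality on the ball applies.
  · intro s hs
    have h1 := (hd s hs).and ((hc s hs) (Metric.closedBall_mem_nhds _ (half_pos hε)))
    obtain ⟨A, hA, B, hB, hAB⟩ := Filter.mem_prod_iff.1 h1
    obtain ⟨r, hr, hrB⟩ := Metric.mem_nhds_iff.1 hB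
    refine ⟨A, hA, r, hr, fun s' hs' y hy => ?_⟩
    have key : ∀ w ∈ Metric.ball (0 : E) r, HasFDerivAt (H s') (H' s' w) w ∧
        ‖H' s' w - H' s 0‖ ≤ ε / 2 := by
      intro w hw
      have := hAB (Set.mk_mem_prod hs' (hrB hw))
      refine ⟨this.1, ?_⟩
      have h2 := this.2
      simpa [dist_eq_norm] using h2
    have h0 := (key 0 (Metric.mem_ball_self hr)).2
    have := (convex_ball (0 : E) r).norm_image_sub_le_of_norm_hasFDerivWithin_le'
      (f := H s') (f' := H' s') (φ := H' s' 0) (C := ε)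
      (fun w hw => (key w hw).1.hasFDerivWithinAt) (fun w hw => ?_)
      (Metric.mem_ball_self hr) (show y ∈ Metric.ball (0 : E) r by simpa using hy)
    · simpa using this
    · calc ‖H' s' w - H' s' 0‖ = ‖(H' s' w - H' s 0) - (H' s' 0 - H' s 0)‖ := by congr 1; abel
        _ ≤ ‖H' s' w - H' s 0‖ + ‖H' s' 0 - H' s 0‖ := norm_sub_le _ _
        _ ≤ ε := by linarith [(key w hw).2]

/-- The expansion with `ε = 1` reduces the claim to a bound on `H' s 0`, which is continuous on the
compact set `K`. -/
theorem exists_uniform_lipschitz {K : Set S} (hK : IsCompact K) {H : S → E → F}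
    {H' : S → E → E →L[ℝ] F}
    (hd : ∀ s ∈ K, ∀ᶠ p in 𝓝[K] s ×ˢ 𝓝 (0 : E), HasFDerivAt (H p.1) (H' p.1 p.2) p.2)
    (hc : ∀ s ∈ K, Tendsto (fun p : S × E => H' p.1 p.2) (𝓝[K] s ×ˢ 𝓝 0) (𝓝 (H' s 0))) :
    ∃ C ≥ 0, ∃ r > 0, ∀ s ∈ K, ∀ y, ‖y‖ < r → ‖H s y - H s 0‖ ≤ C * ‖y‖ := by
  obtain ⟨r, hr, h⟩ := exists_uniform_expansion hK hd hc one_pos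
  have hcont : ContinuousOn (fun s => H' s 0) K := by
    intro s hs
    exact (hc s hs).comp (tendsto_id.prodMk tendsto_const_nhds)
  obtain ⟨C, hC⟩ := hK.exists_bound_of_continuousOn hcont
  refine ⟨1 + |C|, by positivity, r, hr, fun s hs y hy => ?_⟩
  calc ‖H s y - H s 0‖ = ‖(H s y - H s 0 - H' s 0 y) + H' s 0 y‖ := by congr 1; abel
    _ ≤ ‖H s y - H s 0 - H' s 0 y‖ + ‖H' s 0 y‖ := norm_add_le _ _
    _ ≤ 1 * ‖y‖ + |C| * ‖y‖ := add_le_add (h s hs y hy) ((H' s 0).le_of_opNorm_le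
        ((hC s hs).trans (le_abs_self C)) y)
    _ = (1 + |C|) * ‖y‖ := by ring

end UniformDifferentiability

/-- Comparison of the running costs of two trajectories by means of an adjoint state `z`. -/
theorem cost_expansion {E : Type*} [NormedAddCommGroup E] [NormedSpace ℝ E] {c T : ℝ}
    (hcT : c ≤ T) {q q₀ φ φ₀ : ℝ → E} {z z' : ℝ → E →L[ℝ] ℝ} {γ γ₀ : ℝ → ℝ} {η : ℝ}
    (hq : ∀ s ∈ Icc c T, HasDerivWithinAt q (φ s) (Icc c T) s)
    (hq₀ : ∀ s ∈ Icc c T, HasDerivWithinAt q₀ (φ₀ s) (Icc c T) s)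
    (hz : ∀ s ∈ Icc c T, HasDerivWithinAt z (z' s) (Icc c T) s)
    (hγ : ContinuousOn γ (Icc c T)) (hγ₀ : ContinuousOn γ₀ (Icc c T))
    (hrem : ∀ s ∈ Icc c T, |γ s - γ₀ s + z s (φ s - φ₀ s) + z' s (q s - q₀ s)| ≤ η) :
    |(∫ s in c..T, γ s) - (∫ s in c..T, γ₀ s) + z T (q T - q₀ T) - z c (q c - q₀ c)| ≤
      η * (T - c) := by
  have hγγ : ContinuousOn (fun s => γ s - γ₀ s) (Icc c T) := hγ.sub hγ₀
  have hint : ∀ s ∈ Icc c T, HasDerivWithinAt (fun r => ∫ u in c..r, (γ u - γ₀ u))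
      (γ s - γ₀ s) (Icc c T) s := by
    intro s hs
    have : Fact (s ∈ Icc c T) := ⟨hs⟩
    refine intervalIntegral.integral_hasDerivWithinAt_right ?_ ?_ (hγγ s hs)
    · refine ContinuousOn.intervalIntegrable ?_
      rw [uIcc_of_le hs.1]
      exact hγγ.mono (Icc_subset_Icc_right hs.2)
    · exact (hγγ.stronglyMeasurableAtFilter_nhdsWithin measurableSet_Icc s)
  -- The derivative of this auxiliary function is exactly the quantity bounded in `hrem`, and its
  -- increment over `[c, T]` is the quantity to be estimated.
  have hder : ∀ s ∈ Icc c T, HasDerivWithinAt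
      (fun r => (∫ u in c..r, (γ u - γ₀ u)) + z r (q r - q₀ r))
      (γ s - γ₀ s + (z' s (q s - q₀ s) + z s (φ s - φ₀ s))) (Icc c T) s := by
    intro s hs
    exact (hint s hs).add ((hz s hs).clm_apply ((hq s hs).sub (hq₀ s hs)))
  have := norm_image_sub_le_of_norm_deriv_le_segment' hder (C := η) (fun s hs => by
    have := hrem s (Ico_subset_Icc_self hs)
    rw [Real.norm_eq_abs]
    convert this using 2
    ring) T (right_mem_Icc.2 hcT)
  rw [Real.norm_eq_abs, intervalIntegral.integral_same,
    intervalIntegral.integral_sub (hγ.intervalIntegrable_of_Icc hcT)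
      (hγ₀.intervalIntegrable_of_Icc hcT)] at this
  convert this using 2
  ring

/-! ### Derivatives in one point together with the positions of the atoms. -/

section Blocks

variable {n : ℕ} {ι : Type*} [Fintype ι]
variable {Ω : Type*} [MeasurableSpace Ω] (P : Measure Ω) [IsProbabilityMeasure P]
variable {E F : Type*} [NormedAddCommGroup E] [NormedSpace ℝ E]
  [NormedAddCommGroup F] [NormedSpace ℝ F]

/-- The finitely supported measure with atoms `q i` and the weights of a finite partition. -/
def P2.atoms (σ : SimpleFunc Ω ι) (q : ι → Euc n) : P2 n := P2.law P (P2.atomLp P σ q)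

/-- The derivative `∑ j, w_j D_j y_j` in the positions of the atoms. -/
def atomsDeriv (σ : SimpleFunc Ω ι) (D : ι → Euc n →L[ℝ] F) : (ι → Euc n) →L[ℝ] F :=
  ∑ j, P2.wt P σ j • (D j).comp (ContinuousLinearMap.proj (R := ℝ) (φ := fun _ : ι => Euc n) j)

/-- The derivative `D₁ x + ∑ j, w_j D_j y_j`. -/
def blockDeriv (σ : SimpleFunc Ω ι) (D₁ : E →L[ℝ] F) (D : ι → Euc n →L[ℝ] F) :
    E × (ι → Euc n) →L[ℝ] F :=
  D₁.comp (ContinuousLinearMap.fst ℝ _ _) +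
    (atomsDeriv P σ D).comp (ContinuousLinearMap.snd ℝ _ _)

variable {P}

theorem P2.continuous_atoms (σ : SimpleFunc Ω ι) :
    Continuous (P2.atoms P σ : (ι → Euc n) → P2 n) :=
  P2.continuous_law.comp (P2.atomLp P σ).continuous

theorem P2.continuous_norm1_atoms (σ : SimpleFunc Ω ι) :
    Continuous fun q : ι → Euc n => (P2.atoms P σ q).norm1 :=
  P2.continuous_norm1_law.comp (P2.atomLp P σ).continuous

theorem atomsDeriv_apply (σ : SimpleFunc Ω ι) (D : ι → Euc n →L[ℝ] F) (y : ι → Euc n) :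
    atomsDeriv P σ D y = ∑ j, P2.wt P σ j • D j (y j) := by
  simp [atomsDeriv]

theorem blockDeriv_apply (σ : SimpleFunc Ω ι) (D₁ : E →L[ℝ] F) (D : ι → Euc n →L[ℝ] F) (x : E)
    (y : ι → Euc n) : blockDeriv P σ D₁ D (x, y) = D₁ x + ∑ j, P2.wt P σ j • D j (y j) := by
  simp [blockDeriv, atomsDeriv_apply]

theorem tendsto_atomsDeriv {β : Type*} {l : Filter β} (σ : SimpleFunc Ω ι)
    {D : β → ι → Euc n →L[ℝ] F} {D' : ι → Euc n →L[ℝ] F}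
    (h : ∀ j, Tendsto (fun b => D b j) l (𝓝 (D' j))) :
    Tendsto (fun b => atomsDeriv P σ (D b)) l (𝓝 (atomsDeriv P σ D')) := by
  refine tendsto_finsetSum _ fun j _ => Tendsto.const_smul ?_ _
  exact (isBoundedBilinearMap_comp.continuous.tendsto _).comp ((h j).prodMk_nhds tendsto_const_nhds)

theorem tendsto_blockDeriv {β : Type*} {l : Filter β} (σ : SimpleFunc Ω ι)
    {D₁ : β → E →L[ℝ] F} {D₁' : E →L[ℝ] F} (h₁ : Tendsto D₁ l (𝓝 D₁'))
    {D : β → ι → Euc n →L[ℝ] F} {D' : ι → Euc n →L[ℝ] F}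
    (h : ∀ j, Tendsto (fun b => D b j) l (𝓝 (D' j))) :
    Tendsto (fun b => blockDeriv P σ (D₁ b) (D b)) l (𝓝 (blockDeriv P σ D₁' D')) := by
  have h₂ := tendsto_atomsDeriv (P := P) σ h
  refine Tendsto.add ?_ ?_
  · exact (isBoundedBilinearMap_comp.continuous.tendsto _).comp
      (h₁.prodMk_nhds tendsto_const_nhds)
  · exact (isBoundedBilinearMap_comp.continuous.tendsto
      (atomsDeriv P σ D', ContinuousLinearMap.snd ℝ E (ι → Euc n))).comp
      (h₂.prodMk_nhds tendsto_const_nhds)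

theorem RegularlyDifferentiable.hasFDerivAt_atomsDeriv [CompleteSpace F] {Φ : P2 n → F}
    (h : RegularlyDifferentiable Φ) (σ : SimpleFunc Ω ι) (q : ι → Euc n) :
    HasFDerivAt (fun q : ι → Euc n => Φ (P2.atoms P σ q))
      (atomsDeriv P σ fun j => dMu Φ (P2.atoms P σ q) (q j)) q :=
  h.hasFDerivAt_atoms σ q

/-- The lift is composed with the continuous linear map `atomLp`. The expectation representing the
Fréchet derivative is then a sum over the cells. -/
theorem HasLDerivAt.hasFDerivAt_atomsDeriv [CompleteSpace F] {Φ : P2 n → F}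
    {D : Euc n → Euc n →L[ℝ] F} {σ : SimpleFunc Ω ι} {q : ι → Euc n}
    (h : HasLDerivAt P Φ D (P2.atoms P σ q)) :
    HasFDerivAt (fun q : ι → Euc n => Φ (P2.atoms P σ q)) (atomsDeriv P σ fun j => D (q j)) q := by
  obtain ⟨L, hL, hLd⟩ := h.2 (P2.atomLp P σ q) rfl
  have := hLd.comp q (P2.atomLp P σ).hasFDerivAt
  refine this.congr_fderiv ?_
  ext1 y
  rw [ContinuousLinearMap.comp_apply, hL, atomsDeriv_apply,
    ← P2.integral_atoms σ fun j => D (q j) (y j)]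
  refine integral_congr_ae ?_
  filter_upwards [P2.coeFn_atomLp (P := P) σ q, P2.coeFn_atomLp (P := P) σ y] with ω h1 h2
  rw [h1, h2]

/-- The hypotheses on coefficients provide separate derivatives in the point and in the measure.
Continuity of these partial derivatives on an open set makes them a total derivative; a general `U`
is allowed because the control is regular only on the cone. -/
theorem hasFDerivAt_block {σ : SimpleFunc Ω ι} {Φ : E → P2 n → F} {D₁ : E → P2 n → E →L[ℝ] F}
    {D : E → P2 n → Euc n → Euc n →L[ℝ] F} {U : Set (E × (ι → Euc n))} (hU : IsOpen U)
    (h₁ : ∀ p ∈ U, HasFDerivAt (fun x => Φ x (P2.atoms P σ p.2)) (D₁ p.1 (P2.atoms P σ p.2)) p.1)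
    (h₂ : ∀ p ∈ U, HasFDerivAt (fun q => Φ p.1 (P2.atoms P σ q))
      (atomsDeriv P σ fun j => D p.1 (P2.atoms P σ p.2) (p.2 j)) p.2)
    (c₁ : ContinuousOn (fun p : E × (ι → Euc n) => D₁ p.1 (P2.atoms P σ p.2)) U)
    (c₂ : ∀ j, ContinuousOn (fun p : E × (ι → Euc n) => D p.1 (P2.atoms P σ p.2) (p.2 j)) U)
    {p : E × (ι → Euc n)} (hp : p ∈ U) :
    HasFDerivAt (fun p : E × (ι → Euc n) => Φ p.1 (P2.atoms P σ p.2))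
      (blockDeriv P σ (D₁ p.1 (P2.atoms P σ p.2)) fun j => D p.1 (P2.atoms P σ p.2) (p.2 j)) p := by
  have hUp : U ∈ 𝓝 p := hU.mem_nhds hp
  have := hasStrictFDerivAt_uncurry_coprod (𝕜 := ℝ) (u := p)
    (f := fun x q => Φ x (P2.atoms P σ q)) (f₁ := fun x q => D₁ x (P2.atoms P σ q))
    (f₂ := fun x q => atomsDeriv P σ fun j => D x (P2.atoms P σ q) (q j))
    (Filter.mem_of_superset hUp h₁) (Filter.mem_of_superset hUp h₂)
    (c₁.continuousAt hUp)
    (tendsto_atomsDeriv σ fun j => (c₂ j).continuousAt hUp)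
  refine this.hasFDerivAt.congr_fderiv ?_
  ext <;> simp [blockDeriv, Function.HasUncurry.uncurry]

end Blocks

/-! ### Coefficients and controls as differentiable functions of finitely many particles. -/

section Particles

variable {n d : ℕ} {ι : Type*} [Fintype ι]
variable {Ω : Type*} [MeasurableSpace Ω] {P : Measure Ω} [IsProbabilityMeasure P]
variable {F : Type*} [NormedAddCommGroup F] [NormedSpace ℝ F] [CompleteSpace F]

theorem hasFDerivAt_pi_single [DecidableEq ι] {E G : Type*} [NormedAddCommGroup E]
    [NormedSpace ℝ E] [NormedAddCommGroup G] [NormedSpace ℝ G] {A : E → ι → G}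
    {B : ι → E →L[ℝ] G} {w : E} (h : ∀ i, HasFDerivAt (fun w => A w i) (B i) w) :
    HasFDerivAt A (∑ i, (ContinuousLinearMap.single ℝ (fun _ : ι => G) i).comp (B i)) w := by
  refine (hasFDerivAt_pi.2 h).congr_fderiv (ContinuousLinearMap.ext fun y => funext fun i => ?_)
  simp [Finset.sum_apply, Pi.single_apply]

/-- `(q, a) ↦ ((q i, a i), q)`. -/
def pickL (n d : ℕ) (i : ι) :
    (ι → Euc n) × (ι → Euc d) →L[ℝ] (Euc n × Euc d) × (ι → Euc n) :=
  ((((ContinuousLinearMap.proj (R := ℝ) (φ := fun _ : ι => Euc n) i).comp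
    (ContinuousLinearMap.fst ℝ _ _)).prod
    ((ContinuousLinearMap.proj (R := ℝ) (φ := fun _ : ι => Euc d) i).comp
      (ContinuousLinearMap.snd ℝ _ _)))).prod (ContinuousLinearMap.fst ℝ _ _)

theorem pickL_apply (i : ι) (w : (ι → Euc n) × (ι → Euc d)) :
    pickL n d i w = ((w.1 i, w.2 i), w.1) := rfl

/-- `(y, b) ↦ D y + D' b`. -/
def addDeriv (D : Euc n →L[ℝ] F) (D' : Euc d →L[ℝ] F) : Euc n × Euc d →L[ℝ] F :=
  D.comp (ContinuousLinearMap.fst ℝ _ _) + D'.comp (ContinuousLinearMap.snd ℝ _ _)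

theorem RegularCoefficient.hasFDerivAt_xa {φ : Euc n → P2 n → Euc d → F}
    (hφ : RegularCoefficient φ) (μ : P2 n) (p : Euc n × Euc d) :
    HasFDerivAt (fun p : Euc n × Euc d => φ p.1 μ p.2)
      (addDeriv (fderiv ℝ (fun x => φ x μ p.2) p.1) (fderiv ℝ (fun a => φ p.1 μ a) p.2)) p := by
  have := hasStrictFDerivAt_uncurry_coprod (𝕜 := ℝ) (u := p)
    (f := fun x a => φ x μ a) (f₁ := fun x a => fderiv ℝ (fun x => φ x μ a) x)
    (f₂ := fun x a => fderiv ℝ (fun a => φ x μ a) a)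
    (Eventually.of_forall fun v => (hφ.diff_x μ v.2 v.1).hasFDerivAt)
    (Eventually.of_forall fun v => (hφ.diff_a v.1 μ v.2).hasFDerivAt)
    (hφ.continuous_dx.comp (by fun_prop :
      Continuous fun v : Euc n × Euc d => (v.1, μ, v.2))).continuousAt
    (hφ.continuous_da.comp (by fun_prop :
      Continuous fun v : Euc n × Euc d => (v.1, μ, v.2))).continuousAt
  refine this.hasFDerivAt.congr_fderiv ?_
  ext <;> simp [addDeriv, Function.HasUncurry.uncurry]

theorem RegularCoefficient.continuous_dxa {φ : Euc n → P2 n → Euc d → F}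
    (hφ : RegularCoefficient φ) :
    Continuous fun p : Euc n × P2 n × Euc d => addDeriv (fderiv ℝ (fun x => φ x p.2.1 p.2.2) p.1)
      (fderiv ℝ (fun a => φ p.1 p.2.1 a) p.2.2) :=
  (hφ.continuous_dx.clm_comp continuous_const).add (hφ.continuous_da.clm_comp continuous_const)

/-- The derivative of `(q, a) ↦ φ(q i, μ_q, a i)`, `μ_q` being the measure with atoms `q`. -/
def particleDeriv (P : Measure Ω) [IsProbabilityMeasure P] (σ : SimpleFunc Ω ι)
    (φ : Euc n → P2 n → Euc d → F) (i : ι) (w : (ι → Euc n) × (ι → Euc d)) :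
    (ι → Euc n) × (ι → Euc d) →L[ℝ] F :=
  (blockDeriv P σ (addDeriv (fderiv ℝ (fun x => φ x (P2.atoms P σ w.1) (w.2 i)) (w.1 i))
    (fderiv ℝ (fun a => φ (w.1 i) (P2.atoms P σ w.1) a) (w.2 i)))
    fun j => dMu (fun μ => φ (w.1 i) μ (w.2 i)) (P2.atoms P σ w.1) (w.1 j)).comp (pickL n d i)

theorem particleDeriv_apply (σ : SimpleFunc Ω ι) (φ : Euc n → P2 n → Euc d → F) (i : ι)
    (w y : (ι → Euc n) × (ι → Euc d)) :
    particleDeriv P σ φ i w y = fderiv ℝ (fun x => φ x (P2.atoms P σ w.1) (w.2 i)) (w.1 i) (y.1 i)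
      + fderiv ℝ (fun a => φ (w.1 i) (P2.atoms P σ w.1) a) (w.2 i) (y.2 i)
      + ∑ j, P2.wt P σ j •
        dMu (fun μ => φ (w.1 i) μ (w.2 i)) (P2.atoms P σ w.1) (w.1 j) (y.1 j) := by
  rw [particleDeriv, ContinuousLinearMap.comp_apply, pickL_apply, blockDeriv_apply]
  simp [addDeriv]

/-- The position `q i` enters twice, as the state of particle `i` and as an atom of the measure. The
chain rule through `pickL` adds the two contributions. -/
theorem RegularCoefficient.hasFDerivAt_particle {φ : Euc n → P2 n → Euc d → F}
    (hφ : RegularCoefficient φ) (σ : SimpleFunc Ω ι) (i : ι) (w : (ι → Euc n) × (ι → Euc d)) :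
    HasFDerivAt (fun w : (ι → Euc n) × (ι → Euc d) => φ (w.1 i) (P2.atoms P σ w.1) (w.2 i))
      (particleDeriv P σ φ i w) w := by
  have hat := P2.continuous_atoms (P := P) (n := n) σ
  have h := hasFDerivAt_block (P := P) (σ := σ) (Φ := fun p μ => φ p.1 μ p.2)
    (D₁ := fun (p : Euc n × Euc d) μ => addDeriv (fderiv ℝ (fun x => φ x μ p.2) p.1)
      (fderiv ℝ (fun a => φ p.1 μ a) p.2))
    (D := fun p μ y => dMu (fun μ => φ p.1 μ p.2) μ y) isOpen_univ
    (fun p _ => hφ.hasFDerivAt_xa _ _)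
    (fun p _ => (hφ.diff_mu p.1.1 p.1.2).hasFDerivAt_atomsDeriv σ p.2)
    (Continuous.continuousOn (hφ.continuous_dxa.comp (by fun_prop :
      Continuous fun p : (Euc n × Euc d) × (ι → Euc n) => (p.1.1, P2.atoms P σ p.2, p.1.2))))
    (fun j => Continuous.continuousOn (hφ.continuous_dmu.comp (by fun_prop :
      Continuous fun p : (Euc n × Euc d) × (ι → Euc n) =>
        (p.1.1, P2.atoms P σ p.2, p.1.2, p.2 j)))) (mem_univ (pickL n d i w))
  exact h.comp w (pickL n d i).hasFDerivAt

theorem RegularCoefficient.continuous_particleDeriv {φ : Euc n → P2 n → Euc d → F}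
    (hφ : RegularCoefficient φ) (σ : SimpleFunc Ω ι) (i : ι) :
    Continuous (particleDeriv P σ φ i) := by
  have hat := P2.continuous_atoms (P := P) (n := n) σ
  refine Continuous.clm_comp ?_ continuous_const
  rw [continuous_iff_continuousAt]
  intro w
  refine tendsto_blockDeriv σ ?_ fun j => ?_
  · exact (hφ.continuous_dxa.comp (by fun_prop : Continuous
      fun w : (ι → Euc n) × (ι → Euc d) => (w.1 i, P2.atoms P σ w.1, w.2 i))).tendsto w
  · exact (hφ.continuous_dmu.comp (by fun_prop : Continuous
      fun w : (ι → Euc n) × (ι → Euc d) =>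
        (w.1 i, P2.atoms P σ w.1, w.2 i, w.1 j))).tendsto w

theorem RegularTerminal.hasFDerivAt_particle {k : Euc n → P2 n → ℝ} (hk : RegularTerminal k)
    (σ : SimpleFunc Ω ι) (i : ι) (q : ι → Euc n) :
    HasFDerivAt (fun q : ι → Euc n => k (q i) (P2.atoms P σ q))
      ((blockDeriv P σ (fderiv ℝ (fun x => k x (P2.atoms P σ q)) (q i))
        fun j => dMu (fun μ => k (q i) μ) (P2.atoms P σ q) (q j)).comp
        ((ContinuousLinearMap.proj (R := ℝ) (φ := fun _ : ι => Euc n) i).prod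
          (ContinuousLinearMap.id ℝ _))) q := by
  have hat := P2.continuous_atoms (P := P) (n := n) σ
  have h := hasFDerivAt_block (P := P) (σ := σ) (Φ := fun p μ => k p μ)
    (D₁ := fun (p : Euc n) μ => fderiv ℝ (fun x => k x μ) p)
    (D := fun p μ y => dMu (fun μ => k p μ) μ y) isOpen_univ
    (fun p _ => (hk.diff_x _ _).hasFDerivAt)
    (fun p _ => (hk.diff_mu p.1).hasFDerivAt_atomsDeriv σ p.2)
    (Continuous.continuousOn (hk.continuous_dx.comp (by fun_prop :
      Continuous fun p : Euc n × (ι → Euc n) => (p.1, P2.atoms P σ p.2))))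
    (fun j => Continuous.continuousOn (hk.continuous_dmu.comp (by fun_prop :
      Continuous fun p : Euc n × (ι → Euc n) =>
        (p.1, P2.atoms P σ p.2, p.2 j)))) (mem_univ (q i, q))
  exact HasFDerivAt.comp (f := fun q : ι → Euc n => (q i, q)) q h
    ((ContinuousLinearMap.proj (R := ℝ) (φ := fun _ : ι => Euc n) i).prod
      (ContinuousLinearMap.id ℝ (ι → Euc n))).hasFDerivAt

/-- The control at the particles in the states `w.1` with the adjoint states `w.2`. -/
def particleControl (P : Measure Ω) [IsProbabilityMeasure P] (σ : SimpleFunc Ω ι)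
    (α : Euc n → P2 n → Euc n → Euc d) (w : (ι → Euc n) × (ι → Euc n)) : ι → Euc d :=
  fun i => α (w.1 i) (P2.atoms P σ w.1) (w.2 i)

/-- The states of the particles for which all of them are in the cone. -/
def particleCone (P : Measure Ω) [IsProbabilityMeasure P] (σ : SimpleFunc Ω ι) (n : ℕ) (k₀ : ℝ) :
    Set ((ι → Euc n) × (ι → Euc n)) :=
  {w | ∀ i, (w.1 i, P2.atoms P σ w.1, w.2 i) ∈ cone n k₀}

/-- Openness of the cone itself in the Wasserstein topology is not needed: in the positions of the
atoms it follows from continuity of the first moment. -/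
theorem isOpen_atoms_cone {β : Type*} [TopologicalSpace β] (σ : SimpleFunc Ω ι) (k₀ : ℝ)
    {u z : β → Euc n} {q : β → ι → Euc n} (hu : Continuous u) (hz : Continuous z)
    (hq : Continuous q) : IsOpen {b | (u b, P2.atoms P σ (q b), z b) ∈ cone n k₀} := by
  have := (P2.continuous_norm1_atoms (P := P) (n := n) σ).comp hq
  exact isOpen_lt hz.norm (continuous_const.mul ((continuous_const.add hu.norm).add this))

theorem isOpen_particleCone (σ : SimpleFunc Ω ι) (k₀ : ℝ) :
    IsOpen (particleCone P σ n k₀) := by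
  rw [particleCone, ofPred_forall]
  exact isOpen_iInter_of_finite fun i =>
    isOpen_atoms_cone σ k₀ (by fun_prop) (by fun_prop) (by fun_prop)

/-- The feedback is continuously differentiable in all states and costates together. Its derivative
is only used to get Lipschitz bounds, so no formula for it is recorded. -/
theorem RegularControl.exists_particleDeriv {k₀ : ℝ} {α : Euc n → P2 n → Euc n → Euc d}
    (hα : RegularControl P k₀ α) (σ : SimpleFunc Ω ι) :
    ∃ A' : (ι → Euc n) × (ι → Euc n) → (ι → Euc n) × (ι → Euc n) →L[ℝ] (ι → Euc d),
      ContinuousOn A' (particleCone P σ n k₀) ∧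
      ∀ w ∈ particleCone P σ n k₀, HasFDerivAt (particleControl P σ α) (A' w) w := by
  have hat := P2.continuous_atoms (P := P) (n := n) σ
  classical
  obtain ⟨αμ, hαμ, hαc⟩ := hα.diff_mu
  let B : ι → (ι → Euc n) × (ι → Euc n) → (ι → Euc n) × (ι → Euc n) →L[ℝ] Euc d := fun i w =>
    (blockDeriv P σ (fderiv ℝ (fun p : Euc n × Euc n => α p.1 (P2.atoms P σ w.1) p.2)
      (w.1 i, w.2 i)) fun j => αμ (w.1 i) (P2.atoms P σ w.1) (w.2 i) (w.1 j)).comp (pickL n n i)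
  refine ⟨fun w => ∑ i, (ContinuousLinearMap.single ℝ (fun _ : ι => Euc d) i).comp (B i w),
    ?_, fun w hw => ?_⟩
  · have hB : ∀ i, ContinuousOn (B i) (particleCone P σ n k₀) := by
      intro i
      refine ContinuousOn.clm_comp ?_ continuousOn_const
      intro w hw
      refine tendsto_blockDeriv σ ?_ fun j => ?_
      · exact (hα.continuousOn_dxz.comp (by fun_prop : Continuous
          fun w : (ι → Euc n) × (ι → Euc n) => (w.1 i, P2.atoms P σ w.1, w.2 i)).continuousOn
          (fun w (hw : w ∈ particleCone P σ n k₀) => hw i)) w hw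
      · exact (hαc.comp (by fun_prop : Continuous
          fun w : (ι → Euc n) × (ι → Euc n) =>
            ((w.1 i, P2.atoms P σ w.1, w.2 i), w.1 j)).continuousOn
          (fun w (hw : w ∈ particleCone P σ n k₀) => Set.mk_mem_prod (hw i) (mem_univ _))) w hw
    exact continuousOn_finsetSum _ fun i _ => continuousOn_const.clm_comp (hB i)
  · refine hasFDerivAt_pi_single fun i => ?_
    have hU : IsOpen {p : (Euc n × Euc n) × (ι → Euc n) |
        (p.1.1, P2.atoms P σ p.2, p.1.2) ∈ cone n k₀} :=
      isOpen_atoms_cone σ k₀ (by fun_prop) (by fun_prop) (by fun_prop)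
    have h := hasFDerivAt_block (P := P) (σ := σ) (Φ := fun p μ => α p.1 μ p.2)
      (D₁ := fun (p : Euc n × Euc n) μ => fderiv ℝ (fun p : Euc n × Euc n => α p.1 μ p.2) p)
      (D := fun p μ y => αμ p.1 μ p.2 y) hU
      (fun p hp => (hα.diff_xz _ _ _ hp).hasFDerivAt)
      (fun p hp => (hαμ _ _ _ hp).hasFDerivAt_atomsDeriv)
      (hα.continuousOn_dxz.comp (by fun_prop :
        Continuous fun p : (Euc n × Euc n) × (ι → Euc n) =>
          (p.1.1, P2.atoms P σ p.2, p.1.2)).continuousOn (fun p hp => hp))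
      (fun j => hαc.comp (by fun_prop :
        Continuous fun p : (Euc n × Euc n) × (ι → Euc n) =>
          ((p.1.1, P2.atoms P σ p.2, p.1.2), p.2 j)).continuousOn
          (fun p hp => Set.mk_mem_prod hp (mem_univ _)))
      (show pickL n n i w ∈ _ from hw i)
    exact h.comp w (pickL n n i).hasFDerivAt

end Particles

/-! ### The algebra of the adjoint equation. -/

section Adjoint

variable {n d : ℕ} {ι : Type*} [Fintype ι]

/-- The derivative of the Hamiltonian of the particle system, in terms of the right-hand side of
the adjoint equation. -/
theorem hamiltonian_deriv_eq (p : ι → ℝ) (ζ : ι → Euc n) (fx : ι → Euc n →L[ℝ] Euc n)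
    (fa : ι → Euc d →L[ℝ] Euc n) (fm : ι → ι → Euc n →L[ℝ] Euc n) (gx : ι → Euc n →L[ℝ] ℝ)
    (ga : ι → Euc d →L[ℝ] ℝ) (gm : ι → ι → Euc n →L[ℝ] ℝ)
    (hfoc : ∀ i, ContinuousLinearMap.adjoint (fa i) (ζ i) +
      (InnerProductSpace.toDual ℝ (Euc d)).symm (ga i) = 0) (y : ι → Euc n) (b : ι → Euc d) :
    ∑ i, p i * ((gx i (y i) + ga i (b i) + ∑ j, p j • gm i j (y j)) +
      ⟪ζ i, fx i (y i) + fa i (b i) + ∑ j, p j • fm i j (y j)⟫) =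
    -∑ i, p i * ⟪-(∑ j, p j • (ContinuousLinearMap.adjoint (fm j i) (ζ j) +
      (InnerProductSpace.toDual ℝ (Euc n)).symm (gm j i))) -
      ContinuousLinearMap.adjoint (fx i) (ζ i) -
      (InnerProductSpace.toDual ℝ (Euc n)).symm (gx i), y i⟫ := by
  -- Pairing the first order condition with `b i` shows that control variations do not contribute to
  -- first order.
  have hb : ∀ i, ga i (b i) + ⟪ζ i, fa i (b i)⟫ = 0 := by
    intro i
    have := congrArg (fun v => ⟪v, b i⟫) (hfoc i)
    simp only [inner_add_left, ContinuousLinearMap.adjoint_inner_left,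
      InnerProductSpace.toDual_symm_apply, inner_zero_left] at this
    linarith
  have hl : ∀ i, p i * ((gx i (y i) + ga i (b i) + ∑ j, p j • gm i j (y j)) +
      ⟪ζ i, fx i (y i) + fa i (b i) + ∑ j, p j • fm i j (y j)⟫) =
      p i * (gx i (y i) + ⟪ζ i, fx i (y i)⟫) +
        ∑ j, p i * p j * (gm i j (y j) + ⟪ζ i, fm i j (y j)⟫) := by
    intro i
    have e : ∑ j, p i * p j * (gm i j (y j) + ⟪ζ i, fm i j (y j)⟫) =
        p i * ∑ j, p j * gm i j (y j) + p i * ∑ j, p j * ⟪ζ i, fm i j (y j)⟫ := by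
      rw [← mul_add, ← Finset.sum_add_distrib, Finset.mul_sum]
      exact Finset.sum_congr rfl fun j _ => by ring
    rw [e, inner_add_right, inner_add_right, inner_sum]
    simp only [inner_smul_right, smul_eq_mul]
    linear_combination p i * hb i
  have hr : ∀ i, p i * ⟪-(∑ j, p j • (ContinuousLinearMap.adjoint (fm j i) (ζ j) +
      (InnerProductSpace.toDual ℝ (Euc n)).symm (gm j i))) -
      ContinuousLinearMap.adjoint (fx i) (ζ i) -
      (InnerProductSpace.toDual ℝ (Euc n)).symm (gx i), y i⟫ =
      -(p i * (gx i (y i) + ⟪ζ i, fx i (y i)⟫)) -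
        ∑ j, p j * p i * (gm j i (y i) + ⟪ζ j, fm j i (y i)⟫) := by
    intro i
    rw [inner_sub_left, inner_sub_left, inner_neg_left, sum_inner]
    simp only [real_inner_smul_left, inner_add_left, ContinuousLinearMap.adjoint_inner_left,
      InnerProductSpace.toDual_symm_apply]
    have e : ∑ j, p j * p i * (gm j i (y i) + ⟪ζ j, fm j i (y i)⟫) =
        p i * ∑ j, p j * (⟪ζ j, fm j i (y i)⟫ + gm j i (y i)) := by
      rw [Finset.mul_sum]
      exact Finset.sum_congr rfl fun j _ => by ring
    rw [e]
    ring
  simp only [hl, hr, Finset.sum_add_distrib, Finset.sum_sub_distrib, Finset.sum_neg_distrib]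
  -- On the left, `i` is the particle affected and `j` the atom that moves; on the right the roles
  -- are reversed. Exchanging the sums is what puts the transposed mean-field term into the adjoint
  -- equation.
  rw [Finset.sum_comm (f := fun i j => p i * p j * (gm i j (y j) + ⟪ζ i, fm i j (y j)⟫))]
  ring

/-- The same exchange of sums, now for the terminal condition. -/
theorem terminal_deriv_eq (p : ι → ℝ) (kx : ι → Euc n →L[ℝ] ℝ) (km : ι → ι → Euc n →L[ℝ] ℝ)
    (y : ι → Euc n) :
    ∑ i, p i * (kx i (y i) + ∑ j, p j • km i j (y j)) =
    ∑ i, p i * ⟪(∑ j, p j • (InnerProductSpace.toDual ℝ (Euc n)).symm (km j i)) +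
      (InnerProductSpace.toDual ℝ (Euc n)).symm (kx i), y i⟫ := by
  simp only [inner_add_left, sum_inner, real_inner_smul_left,
    InnerProductSpace.toDual_symm_apply, mul_add, Finset.sum_add_distrib, smul_eq_mul,
    Finset.mul_sum]
  rw [Finset.sum_comm, add_comm]
  congr 1
  exact Finset.sum_congr rfl fun i _ => Finset.sum_congr rfl fun j _ => by ring

end Adjoint

/-- The standing assumptions. -/
structure Setting {n d : ℕ} {Ω : Type*} [MeasurableSpace Ω] (P : Measure Ω)
    [IsProbabilityMeasure P] (T k₀ : ℝ) (f : Euc n → P2 n → Euc d → Euc n)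
    (g : Euc n → P2 n → Euc d → ℝ) (k : Euc n → P2 n → ℝ)
    (α : Euc n → P2 n → Euc n → Euc d) (X Z : ℝ → ℝ → P2 n → Euc n → Euc n) : Prop where
  hT : 0 < T
  hk₀ : 0 < k₀
  hf : RegularCoefficient f
  hf' : BoundedDerivs f
  hg : RegularCoefficient g
  hg' : LinearGrowthDerivs g
  hk : RegularTerminal k
  hk' : LinearGrowthDerivsTerminal k
  hα : RegularControl P k₀ α
  hfoc : FirstOrderCondition k₀ f g α
  hXZ : SolvesFBODE T k₀ f g k α X Z
  hX : RegularFamily P T X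
  hZ : RegularFamily P T Z

/-! ### The forward-backward system on finitely supported laws. -/

section Particles

variable {n d : ℕ} {ι : Type*} [Fintype ι]
variable {Ω : Type*} [MeasurableSpace Ω] (P : Measure Ω) [IsProbabilityMeasure P]

/-- The values at the atoms of the family `Y` issued from a finitely supported measure. -/
def along (σ : SimpleFunc Ω ι) (Y : ℝ → ℝ → P2 n → Euc n → Euc n) (t : ℝ) (x : ι → Euc n)
    (s : ℝ) : ι → Euc n :=
  fun i => Y t s (P2.atoms P σ x) (x i)

/-- The states and the controls of the particles. -/
def alongState (σ : SimpleFunc Ω ι) (α : Euc n → P2 n → Euc n → Euc d)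
    (X Z : ℝ → ℝ → P2 n → Euc n → Euc n) (t : ℝ) (x : ι → Euc n) (s : ℝ) :
    (ι → Euc n) × (ι → Euc d) :=
  (along P σ X t x s, particleControl P σ α (along P σ X t x s, along P σ Z t x s))

/-- The mean running cost of a particle system. -/
def runningCost (σ : SimpleFunc Ω ι) (g : Euc n → P2 n → Euc d → ℝ)
    (w : (ι → Euc n) × (ι → Euc d)) : ℝ :=
  ∑ i, P2.wt P σ i * g (w.1 i) (P2.atoms P σ w.1) (w.2 i)

/-- The drift of a particle system. -/
def drift (σ : SimpleFunc Ω ι) (f : Euc n → P2 n → Euc d → Euc n)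
    (w : (ι → Euc n) × (ι → Euc d)) : ι → Euc n :=
  fun i => f (w.1 i) (P2.atoms P σ w.1) (w.2 i)

/-- The mean terminal cost of a particle system. -/
def terminalCost (σ : SimpleFunc Ω ι) (k : Euc n → P2 n → ℝ) (q : ι → Euc n) : ℝ :=
  ∑ i, P2.wt P σ i * k (q i) (P2.atoms P σ q)

/-- The pairing `∑ i, w_i ζ_i · y_i`. -/
def pairing (n : ℕ) (σ : SimpleFunc Ω ι) : (ι → Euc n) →L[ℝ] (ι → Euc n) →L[ℝ] ℝ :=
  LinearMap.toContinuousLinearMap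
    { toFun := fun ζ => atomsDeriv P σ fun j => innerSL ℝ (ζ j)
      map_add' := fun ζ ζ' => by ext1 y; simp [atomsDeriv_apply, mul_add, Finset.sum_add_distrib]
      map_smul' := fun c ζ => by
        ext1 y
        simp [atomsDeriv_apply, Finset.mul_sum, mul_left_comm] }

variable {P}

theorem pairing_apply (σ : SimpleFunc Ω ι) (ζ y : ι → Euc n) :
    pairing P n σ ζ y = ∑ i, P2.wt P σ i * ⟪ζ i, y i⟫ := by
  simp [pairing, atomsDeriv_apply]

/-- The weights are conserved and only the positions move, so the mean-field system closes on
finitely many particles. -/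
theorem flow_atoms (σ : SimpleFunc Ω ι) (X : ℝ → ℝ → P2 n → Euc n → Euc n) (t s : ℝ)
    (x : ι → Euc n) : flow X t s (P2.atoms P σ x) = P2.atoms P σ (along P σ X t x s) :=
  P2.push_law_atomLp σ x _

theorem ctrl_atoms (σ : SimpleFunc Ω ι) (α : Euc n → P2 n → Euc n → Euc d)
    (X Z : ℝ → ℝ → P2 n → Euc n → Euc n) (t s : ℝ) (x : ι → Euc n) (i : ι) :
    ctrl α X Z t s (P2.atoms P σ x) (x i) = (alongState P σ α X Z t x s).2 i := by
  rw [ctrl, flow_atoms]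
  rfl

theorem valueAlong_atoms (σ : SimpleFunc Ω ι) (T : ℝ) (g : Euc n → P2 n → Euc d → ℝ)
    (k : Euc n → P2 n → ℝ) (α : Euc n → P2 n → Euc n → Euc d)
    (X Z : ℝ → ℝ → P2 n → Euc n → Euc n) (t : ℝ) (x : ι → Euc n) :
    valueAlong T g k α X Z t (P2.atoms P σ x) = terminalCost P σ k (along P σ X t x T) +
      ∫ s in t..T, runningCost P σ g (alongState P σ α X Z t x s) := by
  have h : ∀ φ : Euc n → ℝ, ∫ y, φ y ∂(P2.atoms P σ x : Measure (Euc n)) =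
      ∑ i, P2.wt P σ i • φ (x i) := P2.integral_law_atomLp σ x
  simp only [valueAlong, h, ctrl_atoms, flow_atoms]
  rfl

variable {T k₀ : ℝ} {f : Euc n → P2 n → Euc d → Euc n} {g : Euc n → P2 n → Euc d → ℝ}
  {k : Euc n → P2 n → ℝ} {α : Euc n → P2 n → Euc n → Euc d}
  {X Z : ℝ → ℝ → P2 n → Euc n → Euc n}

theorem RegularFamily.continuousOn_along {Y : ℝ → ℝ → P2 n → Euc n → Euc n}
    (hY : RegularFamily P T Y) (σ : SimpleFunc Ω ι) :
    ContinuousOn (fun p : ℝ × ℝ × (ι → Euc n) => along P σ Y p.1 p.2.2 p.2.1)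
      {p | 0 ≤ p.1 ∧ p.1 ≤ p.2.1 ∧ p.2.1 ≤ T} := by
  have hat := P2.continuous_atoms (P := P) (n := n) σ
  rw [continuousOn_pi]
  intro i
  exact hY.continuousOn.comp (by fun_prop : Continuous fun p : ℝ × ℝ × (ι → Euc n) =>
    (p.1, p.2.1, P2.atoms P σ p.2.2, p.2.2 i)).continuousOn (fun p hp => hp)

theorem RegularControl.continuousOn_particleControl (hα : RegularControl P k₀ α)
    (σ : SimpleFunc Ω ι) :
    ContinuousOn (particleControl P σ α) (particleCone P σ n k₀) := by
  obtain ⟨A', -, hA'⟩ := hα.exists_particleDeriv σ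
  exact fun w hw => (hA' w hw).continuousAt.continuousWithinAt

theorem RegularCoefficient.continuous_runningCost (hg : RegularCoefficient g)
    (σ : SimpleFunc Ω ι) : Continuous (runningCost P σ g) :=
  continuous_finsetSum _ fun i _ => continuous_const.mul (continuous_iff_continuousAt.2
    fun w => (hg.hasFDerivAt_particle σ i w).continuousAt)

theorem RegularTerminal.continuous_terminalCost (hk : RegularTerminal k)
    (σ : SimpleFunc Ω ι) : Continuous (terminalCost P σ k) :=
  continuous_finsetSum _ fun i _ => continuous_const.mul (continuous_iff_continuousAt.2
    fun w => (hk.hasFDerivAt_particle σ i w).continuousAt)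

namespace Setting

variable (S : Setting P T k₀ f g k α X Z)
include S

theorem along_mem_cone (σ : SimpleFunc Ω ι) {t s : ℝ} (ht : t ∈ Icc 0 T) (hs : s ∈ Icc t T)
    (x : ι → Euc n) :
    (along P σ X t x s, along P σ Z t x s) ∈ particleCone P σ n k₀ := by
  intro i
  have := S.hXZ.mem_cone t ht (P2.atoms P σ x) s hs (x i)
  rwa [flow_atoms] at this

theorem continuousOn_alongState (σ : SimpleFunc Ω ι) :
    ContinuousOn (fun p : ℝ × ℝ × (ι → Euc n) => alongState P σ α X Z p.1 p.2.2 p.2.1)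
      {p | 0 ≤ p.1 ∧ p.1 ≤ p.2.1 ∧ p.2.1 ≤ T} := by
  have h1 := S.hX.continuousOn_along σ
  have h2 := S.hZ.continuousOn_along σ
  refine h1.prodMk ((S.hα.continuousOn_particleControl σ).comp (h1.prodMk h2) ?_)
  intro p hp
  exact S.along_mem_cone σ ⟨hp.1, hp.2.1.trans hp.2.2⟩ hp.2 p.2.2

theorem continuousOn_along_time {Y : ℝ → ℝ → P2 n → Euc n → Euc n} (hY : RegularFamily P T Y)
    (σ : SimpleFunc Ω ι) {t : ℝ} (ht : t ∈ Icc 0 T) (x : ι → Euc n) :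
    ContinuousOn (along P σ Y t x) (Icc t T) :=
  (hY.continuousOn_along σ).comp (by fun_prop : Continuous fun s : ℝ => (t, s, x)).continuousOn
    (fun _ hs => ⟨ht.1, hs⟩)

theorem continuousOn_alongState_time (σ : SimpleFunc Ω ι) {t : ℝ} (ht : t ∈ Icc 0 T)
    (x : ι → Euc n) : ContinuousOn (alongState P σ α X Z t x) (Icc t T) :=
  (S.continuousOn_alongState σ).comp
    (by fun_prop : Continuous fun s : ℝ => (t, s, x)).continuousOn (fun _ hs => ⟨ht.1, hs⟩)

theorem hasDerivWithinAt_along (σ : SimpleFunc Ω ι) {t s : ℝ} (ht : t ∈ Icc 0 T)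
    (hs : s ∈ Icc t T) (x : ι → Euc n) :
    HasDerivWithinAt (along P σ X t x) (drift P σ f (alongState P σ α X Z t x s)) (Icc t T) s := by
  rw [hasDerivWithinAt_pi]
  intro i
  have := S.hXZ.forward t ht (P2.atoms P σ x) s hs (x i)
  rwa [flow_atoms, ctrl_atoms] at this

/-- The adjoint equation and the first order condition for the particle system: the derivative of
the Hamiltonian. -/
theorem exists_adjoint_deriv (σ : SimpleFunc Ω ι) {t s : ℝ} (ht : t ∈ Icc 0 T)
    (hs : s ∈ Icc t T) (x : ι → Euc n) :
    ∃ ζ' : ι → Euc n, HasDerivWithinAt (along P σ Z t x) ζ' (Icc t T) s ∧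
      ∀ w : (ι → Euc n) × (ι → Euc d),
        (∑ i, P2.wt P σ i • (particleDeriv P σ g i (alongState P σ α X Z t x s) +
          (innerSL ℝ (along P σ Z t x s i)).comp
            (particleDeriv P σ f i (alongState P σ α X Z t x s)))) w =
          - pairing P n σ ζ' w.1 := by
  have hint : ∀ φ : Euc n → Euc n, ∫ y, φ y ∂(P2.atoms P σ x : Measure (Euc n)) =
      ∑ i, P2.wt P σ i • φ (x i) := P2.integral_law_atomLp σ x
  have hb := fun i => S.hXZ.backward t ht (P2.atoms P σ x) s hs (x i)
  simp only [hint, ctrl_atoms, flow_atoms] at hb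
  refine ⟨_, hasDerivWithinAt_pi.2 hb, fun w => ?_⟩
  have hfoc := fun i => S.hfoc _ _ _ (S.along_mem_cone σ ht hs x i)
  -- The integral in the backward equation has become a weighted sum over the particles, in the form
  -- required by `hamiltonian_deriv_eq`.
  have := hamiltonian_deriv_eq (P2.wt P σ) (along P σ Z t x s) _ _ hfoc w.1 w.2
    (fx := fun i => fderiv ℝ (fun ξ => f ξ (P2.atoms P σ (along P σ X t x s))
      ((alongState P σ α X Z t x s).2 i)) (along P σ X t x s i))
    (gx := fun i => fderiv ℝ (fun ξ => g ξ (P2.atoms P σ (along P σ X t x s))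
      ((alongState P σ α X Z t x s).2 i)) (along P σ X t x s i))
    (fm := fun i j => dMu (fun μ => f (along P σ X t x s i) μ ((alongState P σ α X Z t x s).2 i))
      (P2.atoms P σ (along P σ X t x s)) (along P σ X t x s j))
    (gm := fun i j => dMu (fun μ => g (along P σ X t x s i) μ ((alongState P σ α X Z t x s).2 i))
      (P2.atoms P σ (along P σ X t x s)) (along P σ X t x s j))
  rw [pairing_apply]
  refine Eq.trans ?_ this
  simp only [sum_apply, smul_apply,
    add_apply, ContinuousLinearMap.comp_apply, particleDeriv_apply, smul_eq_mul,
    innerSL_apply_apply]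
  rfl

/-- Transversality: the terminal condition makes the final costates represent the derivative of the
mean terminal cost. -/
theorem hasFDerivAt_terminalCost (σ : SimpleFunc Ω ι) {t : ℝ} (ht : t ∈ Icc 0 T)
    (x : ι → Euc n) :
    HasFDerivAt (terminalCost P σ k) (pairing P n σ (along P σ Z t x T)) (along P σ X t x T) := by
  have hint : ∀ φ : Euc n → Euc n, ∫ y, φ y ∂(P2.atoms P σ x : Measure (Euc n)) =
      ∑ i, P2.wt P σ i • φ (x i) := P2.integral_law_atomLp σ x
  have hb := fun i => S.hXZ.terminal t ht (P2.atoms P σ x) (x i)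
  simp only [hint, flow_atoms] at hb
  have h := HasFDerivAt.fun_sum (u := Finset.univ) fun i _ =>
    ((S.hk.hasFDerivAt_particle (P := P) σ i (along P σ X t x T)).const_mul (P2.wt P σ i))
  refine HasFDerivAt.congr_fderiv h ?_
  refine ContinuousLinearMap.ext fun y => ?_
  rw [pairing_apply]
  have hb' : along P σ Z t x T = _ := funext hb
  rw [hb']
  refine Eq.trans ?_ (terminal_deriv_eq (P2.wt P σ) _ _ y)
  simp only [sum_apply, smul_apply,
    ContinuousLinearMap.comp_apply, ContinuousLinearMap.prod_apply, blockDeriv_apply, smul_eq_mul]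
  rfl

end Setting

end Particles

/-! ### Uniform estimates near a compact curve. -/

section Shift

variable {S E F : Type*} [TopologicalSpace S] [NormedAddCommGroup E] [NormedSpace ℝ E]
  [NormedAddCommGroup F] [NormedSpace ℝ F]

theorem hasFDerivAt_const_add_comp {A : E → F} {A' : E →L[ℝ] F} {c y : E}
    (h : HasFDerivAt A A' (c + y)) : HasFDerivAt (fun y => A (c + y)) A' y :=
  h.comp (f := fun y => c + y) y ((hasFDerivAt_id y).const_add c)

theorem tendsto_shift {K : Set S} {Y : S → E} (hY : ContinuousOn Y K) {s : S} (hs : s ∈ K) :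
    Tendsto (fun p : S × E => Y p.1 + p.2) (𝓝[K] s ×ˢ 𝓝 (0 : E)) (𝓝 (Y s)) := by
  have := ((hY s hs).tendsto.comp tendsto_fst).add
    (tendsto_snd (f := 𝓝[K] s) (g := 𝓝 (0 : E)))
  simpa using this

/-- A continuously differentiable function is Lipschitz near a compact curve, uniformly. -/
theorem exists_lipschitz_along {K : Set S} (hK : IsCompact K) {Y : S → E} (hY : ContinuousOn Y K)
    {V : Set E} (hV : IsOpen V) (hYV : ∀ s ∈ K, Y s ∈ V) {A : E → F} {A' : E → E →L[ℝ] F}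
    (hA' : ContinuousOn A' V) (hA : ∀ w ∈ V, HasFDerivAt A (A' w) w) :
    ∃ C ≥ 0, ∃ r > 0, ∀ s ∈ K, ∀ y, ‖y‖ < r → ‖A (Y s + y) - A (Y s)‖ ≤ C * ‖y‖ := by
  have := exists_uniform_lipschitz hK (H := fun s y => A (Y s + y))
    (H' := fun s y => A' (Y s + y)) (fun s hs => ?_) (fun s hs => ?_)
  · simpa using this
  · filter_upwards [tendsto_shift hY hs (hV.mem_nhds (hYV s hs))] with p hp
    exact hasFDerivAt_const_add_comp (hA _ hp)
  · have h1 : ContinuousAt A' (Y s) := hA'.continuousAt (hV.mem_nhds (hYV s hs))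
    simpa only [add_zero] using! h1.tendsto.comp (tendsto_shift hY hs)

end Shift

/-! ### First order comparison of two particle trajectories. -/

namespace Setting

variable {n d : ℕ} {ι : Type*} [Fintype ι]
variable {Ω : Type*} [MeasurableSpace Ω] {P : Measure Ω} [IsProbabilityMeasure P]
variable {T k₀ : ℝ} {f : Euc n → P2 n → Euc d → Euc n} {g : Euc n → P2 n → Euc d → ℝ}
  {k : Euc n → P2 n → ℝ} {α : Euc n → P2 n → Euc n → Euc d}
  {X Z : ℝ → ℝ → P2 n → Euc n → Euc n}
variable (S : Setting P T k₀ f g k α X Z)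
include S

/-- Near a trajectory of the particle system the controls depend on the states and adjoint states
in a Lipschitz manner. -/
theorem exists_lipschitz_control (σ : SimpleFunc Ω ι) {t : ℝ} (ht : t ∈ Icc 0 T) (x : ι → Euc n) :
    ∃ C ≥ 0, ∃ r > 0, ∀ s ∈ Icc t T, ∀ w : (ι → Euc n) × (ι → Euc n),
      ‖w - (along P σ X t x s, along P σ Z t x s)‖ < r →
      ‖particleControl P σ α w - (alongState P σ α X Z t x s).2‖ ≤
        C * ‖w - (along P σ X t x s, along P σ Z t x s)‖ := by
  obtain ⟨A', hA'c, hA'⟩ := S.hα.exists_particleDeriv σ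
  obtain ⟨C, hC, r, hr, h⟩ := exists_lipschitz_along isCompact_Icc
    ((S.continuousOn_along_time S.hX σ ht x).prodMk (S.continuousOn_along_time S.hZ σ ht x))
    (isOpen_particleCone σ k₀) (fun s hs => S.along_mem_cone σ ht hs x) hA'c hA'
  refine ⟨C, hC, r, hr, fun s hs w hw => ?_⟩
  have := h s hs _ hw
  rwa [add_sub_cancel] at this

/-- First order expansion of the Hamiltonian of the particle system. -/
theorem exists_hamiltonian_expansion (σ : SimpleFunc Ω ι) {t : ℝ} (ht : t ∈ Icc 0 T)
    (x : ι → Euc n) {ε : ℝ} (hε : 0 < ε) :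
    ∃ r > 0, ∀ s ∈ Icc t T, ∀ w : (ι → Euc n) × (ι → Euc d),
      ‖w - alongState P σ α X Z t x s‖ < r →
      |runningCost P σ g w - runningCost P σ g (alongState P σ α X Z t x s) +
        pairing P n σ (along P σ Z t x s)
          (drift P σ f w - drift P σ f (alongState P σ α X Z t x s)) -
        (∑ i, P2.wt P σ i • (particleDeriv P σ g i (alongState P σ α X Z t x s) +
          (innerSL ℝ (along P σ Z t x s i)).comp
            (particleDeriv P σ f i (alongState P σ α X Z t x s))))
          (w - alongState P σ α X Z t x s)| ≤ ε * ‖w - alongState P σ α X Z t x s‖ := by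
  have hY := S.continuousOn_alongState_time σ ht x
  have hζ := S.continuousOn_along_time S.hZ σ ht x
  -- The costate is frozen at its value on the reference trajectory; only states and controls vary,
  -- through the shift `w`.
  have key := exists_uniform_expansion (isCompact_Icc : IsCompact (Icc t T))
    (H := fun s w => ∑ i, P2.wt P σ i * (
      g ((alongState P σ α X Z t x s + w).1 i) (P2.atoms P σ (alongState P σ α X Z t x s + w).1)
        ((alongState P σ α X Z t x s + w).2 i) + ⟪along P σ Z t x s i,
      f ((alongState P σ α X Z t x s + w).1 i) (P2.atoms P σ (alongState P σ α X Z t x s + w).1)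
        ((alongState P σ α X Z t x s + w).2 i)⟫))
    (H' := fun s w => ∑ i, P2.wt P σ i • (particleDeriv P σ g i (alongState P σ α X Z t x s + w) +
          (innerSL ℝ (along P σ Z t x s i)).comp
            (particleDeriv P σ f i (alongState P σ α X Z t x s + w)))) (fun s hs => ?_)
    (fun s hs => ?_) hε
  · obtain ⟨r, hr, h⟩ := key
    refine ⟨r, hr, fun s hs w hw => ?_⟩
    have := h s hs _ hw
    simp only [add_sub_cancel, add_zero] at this
    rw [Real.norm_eq_abs] at this
    refine le_of_eq_of_le ?_ this
    congr 2
    simp only [map_sub, pairing_apply, runningCost, drift, mul_add, Finset.sum_add_distrib]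
    ring
  · refine Eventually.of_forall fun p => ?_
    refine HasFDerivAt.fun_sum fun i _ => HasFDerivAt.const_mul ?_ _
    refine HasFDerivAt.add ?_ ?_
    · exact hasFDerivAt_const_add_comp (S.hg.hasFDerivAt_particle σ i _)
    · exact ((innerSL ℝ (along P σ Z t x p.1 i)).hasFDerivAt.comp p.2
        (hasFDerivAt_const_add_comp
          (S.hf.hasFDerivAt_particle σ i (alongState P σ α X Z t x p.1 + p.2))))
  · have hsh := tendsto_shift hY hs
    simp only [add_zero]
    refine tendsto_finsetSum _ fun i _ => Tendsto.const_smul (Tendsto.add ?_ ?_) _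
    · exact ((S.hg.continuous_particleDeriv σ i).tendsto _).comp hsh
    · have h1 : Tendsto (fun p : ℝ × ((ι → Euc n) × (ι → Euc d)) =>
          innerSL ℝ (along P σ Z t x p.1 i)) (𝓝[Icc t T] s ×ˢ 𝓝 0)
          (𝓝 (innerSL ℝ (along P σ Z t x s i))) := by
        refine ((innerSL ℝ).continuous.tendsto _).comp ?_
        exact (tendsto_pi_nhds.1 ((hζ s hs).tendsto.comp tendsto_fst) i)
      have h2 := ((S.hf.continuous_particleDeriv (P := P) σ i).tendsto _).comp hsh
      exact (isBoundedBilinearMap_comp.continuous.tendsto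
        (innerSL ℝ (along P σ Z t x s i), particleDeriv P σ f i (alongState P σ α X Z t x s))).comp
        (h1.prodMk_nhds h2)

/-- First order comparison of the values of two particle systems. -/
theorem value_expansion (σ : SimpleFunc Ω ι) {t : ℝ} (ht : t ∈ Icc 0 T) (x : ι → Euc n)
    {C : ℝ} (hC : 0 ≤ C) {η : ℝ} (hη : 0 < η) :
    ∃ ρ > 0, ∀ ε, 0 ≤ ε → ε < ρ → ∀ t' ∈ Icc t T, ∀ x' : ι → Euc n,
      (∀ s ∈ Icc t' T, ‖along P σ X t' x' s - along P σ X t x s‖ ≤ C * ε ∧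
        ‖along P σ Z t' x' s - along P σ Z t x s‖ ≤ C * ε) →
      |valueAlong T g k α X Z t' (P2.atoms P σ x') -
        (terminalCost P σ k (along P σ X t x T) +
          ∫ s in t'..T, runningCost P σ g (alongState P σ α X Z t x s)) -
        pairing P n σ (along P σ Z t x t') (x' - along P σ X t x t')| ≤ η * ε := by
  have hT := S.hT
  obtain ⟨Ca, hCa, ra, hra, hLip⟩ := S.exists_lipschitz_control σ ht x
  -- `M * ε` bounds the distance of the states together with the controls: the state part costs `C *
  -- ε`, the control part `Ca * C * ε`.
  set M := C * (1 + Ca) with hM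
  have hM0 : 0 ≤ M := by positivity
  have hCM : C ≤ M := by nlinarith
  -- Each of the two errors, running cost over a time at most `T` and terminal cost, is allotted `η
  -- / 2 * ε`. Adding `1` keeps the denominators positive when `M` or `C` vanishes.
  set ε₁ := η / (2 * (M + 1) * T) with hε₁
  have hε₁0 : 0 < ε₁ := by positivity
  set ε₂ := η / (2 * (C + 1)) with hε₂
  have hε₂0 : 0 < ε₂ := by positivity
  obtain ⟨r₁, hr₁, hH⟩ := S.exists_hamiltonian_expansion σ ht x hε₁0
  have hK := (S.hasFDerivAt_terminalCost σ ht x).isLittleO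
  rw [Asymptotics.isLittleO_iff] at hK
  obtain ⟨r₂, hr₂, hK⟩ := Metric.eventually_nhds_iff.1 (hK hε₂0)
  set r := min ra (min r₁ r₂) with hr
  have hr0 : 0 < r := lt_min hra (lt_min hr₁ hr₂)
  refine ⟨r / (M + 1), by positivity, fun ε hε0 hε t' ht' x' hclose => ?_⟩
  have hMε : M * ε < r := by
    rw [lt_div_iff₀ (by positivity)] at hε
    nlinarith
  have hCε : C * ε ≤ M * ε := mul_le_mul_of_nonneg_right hCM hε0
  have ht'0 : t' ∈ Icc 0 T := ⟨ht.1.trans ht'.1, ht'.2⟩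
  have hsub : Icc t' T ⊆ Icc t T := Icc_subset_Icc_left ht'.1
  have hTm : T ∈ Icc t' T := right_mem_Icc.2 ht'.2
  -- closeness of the states including the controls
  have hstate : ∀ s ∈ Icc t' T,
      ‖alongState P σ α X Z t' x' s - alongState P σ α X Z t x s‖ ≤ M * ε := by
    intro s hs
    obtain ⟨h1, h2⟩ := hclose s hs
    have h3 : ‖(along P σ X t' x' s, along P σ Z t' x' s) -
        (along P σ X t x s, along P σ Z t x s)‖ ≤ C * ε := by
      rw [Prod.norm_def]
      exact max_le h1 h2
    have h4 := hLip s (hsub hs) (along P σ X t' x' s, along P σ Z t' x' s)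
      (h3.trans_lt (hCε.trans_lt (hMε.trans_le (min_le_left _ _))))
    rw [Prod.norm_def]
    refine max_le (h1.trans hCε) (h4.trans ?_)
    calc Ca * _ ≤ Ca * (C * ε) := mul_le_mul_of_nonneg_left h3 hCa
      _ ≤ M * ε := by
        rw [hM]
        nlinarith [mul_nonneg hC hε0]
  choose! ζ' hζ' hζ'H using fun s (hs : s ∈ Icc t T) => S.exists_adjoint_deriv σ ht hs x
  have hcost := cost_expansion ht'.2 (q := along P σ X t' x') (q₀ := along P σ X t x)
    (φ := fun s => drift P σ f (alongState P σ α X Z t' x' s))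
    (φ₀ := fun s => drift P σ f (alongState P σ α X Z t x s))
    (z := fun s => pairing P n σ (along P σ Z t x s))
    (z' := fun s => pairing P n σ (ζ' s))
    (γ := fun s => runningCost P σ g (alongState P σ α X Z t' x' s))
    (γ₀ := fun s => runningCost P σ g (alongState P σ α X Z t x s))
    (η := ε₁ * (M * ε))
    (fun s hs => S.hasDerivWithinAt_along σ ht'0 hs x')
    (fun s hs => (S.hasDerivWithinAt_along σ ht (hsub hs) x).mono hsub)
    (fun s hs => (pairing P n σ).hasFDerivAt.comp_hasDerivWithinAt s
      ((hζ' s (hsub hs)).mono hsub))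
    ((S.hg.continuous_runningCost σ).comp_continuousOn
      (S.continuousOn_alongState_time σ ht'0 x'))
    (((S.hg.continuous_runningCost σ).comp_continuousOn
      (S.continuousOn_alongState_time σ ht x)).mono hsub)
    (fun s hs => by
      have h1 := hH s (hsub hs) (alongState P σ α X Z t' x' s)
        ((hstate s hs).trans_lt (hMε.trans_le ((min_le_right _ _).trans (min_le_left _ _))))
      -- By the adjoint equation the linear term of the expansion is minus the pairing of `ζ'` with
      -- the displacement of the states, so the remainder required by `cost_expansion` is the second
      -- order remainder of the Hamiltonian.
      rw [hζ'H s (hsub hs), sub_neg_eq_add] at h1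
      exact h1.trans (mul_le_mul_of_nonneg_left (hstate s hs) hε₁0.le))
  have hterm := hK (y := along P σ X t' x' T) (by
    rw [dist_eq_norm]
    exact (hclose T hTm).1.trans_lt
      (hCε.trans_lt (hMε.trans_le ((min_le_right _ _).trans (min_le_right _ _)))))
  rw [Real.norm_eq_abs] at hterm
  replace hterm := hterm.trans (mul_le_mul_of_nonneg_left (hclose T hTm).1 hε₂0.le)
  have hinit : along P σ X t' x' t' = x' := funext fun i => S.hXZ.initial t' ht'0 _ _
  rw [hinit] at hcost
  rw [valueAlong_atoms]
  have hfin : ε₁ * (M * ε) * (T - t') + ε₂ * (C * ε) ≤ η * ε := by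
    have hb1 : ε₁ * (M * ε) * (T - t') ≤ η / 2 * ε := by
      have : ε₁ * (M + 1) * T = η / 2 := by
        rw [hε₁]
        field_simp
      rw [← this]
      have h5 : T - t' ≤ T := by linarith [ht'0.1]
      have h6 : 0 ≤ ε₁ * (M * ε) := by positivity
      calc _ ≤ ε₁ * (M * ε) * T := mul_le_mul_of_nonneg_left h5 h6
        _ ≤ _ := by nlinarith [mul_nonneg (mul_nonneg hε₁0.le hε0) hT.le]
    have hb2 : ε₂ * (C * ε) ≤ η / 2 * ε := by
      have : ε₂ * (C + 1) = η / 2 := by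
        rw [hε₂]
        field_simp
      rw [← this]
      nlinarith [mul_nonneg hε₂0.le hε0]
    linarith
  refine le_trans ?_ hfin
  refine le_trans (le_of_eq ?_) ((abs_add_le _ _).trans (add_le_add hcost hterm))
  congr 1
  ring

end Setting

/-! ### Lipschitz dependence of trajectories on the initial data. -/

section Families

variable {n : ℕ} {ι : Type*} [Fintype ι]
variable {Ω : Type*} [MeasurableSpace Ω] {P : Measure Ω} [IsProbabilityMeasure P] {T : ℝ}

/-- Moving the atoms changes both the initial law and the points at which the family is evaluated,
so the space and measure derivatives combine. Their joint continuity and compactness of `[t, T]`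
give one constant for all times. -/
theorem RegularFamily.exists_lipschitz_initial {Y : ℝ → ℝ → P2 n → Euc n → Euc n}
    (hY : RegularFamily P T Y) (σ : SimpleFunc Ω ι) {t : ℝ} (ht : t ∈ Icc 0 T) (x : ι → Euc n) :
    ∃ C ≥ 0, ∃ r > 0, ∀ s ∈ Icc t T, ∀ y : ι → Euc n, ‖y‖ < r →
      ‖along P σ Y t (x + y) s - along P σ Y t x s‖ ≤ C * ‖y‖ := by
  classical
  have hat := P2.continuous_atoms (P := P) (n := n) σ
  obtain ⟨Yx, hYx, cYx⟩ := hY.diff_x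
  obtain ⟨Ym, hYm, cYm⟩ := hY.diff_m
  let L : ι → (ι → Euc n) →L[ℝ] Euc n × (ι → Euc n) := fun i =>
    (ContinuousLinearMap.proj (R := ℝ) (φ := fun _ : ι => Euc n) i).prod
      (ContinuousLinearMap.id ℝ (ι → Euc n))
  let B : ℝ → (ι → Euc n) → ι → (ι → Euc n) →L[ℝ] Euc n := fun s q i =>
    (blockDeriv P σ (Yx t s (P2.atoms P σ q) (q i))
      fun j => Ym t s (P2.atoms P σ q) (q i) (q j)).comp (L i)
  have hB : ∀ s ∈ Icc t T, ∀ q i,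
      HasFDerivAt (fun q => along P σ Y t q s i) (B s q i) q := by
    intro s hs q i
    have htri : ∀ m x, (t, s, m, x) ∈ triangle n T := fun m x => ⟨ht.1, hs⟩
    have h := hasFDerivAt_block (P := P) (σ := σ) (Φ := fun p μ => Y t s μ p)
      (D₁ := fun (p : Euc n) μ => Yx t s μ p)
      (D := fun p μ y => Ym t s μ p y) isOpen_univ
      (fun p _ => hYx t s _ _ (htri _ _))
      (fun p _ => (hYm t s _ p.1 (htri _ _)).hasFDerivAt_atomsDeriv)
      (cYx.comp (by fun_prop : Continuous fun p : Euc n × (ι → Euc n) =>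
          (t, s, P2.atoms P σ p.2, p.1)).continuousOn (fun p _ => htri _ _))
      (fun j => cYm.comp (by fun_prop : Continuous fun p : Euc n × (ι → Euc n) =>
          ((t, s, P2.atoms P σ p.2, p.1), p.2 j)).continuousOn
          (fun p _ => Set.mk_mem_prod (htri _ _) (mem_univ _))) (mem_univ (q i, q))
    exact HasFDerivAt.comp (f := fun q : ι → Euc n => (q i, q)) q h (L i).hasFDerivAt
  have hc : ∀ s ∈ Icc t T, ∀ i, Tendsto (fun p : ℝ × (ι → Euc n) => B p.1 (x + p.2) i)
      (𝓝[Icc t T] s ×ˢ 𝓝 0) (𝓝 (B s (x + 0) i)) := by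
    intro s hs i
    have hl : 𝓝[Icc t T] s ×ˢ 𝓝 (0 : ι → Euc n) = 𝓝[Icc t T ×ˢ univ] (s, 0) := by
      rw [nhdsWithin_prod_eq, nhdsWithin_univ]
    have hsm : (s, (0 : ι → Euc n)) ∈ Icc t T ×ˢ (univ : Set (ι → Euc n)) :=
      Set.mk_mem_prod hs (mem_univ _)
    rw [hl]
    have c1 : ContinuousOn (fun p : ℝ × (ι → Euc n) =>
        Yx t p.1 (P2.atoms P σ (x + p.2)) ((x + p.2) i)) (Icc t T ×ˢ univ) :=
      cYx.comp (by fun_prop : Continuous fun p : ℝ × (ι → Euc n) =>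
        (t, p.1, P2.atoms P σ (x + p.2), (x + p.2) i)).continuousOn (fun p hp => ⟨ht.1, hp.1⟩)
    have c2 : ∀ j, ContinuousOn (fun p : ℝ × (ι → Euc n) =>
        Ym t p.1 (P2.atoms P σ (x + p.2)) ((x + p.2) i) ((x + p.2) j)) (Icc t T ×ˢ univ) :=
      fun j => cYm.comp (by fun_prop : Continuous fun p : ℝ × (ι → Euc n) =>
        ((t, p.1, P2.atoms P σ (x + p.2), (x + p.2) i), (x + p.2) j)).continuousOn
        (fun p hp => Set.mk_mem_prod ⟨ht.1, hp.1⟩ (mem_univ _))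
    have c3 : ContinuousWithinAt (fun p : ℝ × (ι → Euc n) => blockDeriv P σ
        (Yx t p.1 (P2.atoms P σ (x + p.2)) ((x + p.2) i))
        fun j => Ym t p.1 (P2.atoms P σ (x + p.2)) ((x + p.2) i) ((x + p.2) j))
        (Icc t T ×ˢ univ) (s, 0) :=
      tendsto_blockDeriv σ (c1 _ hsm) fun j => c2 j _ hsm
    exact c3.clm_comp continuousWithinAt_const

  have key := exists_uniform_lipschitz (isCompact_Icc : IsCompact (Icc t T))
    (H := fun s y => along P σ Y t (x + y) s)
    (H' := fun s y => ∑ i, (ContinuousLinearMap.single ℝ (fun _ : ι => Euc n) i).comp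
      (B s (x + y) i)) (fun s hs => ?_) (fun s hs => ?_)
  · simpa using key
  · have h1 : ∀ᶠ p in 𝓝[Icc t T] s ×ˢ 𝓝 (0 : ι → Euc n), p.1 ∈ Icc t T :=
      tendsto_fst.eventually eventually_mem_nhdsWithin
    filter_upwards [h1] with p hp
    have h2 := hasFDerivAt_pi_single (A := fun q => along P σ Y t q p.1)
      (B := fun i => B p.1 (x + p.2) i) (fun i => hB p.1 hp (x + p.2) i)
    exact hasFDerivAt_const_add_comp h2
  · refine tendsto_finsetSum _ fun i _ => ?_
    have h2 : Tendsto (fun p : ℝ × (ι → Euc n) =>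
        (ContinuousLinearMap.single ℝ (fun _ : ι => Euc n) i, B p.1 (x + p.2) i))
        (𝓝[Icc t T] s ×ˢ 𝓝 0)
        (𝓝 (ContinuousLinearMap.single ℝ (fun _ : ι => Euc n) i, B s (x + 0) i)) :=
      tendsto_const_nhds.prodMk_nhds (hc s hs i)
    exact (isBoundedBilinearMap_comp.continuous.tendsto _).comp h2

/-- For fixed atoms the derivative in the initial time is continuous, hence bounded, on the compact
triangle `0 ≤ t ≤ s ≤ T`. -/
theorem RegularFamily.exists_lipschitz_time {Y : ℝ → ℝ → P2 n → Euc n → Euc n}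
    (hY : RegularFamily P T Y) (σ : SimpleFunc Ω ι) (x : ι → Euc n) :
    ∃ C ≥ 0, ∀ t ∈ Icc 0 T, ∀ t' ∈ Icc t T, ∀ s ∈ Icc t' T,
      ‖along P σ Y t' x s - along P σ Y t x s‖ ≤ C * (t' - t) := by
  obtain ⟨Yt, hYt, cYt⟩ := hY.diff_t
  have hK : IsCompact {p : ℝ × ℝ | 0 ≤ p.1 ∧ p.1 ≤ p.2 ∧ p.2 ≤ T} := by
    refine (isCompact_Icc (a := ((0 : ℝ), (0 : ℝ))) (b := (T, T))).of_isClosed_subset ?_ ?_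
    · exact (isClosed_le continuous_const continuous_fst).inter
        ((isClosed_le continuous_fst continuous_snd).inter
          (isClosed_le continuous_snd continuous_const))
    · rintro ⟨a, b⟩ ⟨h1, h2, h3⟩
      exact ⟨⟨h1, h1.trans h2⟩, ⟨h2.trans h3, h3⟩⟩
  have hc : ContinuousOn (fun p : ℝ × ℝ => fun i => Yt p.1 p.2 (P2.atoms P σ x) (x i))
      {p : ℝ × ℝ | 0 ≤ p.1 ∧ p.1 ≤ p.2 ∧ p.2 ≤ T} := by
    rw [continuousOn_pi]
    intro i
    exact cYt.comp (by fun_prop : Continuous fun p : ℝ × ℝ =>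
      (p.1, p.2, P2.atoms P σ x, x i)).continuousOn (fun p hp => hp)
  obtain ⟨C, hC⟩ := hK.exists_bound_of_continuousOn hc
  refine ⟨|C|, abs_nonneg _, fun t ht t' ht' s hs => ?_⟩
  rw [pi_norm_le_iff_of_nonneg (mul_nonneg (abs_nonneg _) (sub_nonneg.2 ht'.1))]
  intro i
  refine norm_image_sub_le_of_norm_deriv_le_segment'
    (f := fun r => Y r s (P2.atoms P σ x) (x i)) (f' := fun r => Yt r s (P2.atoms P σ x) (x i))
    (fun r hr => ?_) (fun r hr => ?_) t' (right_mem_Icc.2 ht'.1)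
  · exact (hYt r s _ _ ⟨ht.1.trans hr.1, hr.2.trans hs.1, hs.2⟩).mono
      (Icc_subset_Icc ht.1 hs.1)
  · refine (norm_le_pi_norm (fun i => Yt r s (P2.atoms P σ x) (x i)) i).trans
      ((hC (r, s) ⟨ht.1.trans hr.1, hr.2.le.trans hs.1, hs.2⟩).trans (le_abs_self C))

end Families

/-! ### Derivatives of the value at finitely supported laws. -/

namespace Setting

variable {n d : ℕ} {ι : Type*} [Fintype ι]
variable {Ω : Type*} [MeasurableSpace Ω] {P : Measure Ω} [IsProbabilityMeasure P]
variable {T k₀ : ℝ} {f : Euc n → P2 n → Euc d → Euc n} {g : Euc n → P2 n → Euc d → ℝ}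
  {k : Euc n → P2 n → ℝ} {α : Euc n → P2 n → Euc n → Euc d}
  {X Z : ℝ → ℝ → P2 n → Euc n → Euc n}
variable (S : Setting P T k₀ f g k α X Z)
include S

theorem along_initial (σ : SimpleFunc Ω ι) {t : ℝ} (ht : t ∈ Icc 0 T) (x : ι → Euc n) :
    along P σ X t x t = x :=
  funext fun _ => S.hXZ.initial t ht _ _

/-- The value function is differentiable in the positions of finitely many atoms. -/
theorem hasFDerivAt_value_atoms (σ : SimpleFunc Ω ι) {t : ℝ} (ht : t ∈ Icc 0 T) (x : ι → Euc n) :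
    HasFDerivAt (fun x => valueAlong T g k α X Z t (P2.atoms P σ x))
      (pairing P n σ (along P σ Z t x t)) x := by
  obtain ⟨C₁, hC₁, r₁, hr₁, h₁⟩ := S.hX.exists_lipschitz_initial σ ht x
  obtain ⟨C₂, hC₂, r₂, hr₂, h₂⟩ := S.hZ.exists_lipschitz_initial σ ht x
  rw [hasFDerivAt_iff_isLittleO, Asymptotics.isLittleO_iff]
  intro η hη
  obtain ⟨ρ, hρ, h⟩ := S.value_expansion σ ht x (le_max_of_le_left hC₁ : 0 ≤ max C₁ C₂) hη
  filter_upwards [Metric.ball_mem_nhds x (lt_min hρ (lt_min hr₁ hr₂))] with x' hx'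
  rw [Metric.mem_ball, dist_eq_norm, lt_min_iff, lt_min_iff] at hx'
  -- Here the starting time is unchanged and the displacement of the atoms serves as `ε`.
  have := h ‖x' - x‖ (norm_nonneg _) hx'.1 t ⟨le_rfl, ht.2⟩ x' (fun s hs => ?_)
  · rwa [← valueAlong_atoms, S.along_initial σ ht] at this
  · have e1 := h₁ s hs (x' - x) hx'.2.1
    have e2 := h₂ s hs (x' - x) hx'.2.2
    rw [add_sub_cancel] at e1 e2
    exact ⟨e1.trans (mul_le_mul_of_nonneg_right (le_max_left _ _) (norm_nonneg _)),
      e2.trans (mul_le_mul_of_nonneg_right (le_max_right _ _) (norm_nonneg _))⟩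

/-- The right derivative of the value function in time at a finitely supported measure. -/
theorem hasDerivWithinAt_value_atoms (σ : SimpleFunc Ω ι) {t : ℝ} (ht : t ∈ Ico 0 T)
    (x : ι → Euc n) :
    HasDerivWithinAt (fun r => valueAlong T g k α X Z r (P2.atoms P σ x))
      (-(runningCost P σ g (alongState P σ α X Z t x t) + pairing P n σ (along P σ Z t x t)
        (drift P σ f (alongState P σ α X Z t x t)))) (Ici t) t := by
  have ht' : t ∈ Icc 0 T := Ico_subset_Icc_self ht
  have htt : t ∈ Icc t T := ⟨le_rfl, ht'.2⟩
  have hnhds : Icc t T ∈ 𝓝[≥] t := Icc_mem_nhdsGE ht.2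
  obtain ⟨C₁, hC₁, h₁⟩ := S.hX.exists_lipschitz_time σ x
  obtain ⟨C₂, hC₂, h₂⟩ := S.hZ.exists_lipschitz_time σ x
  set G := fun s => runningCost P σ g (alongState P σ α X Z t x s) with hG
  have hGc : ContinuousOn G (Icc t T) :=
    (S.hg.continuous_runningCost σ).comp_continuousOn (S.continuousOn_alongState_time σ ht' x)
  -- First order prediction of the value at `(r, x)`: the cost left after time `r` on the trajectory
  -- started at `t`, corrected by the costate paired with the displacement from that trajectory back
  -- to `x`.
  set B : ℝ → ℝ := fun r => valueAlong T g k α X Z t (P2.atoms P σ x) - (∫ s in t..r, G s) +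
    pairing P n σ (along P σ Z t x r) (x - along P σ X t x r) with hB
  have hBd : HasDerivWithinAt B (-(G t + pairing P n σ (along P σ Z t x t)
        (drift P σ f (alongState P σ α X Z t x t)))) (Ici t) t := by
    obtain ⟨ζ', hζ', -⟩ := S.exists_adjoint_deriv σ ht' htt x
    have d1 : HasDerivWithinAt (fun r => ∫ s in t..r, G s) (G t) (Icc t T) t := by
      have : Fact (t ∈ Icc t T) := ⟨htt⟩
      exact intervalIntegral.integral_hasDerivWithinAt_right (by simp)
        (hGc.stronglyMeasurableAtFilter_nhdsWithin measurableSet_Icc t) (hGc t htt)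
    have d2 := (((pairing P n σ).hasFDerivAt.comp_hasDerivWithinAt t hζ').clm_apply
      ((S.hasDerivWithinAt_along σ ht' htt x).const_sub x))
    have d3 := (d1.const_sub (valueAlong T g k α X Z t (P2.atoms P σ x))).add d2
    refine (d3.mono_of_mem_nhdsWithin hnhds).congr_deriv ?_
    -- The displacement vanishes at `r = t`, so the derivative of the costate drops out.
    rw [S.along_initial σ ht']
    simp
    ring
  have hBt : B t = valueAlong T g k α X Z t (P2.atoms P σ x) := by
    simp [hB, S.along_initial σ ht']
  have hdiff : HasDerivWithinAt
      (fun r => valueAlong T g k α X Z r (P2.atoms P σ x) - B r) 0 (Ici t) t := by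
    rw [hasDerivWithinAt_iff_isLittleO, Asymptotics.isLittleO_iff]
    intro η hη
    obtain ⟨ρ, hρ, h⟩ := S.value_expansion σ ht' x (le_max_of_le_left hC₁ : 0 ≤ max C₁ C₂) hη
    have hev : ∀ᶠ r in 𝓝[≥] t, r < t + ρ :=
      mem_nhdsWithin_of_mem_nhds (Iio_mem_nhds (by linarith))
    filter_upwards [hnhds, hev] with r hr hrρ
    have hr0 : 0 ≤ r - t := sub_nonneg.2 hr.1
    -- The atoms are unchanged and the delay `r - t` serves as `ε`.
    have := h (r - t) hr0 (by linarith) r hr x (fun s hs => ?_)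
    · have hsplit : ∫ s in t..T, G s = (∫ s in t..r, G s) + ∫ s in r..T, G s := by
        refine (intervalIntegral.integral_add_adjacent_intervals ?_ ?_).symm
        · exact (hGc.mono (Icc_subset_Icc_right hr.2)).intervalIntegrable_of_Icc hr.1
        · exact (hGc.mono (Icc_subset_Icc_left hr.1)).intervalIntegrable_of_Icc hr.2
      rw [hBt, sub_self, smul_zero, sub_zero, sub_zero, Real.norm_eq_abs, Real.norm_of_nonneg hr0]
      refine le_of_eq_of_le ?_ this
      congr 1
      simp only [hB]
      rw [valueAlong_atoms (t := t)]
      change _ - (_ + (∫ s in t..T, G s) - _ + _) = _ - (_ + ∫ s in r..T, G s) - _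
      rw [hsplit]
      ring
    · exact ⟨(h₁ t ht' r hr s hs).trans (mul_le_mul_of_nonneg_right (le_max_left _ _) hr0),
        (h₂ t ht' r hr s hs).trans (mul_le_mul_of_nonneg_right (le_max_right _ _) hr0)⟩
  refine ((hdiff.add hBd).congr_deriv (zero_add _)).congr_of_mem (fun r _ => ?_) self_mem_Ici
  simp

/-- Continuity is needed to apply the mean value inequality with right derivatives only. Clamping
both times into the triangle makes the running cost continuous on the whole plane. -/
theorem continuousOn_value_atoms (σ : SimpleFunc Ω ι) (x : ι → Euc n) :
    ContinuousOn (fun r => valueAlong T g k α X Z r (P2.atoms P σ x)) (Icc 0 T) := by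
  have hT := S.hT.le
  let c : ℝ → ℝ := fun r => max 0 (min r T)
  have hc : ∀ r, c r ∈ Icc 0 T := fun r => ⟨le_max_left _ _, max_le hT (min_le_right _ _)⟩
  have hcr : ∀ r ∈ Icc 0 T, c r = r := fun r hr => by simp [c, hr.1, hr.2]
  let φ : ℝ → ℝ → ℝ := fun r s =>
    runningCost P σ g (alongState P σ α X Z (c r) x (max (c r) (min s T)))
  have hφ : Continuous φ.uncurry := by
    refine (S.hg.continuous_runningCost σ).comp ?_
    exact (S.continuousOn_alongState σ).comp_continuous (by fun_prop :
      Continuous fun p : ℝ × ℝ => (c p.1, max (c p.1) (min p.2 T), x))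
      (fun p => ⟨(hc _).1, le_max_left _ _, max_le (hc _).2 (min_le_right _ _)⟩)
  have h1 : Continuous fun r => -∫ s in T..r, φ r s :=
    (intervalIntegral.continuous_parametric_intervalIntegral_of_continuous hφ continuous_id).neg
  have h2 : ContinuousOn (fun r => terminalCost P σ k (along P σ X r x T)) (Icc 0 T) := by
    refine (S.hk.continuous_terminalCost σ).comp_continuousOn ?_
    exact (S.hX.continuousOn_along σ).comp (by fun_prop :
      Continuous fun r : ℝ => (r, T, x)).continuousOn (fun r hr => ⟨hr.1, hr.2, le_rfl⟩)
  refine (h2.add h1.continuousOn).congr fun r hr => ?_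
  rw [valueAlong_atoms, Pi.add_apply, ← intervalIntegral.integral_symm]
  congr 1
  refine intervalIntegral.integral_congr fun s hs => ?_
  rw [uIcc_of_le hr.2] at hs
  simp only [φ, hcr r hr, min_eq_left hs.2, max_eq_right hs.1]

end Setting

/-! ### Superposition operators on `L²`. -/

section Nemytskii

variable {n : ℕ} {Ω : Type*} [MeasurableSpace Ω] {P : Measure Ω} [IsProbabilityMeasure P]

/-- A convergent sequence in `L²` has a subsequence which is dominated in `L²` and converges
almost everywhere. -/
theorem exists_subseq_dominated {ξ : ℕ → Lp (Euc n) 2 P} {ξ₀ : Lp (Euc n) 2 P}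
    (h : Tendsto ξ atTop (𝓝 ξ₀)) :
    ∃ φ : ℕ → ℕ, StrictMono φ ∧ ∃ b : Ω → ℝ, MemLp b 2 P ∧
      (∀ᵐ ω ∂P, ∀ j, ‖ξ (φ j) ω‖ ≤ b ω) ∧
      ∀ᵐ ω ∂P, Tendsto (fun j => ξ (φ j) ω) atTop (𝓝 (ξ₀ ω)) := by
  obtain ⟨φ₁, hφ₁, hae⟩ := (tendstoInMeasure_of_tendsto_Lp h).exists_seq_tendsto_ae
  have h1 : Tendsto (fun j => ‖ξ (φ₁ j) - ξ₀‖) atTop (𝓝 0) := by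
    have := (h.comp hφ₁.tendsto_atTop).sub_const ξ₀
    simpa using this.norm
  -- A second extraction makes the `L²` distances geometrically small, so the functions `‖ξ j - ξ₀‖`
  -- are summable in `L²`; their sum plus `‖ξ₀‖` is the dominating function.
  obtain ⟨φ₂, hφ₂, hsmall⟩ := extraction_forall_of_eventually'
    (P := fun j N => ‖ξ (φ₁ N) - ξ₀‖ < (1 / 2) ^ j)
    (fun j => eventually_atTop.1 (h1.eventually_lt_const (by positivity)))
  let u : ℕ → Lp ℝ 2 P := fun j => (Lp.memLp (ξ (φ₁ (φ₂ j)) - ξ₀)).norm.toLp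
  have hu : ∀ j, u j =ᵐ[P] fun ω => ‖ξ (φ₁ (φ₂ j)) ω - ξ₀ ω‖ := by
    intro j
    filter_upwards [MemLp.coeFn_toLp (Lp.memLp (ξ (φ₁ (φ₂ j)) - ξ₀)).norm,
      Lp.coeFn_sub (ξ (φ₁ (φ₂ j))) ξ₀] with ω h2 h3
    rw [h2, h3, Pi.sub_apply]
  have hun : ∀ j, ‖u j‖ = ‖ξ (φ₁ (φ₂ j)) - ξ₀‖ := by
    intro j
    rw [Lp.norm_toLp, eLpNorm_norm, Lp.norm_def]
  have hsum : Summable u := by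
    refine Summable.of_norm_bounded summable_geometric_two fun j => ?_
    rw [hun]
    exact (hsmall j).le
  have hu0 : ∀ j, 0 ≤ u j := by
    intro j
    rw [← Lp.coeFn_le]
    filter_upwards [hu j, Lp.coeFn_zero ℝ 2 P] with ω h2 h3
    rw [h2, h3]
    exact norm_nonneg _
  have hle : ∀ j, u j ≤ ∑' i, u i := fun j => hsum.le_tsum j fun i _ => hu0 i
  refine ⟨φ₁ ∘ φ₂, hφ₁.comp hφ₂, fun ω => ‖ξ₀ ω‖ + (∑' i, u i : Lp ℝ 2 P) ω,
    (Lp.memLp ξ₀).norm.add (Lp.memLp _), ?_, ?_⟩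
  · rw [ae_all_iff]
    intro j
    filter_upwards [hu j, (Lp.coeFn_le _ _).2 (hle j)] with ω h2 h3
    rw [h2] at h3
    calc ‖ξ (φ₁ (φ₂ j)) ω‖ = ‖ξ₀ ω + (ξ (φ₁ (φ₂ j)) ω - ξ₀ ω)‖ := by congr 1; abel
      _ ≤ ‖ξ₀ ω‖ + ‖ξ (φ₁ (φ₂ j)) ω - ξ₀ ω‖ := norm_add_le _ _
      _ ≤ _ := by linarith
  · filter_upwards [hae] with ω hω
    exact hω.comp hφ₂.tendsto_atTop

theorem exists_bound_of_tendsto {u : ℕ → ℝ} {a : ℝ} (h : Tendsto u atTop (𝓝 a)) :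
    ∃ C ≥ 0, ∀ j, u j ≤ C := by
  obtain ⟨C, hC⟩ := h.bddAbove_range
  exact ⟨max C 0, le_max_right _ _, fun j => (hC (mem_range_self j)).trans (le_max_left _ _)⟩

variable {Q : Type*} [TopologicalSpace Q] {ξ : Q → Lp (Euc n) 2 P}

theorem aestronglyMeasurable_comp_Lp {G : Type*} [NormedAddCommGroup G] (η : Lp (Euc n) 2 P)
    {ψ : Euc n → G} (hψ : Continuous ψ) : AEStronglyMeasurable (fun ω => ψ (η ω)) P :=
  hψ.comp_aestronglyMeasurable (Lp.aestronglyMeasurable η)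

theorem integrable_comp_Lp (η : Lp (Euc n) 2 P) {ψ : Euc n → ℝ} (hψ : Continuous ψ) {C : ℝ}
    (hC : ∀ x, ‖ψ x‖ ≤ C * (1 + ‖x‖ ^ 2)) : Integrable (fun ω => ψ (η ω)) P := by
  refine Integrable.mono' (((integrable_const (1 : ℝ)).add (P2.integrable_norm_sq_Lp η)).const_mul C)
    (aestronglyMeasurable_comp_Lp η hψ) (Eventually.of_forall fun ω => ?_)
  simpa using hC (η ω)

theorem memLp_comp_Lp (η : Lp (Euc n) 2 P) {ψ : Euc n → Euc n} (hψ : Continuous ψ) {C : ℝ}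
    (hC : ∀ x, ‖ψ x‖ ≤ C * (1 + ‖x‖)) : MemLp (fun ω => ψ (η ω)) 2 P := by
  refine MemLp.of_le (g := fun ω => C * (1 + ‖η ω‖))
    (((memLp_const (1 : ℝ)).add (Lp.memLp η).norm).const_mul C)
    (aestronglyMeasurable_comp_Lp η hψ) (Eventually.of_forall fun ω => ?_)
  exact (hC (η ω)).trans (le_abs_self _)

/-- Continuity of the expectation of a function of quadratic growth. -/
theorem continuous_integral_comp_Lp [SequentialSpace Q] (hξ : Continuous ξ) {Ψ : Q → Euc n → ℝ}
    (hΨ : Continuous fun p : Q × Euc n => Ψ p.1 p.2) {C : Q → ℝ} (hC : Continuous C)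
    (hb : ∀ q x, ‖Ψ q x‖ ≤ C q * (1 + ‖x‖ ^ 2)) :
    Continuous fun q => ∫ ω, Ψ q (ξ q ω) ∂P := by
  have hΨq : ∀ q, Continuous (Ψ q) := fun q => hΨ.comp (Continuous.prodMk_right q)
  rw [continuous_iff_seqContinuous]
  intro q q₀ hq
  -- A dominating function exists only along subsequences, which suffices because every subsequence
  -- has a further one with the right limit.
  refine Filter.tendsto_of_subseq_tendsto fun ns hns => ?_
  have hq' : Tendsto (fun j => q (ns j)) atTop (𝓝 q₀) := hq.comp hns
  obtain ⟨φ, hφ, b, hbL, hbb, hae⟩ := exists_subseq_dominated ((hξ.tendsto q₀).comp hq')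
  refine ⟨φ, ?_⟩
  have hq'' : Tendsto (fun j => q (ns (φ j))) atTop (𝓝 q₀) := hq'.comp hφ.tendsto_atTop
  obtain ⟨K, hK0, hK⟩ := exists_bound_of_tendsto ((hC.tendsto q₀).comp hq'')
  refine tendsto_integral_of_dominated_convergence (fun ω => K * (1 + b ω ^ 2)) ?_ ?_ ?_ ?_
  · exact fun j => aestronglyMeasurable_comp_Lp _ (hΨq _)
  · exact ((integrable_const _).add hbL.integrable_sq).const_mul K
  · intro j
    filter_upwards [hbb] with ω hω
    refine (hb _ _).trans (mul_le_mul (hK j) ?_ (by positivity) hK0)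
    have := hω j
    simp only [Function.comp] at this
    gcongr
  · filter_upwards [hae] with ω hω
    exact (hΨ.tendsto (q₀, ξ q₀ ω)).comp (hq''.prodMk_nhds hω)

/-- Continuity in `L²` of the composition with a function of linear growth. -/
theorem continuous_toLp_comp_Lp [SequentialSpace Q] (hξ : Continuous ξ) {Ψ : Q → Euc n → Euc n}
    (hΨ : Continuous fun p : Q × Euc n => Ψ p.1 p.2) {C : Q → ℝ} (hC : Continuous C)
    (hb : ∀ q x, ‖Ψ q x‖ ≤ C q * (1 + ‖x‖)) {η : Q → Lp (Euc n) 2 P}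
    (hη : ∀ q, η q =ᵐ[P] fun ω => Ψ q (ξ q ω)) : Continuous η := by
  have hΨq : ∀ q, Continuous (Ψ q) := fun q => hΨ.comp (Continuous.prodMk_right q)
  rw [continuous_iff_seqContinuous]
  intro q q₀ hq
  refine Filter.tendsto_of_subseq_tendsto fun ns hns => ?_
  have hq' : Tendsto (fun j => q (ns j)) atTop (𝓝 q₀) := hq.comp hns
  obtain ⟨φ, hφ, b, hbL, hbb, hae⟩ := exists_subseq_dominated ((hξ.tendsto q₀).comp hq')
  refine ⟨φ, ?_⟩
  have hq'' : Tendsto (fun j => q (ns (φ j))) atTop (𝓝 q₀) := hq'.comp hφ.tendsto_atTop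
  obtain ⟨K, hK0, hK⟩ := exists_bound_of_tendsto ((hC.tendsto q₀).comp hq'')
  have hsq : Tendsto (fun j => ∫ ω, ‖Ψ (q (ns (φ j))) (ξ (q (ns (φ j))) ω) - Ψ q₀ (ξ q₀ ω)‖ ^ 2 ∂P)
      atTop (𝓝 (∫ _, (0 : ℝ) ∂P)) := by
    refine tendsto_integral_of_dominated_convergence
      (fun ω => (K * (1 + b ω) + ‖Ψ q₀ (ξ q₀ ω)‖) ^ 2) ?_ ?_ ?_ ?_
    · exact fun j => (((aestronglyMeasurable_comp_Lp _ (hΨq _)).sub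
        (aestronglyMeasurable_comp_Lp _ (hΨq _))).norm.pow 2)
    · exact ((((memLp_const (1 : ℝ)).add hbL).const_mul K).add
        (memLp_comp_Lp (ξ q₀) (hΨq q₀) (hb q₀)).norm).integrable_sq
    · intro j
      filter_upwards [hbb] with ω hω
      rw [norm_pow, norm_norm]
      have h1 := hω j
      simp only [Function.comp] at h1
      refine pow_le_pow_left₀ (norm_nonneg _) ((norm_sub_le _ _).trans ?_) 2
      gcongr
      exact (hb _ _).trans (mul_le_mul (hK j) (by gcongr) (by positivity) hK0)
    · filter_upwards [hae] with ω hω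
      have h1 : Tendsto (fun j => Ψ (q (ns (φ j))) (ξ (q (ns (φ j))) ω)) atTop
          (𝓝 (Ψ q₀ (ξ q₀ ω))) := (hΨ.tendsto (q₀, ξ q₀ ω)).comp (hq''.prodMk_nhds hω)
      have h2 := ((h1.sub_const (Ψ q₀ (ξ q₀ ω))).norm).pow 2
      simpa using h2
  rw [tendsto_iff_norm_sub_tendsto_zero]
  have heq : ∀ j, ‖η (q (ns (φ j))) - η q₀‖ =
      √(∫ ω, ‖Ψ (q (ns (φ j))) (ξ (q (ns (φ j))) ω) - Ψ q₀ (ξ q₀ ω)‖ ^ 2 ∂P) := by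
    intro j
    rw [← Real.sqrt_sq (norm_nonneg (η (q (ns (φ j))) - η q₀)), ← P2.integral_norm_sub_sq]
    congr 1
    refine integral_congr_ae ?_
    filter_upwards [hη (q (ns (φ j))), hη q₀] with ω h1 h2
    rw [h1, h2]
  have h3 := (Real.continuous_sqrt.tendsto _).comp hsq
  simp only [integral_zero, Real.sqrt_zero] at h3
  exact h3.congr fun j => (heq j).symm

end Nemytskii

theorem sq_one_add_norm_le {E : Type*} [NormedAddCommGroup E] {x : E} {A R : ℝ} (hR0 : 0 ≤ R)
    (hR : R ≤ A * (1 + ‖x‖)) : R ^ 2 ≤ 2 * A ^ 2 * (1 + ‖x‖ ^ 2) := by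
  calc R ^ 2 ≤ (A * (1 + ‖x‖)) ^ 2 := pow_le_pow_left₀ hR0 hR 2
    _ ≤ 2 * A ^ 2 * (1 + ‖x‖ ^ 2) := by
      have : 0 ≤ A ^ 2 * (1 - ‖x‖) ^ 2 := by positivity
      linarith

/-! ### Continuity in the lifted variable. -/

section Continuity

variable {n : ℕ} {Ω : Type*} [MeasurableSpace Ω] {P : Measure Ω} [IsProbabilityMeasure P] {T : ℝ}

theorem continuous_integral_law {Q : Type*} [TopologicalSpace Q] [SequentialSpace Q]
    {ξ : Q → Lp (Euc n) 2 P} (hξ : Continuous ξ) {Ψ : Q → Euc n → ℝ}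
    (hΨ : Continuous fun p : Q × Euc n => Ψ p.1 p.2) {C : Q → ℝ} (hC : Continuous C)
    (hb : ∀ q x, ‖Ψ q x‖ ≤ C q * (1 + ‖x‖ ^ 2)) :
    Continuous fun q => ∫ x, Ψ q x ∂(P2.law P (ξ q) : Measure (Euc n)) :=
  (continuous_integral_comp_Lp hξ hΨ hC hb).congr fun q => (P2.integral_law (ξ q)
    (hΨ.comp (Continuous.prodMk_right q)).aestronglyMeasurable).symm

theorem RegularFamily.continuous_joint {Y : ℝ → ℝ → P2 n → Euc n → Euc n}
    (hY : RegularFamily P T Y) {t : ℝ} (ht : t ∈ Icc 0 T) :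
    Continuous fun p : (Icc t T × Lp (Euc n) 2 P) × Euc n =>
      Y t p.1.1 (P2.law P p.1.2) p.2 := by
  have hl := P2.continuous_law (P := P) (n := n)
  exact hY.continuousOn.comp_continuous (by fun_prop :
    Continuous fun p : (Icc t T × Lp (Euc n) 2 P) × Euc n =>
      (t, (p.1.1 : ℝ), P2.law P p.1.2, p.2)) (fun p => ⟨ht.1, p.1.1.2⟩)

end Continuity

/-! ### Growth bounds, integrability and continuity of the value. -/

namespace Setting

variable {n d : ℕ}
variable {Ω : Type*} [MeasurableSpace Ω] {P : Measure Ω} [IsProbabilityMeasure P]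
variable {T k₀ : ℝ} {f : Euc n → P2 n → Euc d → Euc n} {g : Euc n → P2 n → Euc d → ℝ}
  {k : Euc n → P2 n → ℝ} {α : Euc n → P2 n → Euc n → Euc d}
  {X Z : ℝ → ℝ → P2 n → Euc n → Euc n}
variable (S : Setting P T k₀ f g k α X Z)
include S

/-- In the cone `‖z‖` is itself controlled by `1 + ‖x‖ + μ.norm1`. -/
theorem exists_control_growth : ∃ L ≥ 0, ∀ x μ z, (x, μ, z) ∈ cone n k₀ →
    ‖α x μ z‖ ≤ L * (1 + ‖x‖ + μ.norm1) := by
  have hk₀ := S.hk₀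
  obtain ⟨L, hL⟩ := S.hα.growth
  refine ⟨|L| * (1 + k₀ / 2), by positivity, fun x μ z h => (hL x μ z h).trans ?_⟩
  have hz : ‖z‖ < k₀ / 2 * (1 + ‖x‖ + μ.norm1) := h
  have hμ := μ.norm1_nonneg
  calc L * (1 + ‖x‖ + μ.norm1 + ‖z‖) ≤ |L| * (1 + ‖x‖ + μ.norm1 + ‖z‖) :=
        mul_le_mul_of_nonneg_right (le_abs_self L) (by positivity)
    _ ≤ |L| * ((1 + k₀ / 2) * (1 + ‖x‖ + μ.norm1)) :=
        mul_le_mul_of_nonneg_left (by linarith) (abs_nonneg L)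
    _ = _ := by ring

theorem norm1_flow {t s : ℝ} (ht : t ∈ Icc 0 T) (hs : s ∈ Icc t T) (m : P2 n) :
    (flow X t s m).norm1 = ∫ x, ‖X t s m x‖ ∂(m : Measure (Euc n)) := by
  have h := S.hXZ.memLp t ht m s hs
  rw [flow, P2.push, dif_pos h]
  exact integral_map h.aestronglyMeasurable.aemeasurable (by fun_prop)

theorem flow_initial {t : ℝ} (ht : t ∈ Icc 0 T) (m : P2 n) : flow X t t m = m :=
  P2.push_id m fun x => S.hXZ.initial t ht m x

/-- The trajectories grow at most linearly, uniformly in time. -/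
theorem exists_growth : ∃ C ≥ 0, ∀ t ∈ Icc 0 T, ∀ m : P2 n, ∀ s ∈ Icc t T, ∀ x,
    ‖X t s m x‖ ≤ C * (1 + ‖x‖ + m.norm1) := by
  have hT := S.hT
  obtain ⟨L, hL0, hL⟩ := S.exists_control_growth
  obtain ⟨C₁, hC₁, hf⟩ := S.hf.growth_of_bounded S.hf'
  set c := C₁ * (1 + L) + 1 with hc
  have hc0 : 0 < c := by positivity
  refine ⟨2 * Real.exp (4 * c * T), by positivity, fun t ht m s hs x => ?_⟩
  have hTt : T ∈ Icc t T := right_mem_Icc.2 ht.2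
  have hm := m.norm1_nonneg
  have hvel : ∀ s ∈ Icc t T, ∀ x, ‖f (X t s m x) (flow X t s m) (ctrl α X Z t s m x)‖ ≤
      c * (1 + ‖X t s m x‖ + (flow X t s m).norm1) := by
    intro s hs x
    have h1 : ‖ctrl α X Z t s m x‖ ≤ _ := hL _ _ _ (S.hXZ.mem_cone t ht m s hs x)
    have h2 := (flow X t s m).norm1_nonneg
    refine (hf _ _ _).trans ?_
    have h3 : 0 ≤ 1 + ‖X t s m x‖ + (flow X t s m).norm1 := by positivity
    calc _ ≤ C₁ * ((1 + L) * (1 + ‖X t s m x‖ + (flow X t s m).norm1)) :=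
          mul_le_mul_of_nonneg_left (by linarith) hC₁
      _ ≤ _ := by rw [hc]; linarith
  -- The rate `4 * c` leaves room for a strict inequality of derivatives in the comparison below,
  -- where the velocity is bounded by `c` times state, moment and constant together.
  let E : ℝ → ℝ := fun s => Real.exp (4 * c * (s - t))
  have hE1 : ∀ s ∈ Icc t T, 1 ≤ E s := fun s hs =>
    Real.one_le_exp (mul_nonneg (by positivity) (sub_nonneg.2 hs.1))
  have hE0 : ∀ s, 0 < E s := fun s => Real.exp_pos _
  have hEd : ∀ s, HasDerivAt E (4 * c * E s) s := by
    intro s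
    have := (((hasDerivAt_id s).sub_const t).const_mul (4 * c)).exp
    simpa [E, mul_comm] using this
  -- A moment bound `M * E` gives a pointwise bound in which `M` enters only through `M / 2`.
  -- Integrating it improves the moment bound, so the best constant can be estimated by itself.
  have hpoint : ∀ M ≥ 0, (∀ s ∈ Icc t T, (flow X t s m).norm1 ≤ M * E s) →
      ∀ s ∈ Icc t T, ∀ x, ‖X t s m x‖ ≤ (‖x‖ + 1 + M / 2) * E s := by
    intro M hM hu s hs x
    refine image_norm_le_of_norm_deriv_right_lt_deriv_boundary (f := fun r => X t r m x)
      (f' := fun r => f (X t r m x) (flow X t r m) (ctrl α X Z t r m x)) (a := t) (b := T)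
      (fun r hr => (S.hXZ.forward t ht m r hr x).continuousWithinAt)
      (fun r hr => (S.hXZ.forward t ht m r (Ico_subset_Icc_self hr) x).mono_of_mem_nhdsWithin
        (Icc_mem_nhdsGE_of_mem hr))
      (B := fun r => (‖x‖ + 1 + M / 2) * E r)
      (B' := fun r => (‖x‖ + 1 + M / 2) * (4 * c * E r)) ?_
      (fun r => (hEd r).const_mul _) (fun r hr hB => ?_) hs
    · simp only [S.hXZ.initial t ht m x, E, sub_self, mul_zero, Real.exp_zero, mul_one]
      linarith
    · have hr' := Ico_subset_Icc_self hr
      refine (hvel r hr' x).trans_lt ?_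
      rw [hB]
      have h1 := hu r hr'
      have h2 := hE1 r hr'
      have h3 : 0 ≤ ‖x‖ * E r := mul_nonneg (norm_nonneg _) (hE0 r).le
      have h4 : 0 ≤ M * E r := mul_nonneg hM (hE0 r).le
      have : 1 + (‖x‖ + 1 + M / 2) * E r + (flow X t r m).norm1 <
          4 * ((‖x‖ + 1 + M / 2) * E r) := by nlinarith
      calc _ < c * (4 * ((‖x‖ + 1 + M / 2) * E r)) := mul_lt_mul_of_pos_left this hc0
        _ = _ := by ring
  have hint : ∀ M ≥ 0, (∀ s ∈ Icc t T, (flow X t s m).norm1 ≤ M * E s) →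
      ∀ s ∈ Icc t T, (flow X t s m).norm1 ≤ (m.norm1 + 1 + M / 2) * E s := by
    intro M hM hu s hs
    rw [S.norm1_flow ht hs]
    have hi : Integrable (fun x => (‖x‖ + 1 + M / 2) * E s) (m : Measure (Euc n)) :=
      ((m.integrable_norm.add (integrable_const _)).add (integrable_const _)).mul_const _
    refine (integral_mono ((S.hXZ.memLp t ht m s hs).integrable one_le_two).norm hi
      (fun x => hpoint M hM hu s hs x)).trans (le_of_eq ?_)
    simp only [add_assoc]
    rw [integral_mul_const, integral_add m.integrable_norm (integrable_const _)]
    simp [P2.norm1]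
  -- the best constant in the bound on the first moments
  let A : Set ℝ := (fun s => (flow X t s m).norm1 / E s) '' Icc t T
  have hAne : A.Nonempty := ⟨_, mem_image_of_mem _ hTt⟩
  -- The assumed bound on second moments serves only to make the best constant finite; its size does
  -- not enter the result.
  have hAb : BddAbove A := by
    obtain ⟨C, hC⟩ := S.hXZ.bounded t ht m
    refine ⟨1 + C, ?_⟩
    rintro _ ⟨s, hs, rfl⟩
    have h1 : (flow X t s m).norm1 ≤ 1 + C := by
      rw [S.norm1_flow ht hs]
      have hL := S.hXZ.memLp t ht m s hs
      have hi := hL.integrable_norm_pow two_ne_zero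
      calc _ ≤ ∫ x, (1 + ‖X t s m x‖ ^ 2) ∂(m : Measure (Euc n)) :=
            integral_mono (hL.integrable one_le_two).norm ((integrable_const _).add hi)
              (fun x => by nlinarith [sq_nonneg (‖X t s m x‖ - 1)])
        _ = 1 + ∫ x, ‖X t s m x‖ ^ 2 ∂(m : Measure (Euc n)) := by
            rw [integral_add (integrable_const _) hi]
            simp
        _ ≤ _ := by linarith [hC s hs]
    exact (div_le_self (flow X t s m).norm1_nonneg (hE1 s hs)).trans h1
  have hM : ∀ s ∈ Icc t T, (flow X t s m).norm1 ≤ sSup A * E s := fun s hs =>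
    (div_le_iff₀ (hE0 s)).1 (le_csSup hAb (mem_image_of_mem _ hs))
  have hM0 : 0 ≤ sSup A := le_csSup_of_le hAb (mem_image_of_mem _ hTt)
    (div_nonneg (P2.norm1_nonneg _) (hE0 T).le)
  -- Absorbing the last term gives `sSup A ≤ 2 * (m.norm1 + 1)`, which depends on neither `t` nor
  -- the a priori bound.
  have hM1 : sSup A ≤ m.norm1 + 1 + sSup A / 2 := by
    refine csSup_le hAne ?_
    rintro _ ⟨s, hs, rfl⟩
    exact (div_le_iff₀ (hE0 s)).2 (hint _ hM0 hM s hs)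
  refine (hpoint _ hM0 hM s hs x).trans ?_
  have hEs : E s ≤ Real.exp (4 * c * T) := by
    refine Real.exp_le_exp.2 (mul_le_mul_of_nonneg_left ?_ (by positivity))
    linarith [ht.1, hs.2]
  calc (‖x‖ + 1 + sSup A / 2) * E s ≤ (2 * (1 + ‖x‖ + m.norm1)) * Real.exp (4 * c * T) :=
        mul_le_mul (by linarith [norm_nonneg x]) hEs (hE0 s).le (by positivity)
    _ = _ := by ring

/-- The trajectories as random vectors. -/
theorem exists_flowLp {t : ℝ} (ht : t ∈ Icc 0 T) :
    ∃ η : Icc t T × Lp (Euc n) 2 P → Lp (Euc n) 2 P, Continuous η ∧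
      (∀ p, η p =ᵐ[P] fun ω => X t p.1 (P2.law P p.2) (p.2 ω)) ∧
      ∀ p, flow X t p.1 (P2.law P p.2) = P2.law P (η p) := by
  obtain ⟨C, hC, hgr⟩ := S.exists_growth
  refine ⟨fun p => P2.compLp p.2 (X t p.1 (P2.law P p.2)) (S.hXZ.memLp t ht _ p.1 p.1.2), ?_,
    fun p => P2.coeFn_compLp _ _ _, fun p => P2.push_law _ _ _⟩
  refine continuous_toLp_comp_Lp (Q := Icc t T × Lp (Euc n) 2 P) (ξ := fun p => p.2)
    continuous_snd (S.hX.continuous_joint ht) (C := fun p => C * (1 + (P2.law P p.2).norm1)) ?_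
    (fun p x => ?_) (fun p => P2.coeFn_compLp _ _ _)
  · have := (P2.continuous_norm1_law (P := P) (n := n)).comp
      (continuous_snd : Continuous fun p : Icc t T × Lp (Euc n) 2 P => p.2)
    exact continuous_const.mul (continuous_const.add this)
  · refine (hgr t ht _ p.1 p.1.2 x).trans ?_
    rw [mul_assoc]
    have := (P2.law P p.2).norm1_nonneg
    refine mul_le_mul_of_nonneg_left ?_ hC
    nlinarith [norm_nonneg x]

theorem continuous_flow {t : ℝ} (ht : t ∈ Icc 0 T) :
    Continuous fun p : Icc t T × Lp (Euc n) 2 P => flow X t p.1 (P2.law P p.2) := by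
  obtain ⟨η, hη, -, h⟩ := S.exists_flowLp ht
  simp only [h]
  exact P2.continuous_law.comp hη

theorem continuous_ctrl {t : ℝ} (ht : t ∈ Icc 0 T) :
    Continuous fun p : (Icc t T × Lp (Euc n) 2 P) × Euc n =>
      ctrl α X Z t p.1.1 (P2.law P p.1.2) p.2 :=
  S.hα.continuousOn.comp_continuous ((S.hX.continuous_joint ht).prodMk
    (((S.continuous_flow ht).comp continuous_fst).prodMk (S.hZ.continuous_joint ht)))
    (fun p => S.hXZ.mem_cone t ht _ p.1.1 p.1.1.2 p.2)

/-- A bound on the first moments and on the trajectories. -/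
theorem exists_state_bound {t : ℝ} (ht : t ∈ Icc 0 T) :
    ∃ A : Icc t T × Lp (Euc n) 2 P → ℝ, Continuous A ∧ ∀ p x,
      1 + ‖X t p.1 (P2.law P p.2) x‖ + (flow X t p.1 (P2.law P p.2)).norm1 ≤ A p * (1 + ‖x‖) ∧
      ∫ y, ‖y‖ ^ 2 ∂(flow X t p.1 (P2.law P p.2) : Measure (Euc n)) ≤ A p := by
  obtain ⟨C, hC, hgr⟩ := S.exists_growth
  obtain ⟨η, hη, -, h⟩ := S.exists_flowLp ht
  have hc := (P2.continuous_norm1_law (P := P) (n := n)).comp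
      (continuous_snd : Continuous fun p : Icc t T × Lp (Euc n) 2 P => p.2)
  have hc' := (P2.continuous_norm1_law (P := P) (n := n)).comp hη
  refine ⟨fun p => 1 + C * (1 + (P2.law P p.2).norm1) + (P2.law P (η p)).norm1 + ‖η p‖ ^ 2,
    ((continuous_const.add (continuous_const.mul (continuous_const.add hc))).add hc').add
      (hη.norm.pow 2), fun p x => ⟨?_, ?_⟩⟩
  · have h1 := hgr t ht (P2.law P p.2) p.1 p.1.2 x
    rw [h]
    have h2 := (P2.law P p.2).norm1_nonneg
    have h3 := (P2.law P (η p)).norm1_nonneg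
    have h4 := norm_nonneg x
    have h5 : 0 ≤ C * (P2.law P p.2).norm1 * ‖x‖ := by positivity
    have h6 : 0 ≤ (P2.law P (η p)).norm1 * ‖x‖ := by positivity
    have h7 : 0 ≤ ‖η p‖ ^ 2 * (1 + ‖x‖) := by positivity
    nlinarith
  · rw [h, P2.integral_law _ (by fun_prop), ← P2.norm_sq_Lp]
    have h2 := (P2.law P p.2).norm1_nonneg
    have h3 := (P2.law P (η p)).norm1_nonneg
    have h4 : 0 ≤ C * (1 + (P2.law P p.2).norm1) := by positivity
    linarith

/-- The coefficient `B` is continuous in the time and the lifted law, hence bounded along convergent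
sequences, as dominated convergence requires. -/
theorem exists_running_bound {t : ℝ} (ht : t ∈ Icc 0 T) :
    ∃ B : Icc t T × Lp (Euc n) 2 P → ℝ, Continuous B ∧ ∀ p x,
      ‖g (X t p.1 (P2.law P p.2) x) (flow X t p.1 (P2.law P p.2))
        (ctrl α X Z t p.1 (P2.law P p.2) x)‖ ≤ B p * (1 + ‖x‖ ^ 2) := by
  obtain ⟨A, hA, hAb⟩ := S.exists_state_bound ht
  obtain ⟨C, hC, hg⟩ := S.hg.growth_of_linear S.hg'
  obtain ⟨L, hL0, hL⟩ := S.exists_control_growth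
  refine ⟨fun p => C * (2 * ((1 + L) * A p) ^ 2 + A p), by fun_prop, fun p x => ?_⟩
  obtain ⟨h1, h2⟩ := hAb p x
  have h3 : ‖ctrl α X Z t p.1 (P2.law P p.2) x‖ ≤ _ :=
    hL _ _ _ (S.hXZ.mem_cone t ht (P2.law P p.2) p.1 p.1.2 x)
  refine (hg _ _ _).trans ?_
  rw [mul_assoc]
  have h4 := (flow X t p.1 (P2.law P p.2)).norm1_nonneg
  have hI : 0 ≤ ∫ y, ‖y‖ ^ 2 ∂(flow X t p.1 (P2.law P p.2) : Measure (Euc n)) := by positivity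
  refine mul_le_mul_of_nonneg_left ?_ hC
  have h5 := sq_one_add_norm_le (x := x) (A := (1 + L) * A p)
    (R := 1 + ‖X t p.1 (P2.law P p.2) x‖ + (flow X t p.1 (P2.law P p.2)).norm1 +
      ‖ctrl α X Z t p.1 (P2.law P p.2) x‖) (by positivity) (by
      rw [mul_assoc]
      nlinarith [mul_le_mul_of_nonneg_left h1 (by positivity : 0 ≤ 1 + L)])
  nlinarith [mul_nonneg (hI.trans h2) (sq_nonneg ‖x‖)]

theorem exists_terminal_bound {t : ℝ} (ht : t ∈ Icc 0 T) :
    ∃ B : Icc t T × Lp (Euc n) 2 P → ℝ, Continuous B ∧ ∀ p x,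
      ‖k (X t p.1 (P2.law P p.2) x) (flow X t p.1 (P2.law P p.2))‖ ≤ B p * (1 + ‖x‖ ^ 2) := by
  obtain ⟨A, hA, hAb⟩ := S.exists_state_bound ht
  obtain ⟨C, hC, hg⟩ := S.hk.growth S.hk'
  refine ⟨fun p => C * (2 * (A p) ^ 2 + A p), by fun_prop, fun p x => ?_⟩
  obtain ⟨h1, h2⟩ := hAb p x
  refine (hg _ _).trans ?_
  rw [mul_assoc]
  have h4 := (flow X t p.1 (P2.law P p.2)).norm1_nonneg
  have hI : 0 ≤ ∫ y, ‖y‖ ^ 2 ∂(flow X t p.1 (P2.law P p.2) : Measure (Euc n)) := by positivity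
  refine mul_le_mul_of_nonneg_left ?_ hC
  have h5 := sq_one_add_norm_le (x := x) (by positivity) h1
  nlinarith [mul_nonneg (hI.trans h2) (sq_nonneg ‖x‖)]

theorem continuous_running_integrand {t : ℝ} (ht : t ∈ Icc 0 T) :
    Continuous fun p : (Icc t T × Lp (Euc n) 2 P) × Euc n =>
      g (X t p.1.1 (P2.law P p.1.2) p.2) (flow X t p.1.1 (P2.law P p.1.2))
        (ctrl α X Z t p.1.1 (P2.law P p.1.2) p.2) :=
  S.hg.continuous.comp ((S.hX.continuous_joint ht).prodMk
    (((S.continuous_flow ht).comp continuous_fst).prodMk (S.continuous_ctrl ht)))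

theorem continuous_terminal_integrand {t : ℝ} (ht : t ∈ Icc 0 T) :
    Continuous fun p : (Icc t T × Lp (Euc n) 2 P) × Euc n =>
      k (X t p.1.1 (P2.law P p.1.2) p.2) (flow X t p.1.1 (P2.law P p.1.2)) :=
  S.hk.continuous.comp ((S.hX.continuous_joint ht).prodMk
    ((S.continuous_flow ht).comp continuous_fst))

theorem continuous_running {t : ℝ} (ht : t ∈ Icc 0 T) :
    Continuous fun p : Icc t T × Lp (Euc n) 2 P =>
      ∫ x, g (X t p.1 (P2.law P p.2) x) (flow X t p.1 (P2.law P p.2))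
        (ctrl α X Z t p.1 (P2.law P p.2) x) ∂(P2.law P p.2 : Measure (Euc n)) := by
  obtain ⟨B, hB, hb⟩ := S.exists_running_bound ht
  have hc := S.continuous_running_integrand ht
  exact continuous_integral_law (ξ := fun p : Icc t T × Lp (Euc n) 2 P => p.2)
    continuous_snd (Ψ := fun p x => g (X t p.1 (P2.law P p.2) x) (flow X t p.1 (P2.law P p.2))
        (ctrl α X Z t p.1 (P2.law P p.2) x)) hc hB hb

theorem continuous_terminal {t : ℝ} (ht : t ∈ Icc 0 T) :
    Continuous fun p : Icc t T × Lp (Euc n) 2 P =>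
      ∫ x, k (X t p.1 (P2.law P p.2) x) (flow X t p.1 (P2.law P p.2))
        ∂(P2.law P p.2 : Measure (Euc n)) := by
  obtain ⟨B, hB, hb⟩ := S.exists_terminal_bound ht
  have hc := S.continuous_terminal_integrand ht
  exact continuous_integral_law (ξ := fun p : Icc t T × Lp (Euc n) 2 P => p.2)
    continuous_snd (Ψ := fun p x => k (X t p.1 (P2.law P p.2) x) (flow X t p.1 (P2.law P p.2)))
    hc hB hb

theorem valueWellDefined (hΩ : RichSpace n P) : ValueWellDefined T g k α X Z := by
  intro t ht m
  obtain ⟨ξ, rfl⟩ := hΩ m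
  have hg := S.continuous_running_integrand ht
  have hk := S.continuous_terminal_integrand ht
  obtain ⟨B, -, hb⟩ := S.exists_running_bound ht
  obtain ⟨B', -, hb'⟩ := S.exists_terminal_bound ht
  refine ⟨?_, fun s hs => ?_, ?_⟩
  · have h1 := hk.comp (Continuous.prodMk_right
      ((⟨T, right_mem_Icc.2 ht.2⟩, ξ) : Icc t T × Lp (Euc n) 2 P))
    exact (P2.integrable_law_iff ξ h1.aestronglyMeasurable).2
      (integrable_comp_Lp ξ h1 (hb' (⟨T, right_mem_Icc.2 ht.2⟩, ξ)))
  · have h1 := hg.comp (Continuous.prodMk_right ((⟨s, hs⟩, ξ) : Icc t T × Lp (Euc n) 2 P))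
    exact (P2.integrable_law_iff ξ h1.aestronglyMeasurable).2
      (integrable_comp_Lp ξ h1 (hb (⟨s, hs⟩, ξ)))
  · refine ContinuousOn.intervalIntegrable_of_Icc ht.2 ?_
    rw [continuousOn_iff_continuous_domRestrict]
    exact (S.continuous_running ht).comp (Continuous.prodMk_left ξ)

/-- The value function is continuous in the lifted variable. -/
theorem continuous_value {t : ℝ} (ht : t ∈ Icc 0 T) :
    Continuous fun ξ : Lp (Euc n) 2 P => valueAlong T g k α X Z t (P2.law P ξ) := by
  have h1 := (S.continuous_terminal ht).comp (Continuous.prodMk_right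
    (⟨T, right_mem_Icc.2 ht.2⟩ : Icc t T))
  -- Projecting the time onto `[t, T]` extends the integrand continuously to all real times without
  -- changing the integral.
  let γ : Lp (Euc n) 2 P → ℝ → ℝ := fun ξ s =>
    ∫ x, g (X t (projIcc t T ht.2 s) (P2.law P ξ) x) (flow X t (projIcc t T ht.2 s) (P2.law P ξ))
      (ctrl α X Z t (projIcc t T ht.2 s) (P2.law P ξ) x) ∂(P2.law P ξ : Measure (Euc n))
  have hp : Continuous fun q : Lp (Euc n) 2 P × ℝ => (projIcc t T ht.2 q.2, q.1) :=
    (continuous_projIcc.comp continuous_snd).prodMk continuous_fst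
  have hγ : Continuous γ.uncurry := (S.continuous_running ht).comp hp
  have h2 : Continuous fun ξ => ∫ s in t..T, γ ξ s :=
    intervalIntegral.continuous_parametric_intervalIntegral_of_continuous hγ continuous_const
  refine (h1.add h2).congr fun ξ => ?_
  simp only [valueAlong, Pi.add_apply]
  congr 1
  apply intervalIntegral.integral_congr
  intro s hs
  rw [uIcc_of_le ht.2] at hs
  simp only [γ, projIcc_of_mem ht.2 hs]

end Setting

/-! ### Extension of derivatives from a dense set. -/

section Density

variable {E : Type*} [NormedAddCommGroup E] [NormedSpace ℝ E] {D : Set E}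

/-- A continuous function which is differentiable along the segments between points of a dense
set, with a continuous derivative, is differentiable. -/
theorem hasFDerivAt_of_dense (hD : Dense D) {v : E → ℝ} (hv : Continuous v)
    {G : E → E →L[ℝ] ℝ} (hG : Continuous G)
    (h : ∀ a ∈ D, ∀ b ∈ D, ∀ θ : ℝ,
      HasDerivAt (fun θ : ℝ => v (a + θ • (b - a))) (G (a + θ • (b - a)) (b - a)) θ) (ξ : E) :
    HasFDerivAt v (G ξ) ξ := by
  refine HasFDerivAt.of_isLittleO (Asymptotics.isLittleO_iff.2 fun ε hε => ?_)
  obtain ⟨δ, hδ, hδG⟩ := Metric.continuousAt_iff.1 hG.continuousAt ε hε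
  -- The mean value inequality on segments between dense points is a closed condition in the pair of
  -- end points, so it passes to the whole ball, including the pair with first point `ξ`.
  have hball : ∀ a ∈ D, ∀ b ∈ D, a ∈ Metric.ball ξ δ → b ∈ Metric.ball ξ δ →
      ‖v b - v a - G ξ (b - a)‖ ≤ ε * ‖b - a‖ := by
    intro a ha b hb haδ hbδ
    have hd : ∀ θ ∈ Icc (0 : ℝ) 1, HasDerivWithinAt
        (fun θ : ℝ => v (a + θ • (b - a)) - θ * G ξ (b - a))
        (G (a + θ • (b - a)) (b - a) - G ξ (b - a)) (Icc 0 1) θ := by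
      intro θ _
      have := (h a ha b hb θ).fun_sub ((hasDerivAt_id' θ).mul_const (G ξ (b - a)))
      rw [one_mul] at this
      exact this.hasDerivWithinAt
    have := norm_image_sub_le_of_norm_deriv_le_segment_01' hd (C := ε * ‖b - a‖) (fun θ hθ => ?_)
    · simpa [sub_right_comm] using this
    · have hmem : a + θ • (b - a) ∈ Metric.ball ξ δ :=
        (convex_ball ξ δ).add_smul_sub_mem haδ hbδ (Ico_subset_Icc_self hθ)
      have h1 := hδG hmem
      rw [dist_eq_norm] at h1
      exact ((G (a + θ • (b - a)) - G ξ).le_opNorm (b - a)).trans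
        (mul_le_mul_of_nonneg_right h1.le (norm_nonneg _))
  have hcl : IsClosed {p : E × E | ‖v p.2 - v p.1 - G ξ (p.2 - p.1)‖ ≤ ε * ‖p.2 - p.1‖} :=
    isClosed_le (by fun_prop) (by fun_prop)
  have hsub : Metric.ball ξ δ ×ˢ Metric.ball ξ δ ⊆
      {p : E × E | ‖v p.2 - v p.1 - G ξ (p.2 - p.1)‖ ≤ ε * ‖p.2 - p.1‖} :=
    ((hD.prod hD).open_subset_closure_inter
      (Metric.isOpen_ball.prod Metric.isOpen_ball)).trans
      (closure_minimal (fun p hp => hball _ hp.2.1 _ hp.2.2 hp.1.1 hp.1.2) hcl)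
  filter_upwards [Metric.ball_mem_nhds ξ hδ] with η hη
  exact hsub (show (ξ, η) ∈ _ from ⟨Metric.mem_ball_self hδ, hη⟩)

/-- A time derivative known on a dense set of parameters extends by continuity. -/
theorem hasDerivWithinAt_of_dense (hD : Dense D) {T : ℝ} {v : ℝ → E → ℝ}
    (hv : ∀ t ∈ Icc 0 T, Continuous (v t)) {h : ℝ → E → ℝ}
    (hh : ContinuousOn (fun p : ℝ × E => h p.1 p.2) (Icc 0 T ×ˢ univ))
    (hc : ∀ a ∈ D, ContinuousOn (fun r => v r a) (Icc 0 T))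
    (hd : ∀ a ∈ D, ∀ t ∈ Ico 0 T, HasDerivWithinAt (fun r => v r a) (h t a) (Ici t) t)
    {t : ℝ} (ht : t ∈ Icc 0 T) (ξ : E) :
    HasDerivWithinAt (fun r => v r ξ) (h t ξ) (Icc 0 T) t := by
  refine hasDerivWithinAt_iff_isLittleO.2 (Asymptotics.isLittleO_iff.2 fun ε hε => ?_)
  obtain ⟨δ, hδ, hδh⟩ := Metric.continuousWithinAt_iff.1 (hh (t, ξ) ⟨ht, mem_univ _⟩) ε hε
  have hmono : ∀ r₁ ∈ Icc 0 T, ∀ r₂ ∈ Icc 0 T, |r₁ - t| < δ → |r₂ - t| < δ → r₁ ≤ r₂ →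
      ‖v r₂ ξ - v r₁ ξ - (r₂ - r₁) * h t ξ‖ ≤ ε * (r₂ - r₁) := by
    intro r₁ h₁ r₂ h₂ hr₁ hr₂ h12
    have hI : Icc r₁ r₂ ⊆ Icc 0 T := Icc_subset_Icc h₁.1 h₂.2
    have hball : ∀ a ∈ D, a ∈ Metric.ball ξ δ →
        ‖v r₂ a - v r₁ a - (r₂ - r₁) * h t ξ‖ ≤ ε * (r₂ - r₁) := by
      intro a ha haδ
      -- Right derivatives and continuity suffice for an estimate on `[r₁, r₂]`. As `r₁` and `r₂`
      -- are arbitrary times near `t`, the limit derivative is two-sided.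
      have := norm_image_sub_le_of_norm_deriv_right_le_segment
        (f := fun r => v r a - r * h t ξ) (f' := fun r => h r a - h t ξ) (a := r₁) (b := r₂)
        (C := ε) (((hc a ha).mono hI).sub (by fun_prop)) (fun r hr => ?_) (fun r hr => ?_)
        r₂ (right_mem_Icc.2 h12)
      · rwa [show v r₂ a - v r₁ a - (r₂ - r₁) * h t ξ =
          v r₂ a - r₂ * h t ξ - (v r₁ a - r₁ * h t ξ) by ring]
      · have h1 := (hd a ha r ⟨h₁.1.trans hr.1, hr.2.trans_le h₂.2⟩).fun_sub
          ((hasDerivAt_id' r).mul_const (h t ξ)).hasDerivWithinAt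
        rwa [one_mul] at h1
      · have h1 : dist (r, a) (t, ξ) < δ := by
          rw [Prod.dist_eq, max_lt_iff, Real.dist_eq]
          refine ⟨?_, haδ⟩
          rw [abs_lt] at *
          constructor <;> linarith [hr.1, hr.2]
        have h2 := hδh (x := (r, a)) ⟨hI (Ico_subset_Icc_self hr), mem_univ _⟩ h1
        rw [dist_eq_norm] at h2
        exact h2.le
    have hcl : IsClosed {a : E | ‖v r₂ a - v r₁ a - (r₂ - r₁) * h t ξ‖ ≤ ε * (r₂ - r₁)} := by
      have c1 := hv r₁ h₁
      have c2 := hv r₂ h₂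
      exact isClosed_le (by fun_prop) (by fun_prop)
    exact ((hD.open_subset_closure_inter Metric.isOpen_ball).trans
      (closure_minimal (fun a ha => hball a ha.2 ha.1) hcl)) (Metric.mem_ball_self hδ)
  have hb : ∀ᶠ r in 𝓝[Icc 0 T] t, r ∈ Metric.ball t δ :=
    mem_nhdsWithin_of_mem_nhds (Metric.ball_mem_nhds t hδ)
  filter_upwards [hb, self_mem_nhdsWithin] with r hr hrI
  rw [Metric.mem_ball, Real.dist_eq] at hr
  have h0 : |t - t| < δ := by simpa using hδ
  rw [smul_eq_mul]
  rcases le_total t r with hle | hle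
  · rw [Real.norm_of_nonneg (sub_nonneg.2 hle)]
    exact hmono t ht r hrI h0 hr hle
  · rw [Real.norm_of_nonpos (sub_nonpos.2 hle), ← norm_neg, neg_sub r t,
      show -(v r ξ - v t ξ - (r - t) * h t ξ) = v t ξ - v r ξ - (t - r) * h t ξ by ring]
    exact hmono r hrI t ht hr h0 hle

end Density

/-! ### Simple random vectors. -/

namespace P2

variable {n : ℕ} {Ω : Type*} [MeasurableSpace Ω] {P : Measure Ω} [IsProbabilityMeasure P]

variable (n P) in
/-- The random vectors with finitely many values. -/
def simples : Set (Lp (Euc n) 2 P) := {ξ | ∃ s : SimpleFunc Ω (Euc n), ξ =ᵐ[P] s}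

theorem dense_simples : Dense (simples n P) := by
  have h := Lp.simpleFunc.denseRange (E := Euc n) (p := 2) (μ := P) (by simp)
  refine h.mono ?_
  rintro _ ⟨s, rfl⟩
  exact ⟨Lp.simpleFunc.toSimpleFunc s, (Lp.simpleFunc.toSimpleFunc_eq_toFun s).symm⟩

/-- Two random vectors with finitely many values live on a common finite partition. -/
theorem exists_atoms_of_simples {ξ η : Lp (Euc n) 2 P} (hξ : ξ ∈ simples n P)
    (hη : η ∈ simples n P) :
    ∃ (R : Finset (Euc n × Euc n)) (σ : SimpleFunc Ω R) (x y : R → Euc n),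
      ξ = atomLp P σ x ∧ η = atomLp P σ y := by
  obtain ⟨s, hs⟩ := hξ
  obtain ⟨s', hs'⟩ := hη
  -- The cells are labelled by the pair of values, so each vector is a coordinate of the label.
  let σ : SimpleFunc Ω (s.pair s').range :=
    { toFun := fun ω => ⟨s.pair s' ω, SimpleFunc.mem_range_self _ _⟩
      measurableSet_fiber' := fun y => by
        convert (s.pair s').measurableSet_fiber y.1 using 1
        ext ω
        simp [Subtype.ext_iff]
      finite_range' := toFinite _ }
  refine ⟨_, σ, fun i => i.1.1, fun i => i.1.2, Lp.ext ?_, Lp.ext ?_⟩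
  · filter_upwards [hs, coeFn_atomLp (P := P) σ fun i => i.1.1] with ω h1 h2
    rw [h1, h2]
    rfl
  · filter_upwards [hs', coeFn_atomLp (P := P) σ fun i => i.1.2] with ω h1 h2
    rw [h1, h2]
    rfl

end P2

theorem hamiltonian_eq_feedbackHamiltonian {n d : ℕ} {k₀ : ℝ} {f : Euc n → P2 n → Euc d → Euc n}
    {g : Euc n → P2 n → Euc d → ℝ} {α : Euc n → P2 n → Euc n → Euc d}
    (h : IsMinimiser k₀ f g α) {x : Euc n} {μ : P2 n} {z : Euc n} (hc : (x, μ, z) ∈ cone n k₀) :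
    hamiltonian f g x μ z = feedbackHamiltonian f g α x μ z :=
  le_antisymm (ciInf_le ⟨_, forall_mem_range.2 (h x μ z hc)⟩ (α x μ z)) (le_ciInf (h x μ z hc))

/-! ### The gradient, the time derivative and the Bellman equation. -/

namespace Setting

variable {n d : ℕ}
variable {Ω : Type*} [MeasurableSpace Ω] {P : Measure Ω} [IsProbabilityMeasure P]
variable {T k₀ : ℝ} {f : Euc n → P2 n → Euc d → Euc n} {g : Euc n → P2 n → Euc d → ℝ}
  {k : Euc n → P2 n → ℝ} {α : Euc n → P2 n → Euc n → Euc d}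
  {X Z : ℝ → ℝ → P2 n → Euc n → Euc n}
variable (S : Setting P T k₀ f g k α X Z)
include S

theorem mem_cone_initial {t : ℝ} (ht : t ∈ Icc 0 T) (m : P2 n) (x : Euc n) :
    (x, m, Z t t m x) ∈ cone n k₀ := by
  have := S.hXZ.mem_cone t ht m t (left_mem_Icc.2 ht.2) x
  rwa [S.hXZ.initial t ht, S.flow_initial ht] at this

/-- The cone condition at the initial time is the only growth bound on `Z` that is needed; it puts
the candidate gradient in `L²`. -/
theorem norm_costate_le {t : ℝ} (ht : t ∈ Icc 0 T) (m : P2 n) (x : Euc n) :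
    ‖Z t t m x‖ ≤ k₀ / 2 * (1 + m.norm1) * (1 + ‖x‖) := by
  have h : ‖Z t t m x‖ < k₀ / 2 * (1 + ‖x‖ + m.norm1) := S.mem_cone_initial ht m x
  have hk := S.hk₀
  have hm := m.norm1_nonneg
  refine h.le.trans ?_
  rw [mul_assoc]
  refine mul_le_mul_of_nonneg_left ?_ (by positivity)
  nlinarith [mul_nonneg hm (norm_nonneg x)]

theorem continuous_costate_joint :
    Continuous fun p : (Icc 0 T × Lp (Euc n) 2 P) × Euc n => Z p.1.1 p.1.1 (P2.law P p.1.2) p.2 := by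
  have hl := P2.continuous_law (P := P) (n := n)
  exact S.hZ.continuousOn.comp_continuous (by fun_prop :
    Continuous fun p : (Icc 0 T × Lp (Euc n) 2 P) × Euc n =>
      ((p.1.1 : ℝ), (p.1.1 : ℝ), P2.law P p.1.2, p.2)) (fun p => ⟨p.1.1.2.1, le_rfl, p.1.1.2.2⟩)

theorem continuous_costate {t : ℝ} (ht : t ∈ Icc 0 T) :
    Continuous fun p : Lp (Euc n) 2 P × Euc n => Z t t (P2.law P p.1) p.2 :=
  S.continuous_costate_joint.comp (by fun_prop :
    Continuous fun p : Lp (Euc n) 2 P × Euc n => (((⟨t, ht⟩ : Icc 0 T), p.1), p.2))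

theorem memLp_costate {t : ℝ} (ht : t ∈ Icc 0 T) (ξ : Lp (Euc n) 2 P) :
    MemLp (Z t t (P2.law P ξ)) 2 (P2.law P ξ : Measure (Euc n)) := by
  refine MemLp.of_le (g := fun x => k₀ / 2 * (1 + (P2.law P ξ).norm1) * (1 + ‖x‖))
    (((memLp_const (1 : ℝ)).add (P2.law P ξ).memLp.norm).const_mul _)
    ((S.continuous_costate ht).comp (Continuous.prodMk_right ξ)).aestronglyMeasurable
    (Eventually.of_forall fun x => ?_)
  exact (S.norm_costate_le ht _ x).trans (le_abs_self _)

/-- The initial costate as a continuous map of the initial random vector. -/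
theorem exists_costateLp {t : ℝ} (ht : t ∈ Icc 0 T) :
    ∃ ζ : Lp (Euc n) 2 P → Lp (Euc n) 2 P, Continuous ζ ∧
      ∀ ξ, ζ ξ =ᵐ[P] fun ω => Z t t (P2.law P ξ) (ξ ω) := by
  refine ⟨fun ξ => P2.compLp ξ _ (S.memLp_costate ht ξ), ?_, fun ξ => P2.coeFn_compLp _ _ _⟩
  refine continuous_toLp_comp_Lp (ξ := fun ξ : Lp (Euc n) 2 P => ξ) continuous_id
    (S.continuous_costate ht) (C := fun ξ => k₀ / 2 * (1 + (P2.law P ξ).norm1)) ?_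
    (fun ξ x => S.norm_costate_le ht _ x) (fun p => P2.coeFn_compLp _ _ _)
  exact continuous_const.mul (continuous_const.add P2.continuous_norm1_law)

/-- The gradient of the value function with respect to the law. -/
theorem hasLGradient_value {t : ℝ} (ht : t ∈ Icc 0 T) (hΩ : RichSpace n P) :
    HasLGradient P (valueAlong T g k α X Z t) (fun m x => Z t t m x) := by
  intro m
  obtain ⟨ζ, hζ, hae⟩ := S.exists_costateLp ht
  refine ⟨?_, fun ξ hξ => ?_⟩
  · obtain ⟨ξ, rfl⟩ := hΩ m
    exact (innerSL ℝ : Euc n →L[ℝ] Euc n →L[ℝ] ℝ).comp_memLp' (S.memLp_costate ht ξ)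
  · subst hξ
    refine ⟨innerSL ℝ (ζ ξ), fun Y => ?_, ?_⟩
    · rw [innerSL_apply_apply, L2.inner_def]
      refine integral_congr_ae ?_
      filter_upwards [hae ξ] with ω h
      rw [h]
      rfl
    · refine hasFDerivAt_of_dense (G := fun ξ => innerSL ℝ (ζ ξ)) P2.dense_simples
        (S.continuous_value ht) ((innerSL ℝ).continuous.comp hζ) (fun a ha b hb θ => ?_) ξ
      obtain ⟨R, σ, x, y, rfl, rfl⟩ := P2.exists_atoms_of_simples ha hb
      have hline : HasDerivAt (fun θ : ℝ => x + θ • (y - x)) (y - x) θ := by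
        simpa using ((hasDerivAt_id θ).smul_const (y - x)).const_add x
      have hd := (S.hasFDerivAt_value_atoms σ ht (x + θ • (y - x))).comp_hasDerivAt θ hline
      -- The segment between two vectors on a common partition stays on that partition, so the
      -- finite-dimensional derivative applies along it.
      have hlin : ∀ θ : ℝ, P2.atomLp P σ x + θ • P2.atomLp P σ (y - x) =
          P2.atomLp P σ (x + θ • (y - x)) := by
        intro θ
        rw [map_add, map_smul]
      simp only [← map_sub, hlin]
      refine hd.congr_deriv ?_
      rw [pairing_apply, innerSL_apply_apply, L2.inner_def]
      have := P2.integral_atoms (P := P) σ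
        (fun i => ⟪along P σ Z t (x + θ • (y - x)) t i, (y - x) i⟫)
      simp only [smul_eq_mul] at this
      rw [← this]
      refine integral_congr_ae ?_
      filter_upwards [hae (P2.atomLp P σ (x + θ • (y - x))),
        P2.coeFn_atomLp (P := P) σ (x + θ • (y - x)), P2.coeFn_atomLp (P := P) σ (y - x)]
        with ω h1 h2 h3
      rw [h1, h2, h3]
      rfl

theorem continuous_hamiltonian_integrand :
    Continuous fun p : (Icc 0 T × Lp (Euc n) 2 P) × Euc n =>
      feedbackHamiltonian f g α p.2 (P2.law P p.1.2) (Z p.1.1 p.1.1 (P2.law P p.1.2) p.2) := by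
  have hl : Continuous fun p : (Icc 0 T × Lp (Euc n) 2 P) × Euc n => P2.law P p.1.2 :=
    P2.continuous_law.comp (continuous_snd.comp continuous_fst)
  have hz := S.continuous_costate_joint
  have ha : Continuous fun p : (Icc 0 T × Lp (Euc n) 2 P) × Euc n =>
      α p.2 (P2.law P p.1.2) (Z p.1.1 p.1.1 (P2.law P p.1.2) p.2) :=
    S.hα.continuousOn.comp_continuous (continuous_snd.prodMk (hl.prodMk hz))
      (fun p => S.mem_cone_initial p.1.1.2 _ _)
  have harg := continuous_snd.prodMk (hl.prodMk ha)
  exact ((S.hf.continuous.comp harg).inner hz).add (S.hg.continuous.comp harg)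

/-- In the cone `f` and `z` both grow linearly, so their product and `g` are quadratic. The bound is
independent of `t`, which yields continuity jointly in time and law. -/
theorem exists_hamiltonian_bound :
    ∃ B : Lp (Euc n) 2 P → ℝ, Continuous B ∧ ∀ t ∈ Icc 0 T, ∀ ξ x,
      ‖feedbackHamiltonian f g α x (P2.law P ξ) (Z t t (P2.law P ξ) x)‖ ≤
        B ξ * (1 + ‖x‖ ^ 2) := by
  obtain ⟨L, hL0, hL⟩ := S.exists_control_growth
  obtain ⟨C₁, hC₁, hf⟩ := S.hf.growth_of_bounded S.hf'
  obtain ⟨C₂, hC₂, hg⟩ := S.hg.growth_of_linear S.hg'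
  have hk := S.hk₀
  have hc := P2.continuous_norm1_law (P := P) (n := n)
  refine ⟨fun ξ => (C₁ * (1 + L) * (k₀ / 2) + C₂ * (1 + L) ^ 2) *
    (2 * (1 + (P2.law P ξ).norm1) ^ 2) + C₂ * ‖ξ‖ ^ 2, by fun_prop, fun t ht ξ x => ?_⟩
  set m := P2.law P ξ with hm
  set z := Z t t m x
  have hcone := S.mem_cone_initial ht m x
  have hz : ‖z‖ ≤ k₀ / 2 * (1 + ‖x‖ + m.norm1) := le_of_lt hcone
  have ha := hL _ _ _ hcone
  have hm0 := m.norm1_nonneg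
  have hI : ∫ y, ‖y‖ ^ 2 ∂(m : Measure (Euc n)) = ‖ξ‖ ^ 2 := by
    rw [hm, P2.integral_law _ (by fun_prop), ← P2.norm_sq_Lp]
  set A := 1 + ‖x‖ + m.norm1
  have hA0 : 0 ≤ A := by positivity
  have hA : A ^ 2 ≤ 2 * (1 + m.norm1) ^ 2 * (1 + ‖x‖ ^ 2) :=
    sq_one_add_norm_le hA0 (by nlinarith [mul_nonneg hm0 (norm_nonneg x)])
  have hsum : A + ‖α x m z‖ ≤ (1 + L) * A := by linarith
  have h1 : ‖⟪f x m (α x m z), z⟫‖ ≤ C₁ * ((1 + L) * A) * (k₀ / 2 * A) :=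
    (norm_inner_le_norm _ _).trans (mul_le_mul
      ((hf _ _ _).trans (mul_le_mul_of_nonneg_left hsum hC₁)) hz (norm_nonneg _) (by positivity))
  have h2 : ‖g x m (α x m z)‖ ≤ C₂ * (((1 + L) * A) ^ 2 + ‖ξ‖ ^ 2) := by
    refine (hg _ _ _).trans (mul_le_mul_of_nonneg_left ?_ hC₂)
    rw [hI]
    gcongr
  have hK : 0 ≤ C₁ * (1 + L) * (k₀ / 2) + C₂ * (1 + L) ^ 2 := by positivity
  calc _ ≤ C₁ * ((1 + L) * A) * (k₀ / 2 * A) + C₂ * (((1 + L) * A) ^ 2 + ‖ξ‖ ^ 2) :=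
        (norm_add_le _ _).trans (add_le_add h1 h2)
    _ = (C₁ * (1 + L) * (k₀ / 2) + C₂ * (1 + L) ^ 2) * A ^ 2 + C₂ * ‖ξ‖ ^ 2 := by ring
    _ ≤ (C₁ * (1 + L) * (k₀ / 2) + C₂ * (1 + L) ^ 2) *
          (2 * (1 + m.norm1) ^ 2 * (1 + ‖x‖ ^ 2)) + C₂ * ‖ξ‖ ^ 2 := by gcongr
    _ ≤ _ := by
      have : 0 ≤ C₂ * ‖ξ‖ ^ 2 * ‖x‖ ^ 2 := by positivity
      linarith

theorem integrable_hamiltonian {t : ℝ} (ht : t ∈ Icc 0 T) (hΩ : RichSpace n P) (m : P2 n) :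
    Integrable (fun x => feedbackHamiltonian f g α x m (Z t t m x)) (m : Measure (Euc n)) := by
  obtain ⟨ξ, rfl⟩ := hΩ m
  obtain ⟨B, -, hb⟩ := S.exists_hamiltonian_bound
  have h := S.continuous_hamiltonian_integrand.comp
    (Continuous.prodMk_right ((⟨t, ht⟩ : Icc 0 T), ξ))
  exact (P2.integrable_law_iff ξ h.aestronglyMeasurable).2 (integrable_comp_Lp ξ h (hb t ht ξ))

theorem continuousOn_integral_hamiltonian :
    ContinuousOn (fun p : ℝ × Lp (Euc n) 2 P =>
      -∫ x, feedbackHamiltonian f g α x (P2.law P p.2) (Z p.1 p.1 (P2.law P p.2) x)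
        ∂(P2.law P p.2 : Measure (Euc n))) (Icc 0 T ×ˢ univ) := by
  obtain ⟨B, hB, hb⟩ := S.exists_hamiltonian_bound
  have h := continuous_integral_law (ξ := fun p : Icc 0 T × Lp (Euc n) 2 P => p.2) continuous_snd
    (Ψ := fun p x => feedbackHamiltonian f g α x (P2.law P p.2) (Z p.1 p.1 (P2.law P p.2) x))
    S.continuous_hamiltonian_integrand (hB.comp continuous_snd) (fun p x => hb p.1 p.1.2 p.2 x)
  have hp : Continuous fun q : ℝ × Lp (Euc n) 2 P => (projIcc 0 T S.hT.le q.1, q.2) :=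
    (continuous_projIcc.comp continuous_fst).prodMk continuous_snd
  refine (h.comp hp).neg.continuousOn.congr fun q hq => ?_
  simp [projIcc_of_mem S.hT.le hq.1]

/-- The time derivative of the value function. -/
theorem hasDerivWithinAt_value {t : ℝ} (ht : t ∈ Icc 0 T) (hΩ : RichSpace n P) (m : P2 n) :
    HasDerivWithinAt (fun r => valueAlong T g k α X Z r m)
      (-∫ x, feedbackHamiltonian f g α x m (Z t t m x) ∂(m : Measure (Euc n))) (Icc 0 T) t := by
  obtain ⟨ξ, rfl⟩ := hΩ m
  refine hasDerivWithinAt_of_dense P2.dense_simples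
    (v := fun r ξ => valueAlong T g k α X Z r (P2.law P ξ))
    (h := fun r ξ => -∫ x, feedbackHamiltonian f g α x (P2.law P ξ) (Z r r (P2.law P ξ) x)
      ∂(P2.law P ξ : Measure (Euc n))) (fun t ht => S.continuous_value ht)
    S.continuousOn_integral_hamiltonian (fun a ha => ?_) (fun a ha t ht => ?_) ht ξ
  · obtain ⟨R, σ, x, -, rfl, -⟩ := P2.exists_atoms_of_simples ha ha
    exact S.continuousOn_value_atoms σ x
  · obtain ⟨R, σ, x, -, rfl, -⟩ := P2.exists_atoms_of_simples ha ha
    have ht' := Ico_subset_Icc_self ht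
    refine (S.hasDerivWithinAt_value_atoms σ ht x).congr_deriv ?_
    -- At the initial time the particles sit at `x`, so running cost plus costate paired with drift
    -- is the weighted sum of the feedback Hamiltonian.
    rw [P2.integral_law_atomLp, pairing_apply, runningCost, ← Finset.sum_add_distrib]
    congr 1
    refine Finset.sum_congr rfl fun i _ => ?_
    have hc := ctrl_atoms (P := P) σ α X Z t t x i
    rw [ctrl, S.hXZ.initial t ht', S.flow_initial ht'] at hc
    have h1 : (alongState P σ α X Z t x t).1 = x := S.along_initial σ ht' x
    rw [drift, h1, ← hc, feedbackHamiltonian, smul_eq_mul, real_inner_comm]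
    simp only [P2.atoms, along]
    ring

theorem value_terminal (m : P2 n) :
    valueAlong T g k α X Z T m = ∫ x, k x m ∂(m : Measure (Euc n)) := by
  have hT : T ∈ Icc 0 T := right_mem_Icc.2 S.hT.le
  simp only [valueAlong, intervalIntegral.integral_same, add_zero, S.hXZ.initial T hT,
    S.flow_initial hT]

/-- The equation evaluates `H` only at `(x, m, Z t t m x)`, a point of the cone. One argument
therefore covers the feedback Hamiltonian and the minimised one. -/
theorem isClassicalSolution (hΩ : RichSpace n P) {H : Euc n → P2 n → Euc n → ℝ}
    (hH : ∀ x μ z, (x, μ, z) ∈ cone n k₀ → H x μ z = feedbackHamiltonian f g α x μ z) :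
    IsClassicalSolution P T H k (valueAlong T g k α X Z) := by
  refine ⟨fun t m => -∫ x, feedbackHamiltonian f g α x m (Z t t m x) ∂(m : Measure (Euc n)),
    fun t m x => Z t t m x, fun t ht m => S.hasDerivWithinAt_value ht hΩ m,
    fun t ht => S.hasLGradient_value ht hΩ, fun t ht m => ?_, fun m => ⟨?_, S.value_terminal m⟩⟩
  · have h : (fun x => H x m (Z t t m x)) =
        fun x => feedbackHamiltonian f g α x m (Z t t m x) :=
      funext fun x => hH _ _ _ (S.mem_cone_initial ht m x)
    simp only [h]
    exact ⟨S.integrable_hamiltonian ht hΩ m, neg_add_cancel _⟩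
  · have hT : T ∈ Icc 0 T := right_mem_Icc.2 S.hT.le
    have h := (S.valueWellDefined hΩ T hT m).1
    simpa only [S.hXZ.initial T hT, S.flow_initial hT] using h

end Setting

end MFC

end

theorem mainTheorem11 {Ω : Type*} [MeasurableSpace Ω] (P : Measure Ω) [IsProbabilityMeasure P]
    (n d : ℕ) (hΩ : MFC.RichSpace n P) (T k₀ : ℝ) (hT : 0 < T) (hk₀ : 0 < k₀)
    (f : MFC.Euc n → MFC.P2 n → MFC.Euc d → MFC.Euc n)
    (g : MFC.Euc n → MFC.P2 n → MFC.Euc d → ℝ)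
    (k : MFC.Euc n → MFC.P2 n → ℝ)
    (α : MFC.Euc n → MFC.P2 n → MFC.Euc n → MFC.Euc d)
    (X Z : ℝ → ℝ → MFC.P2 n → MFC.Euc n → MFC.Euc n)
    (hf : MFC.RegularCoefficient f) (hf' : MFC.BoundedDerivs f)
    (hg : MFC.RegularCoefficient g) (hg' : MFC.LinearGrowthDerivs g)
    (hk : MFC.RegularTerminal k) (hk' : MFC.LinearGrowthDerivsTerminal k)
    (hα : MFC.RegularControl P k₀ α) (hfoc : MFC.FirstOrderCondition k₀ f g α)
    (hXZ : MFC.SolvesFBODE T k₀ f g k α X Z)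
    (hX : MFC.RegularFamily P T X) (hZ : MFC.RegularFamily P T Z) :
    MFC.ValueWellDefined T g k α X Z ∧
    MFC.IsClassicalSolution P T (MFC.feedbackHamiltonian f g α) k
      (MFC.valueAlong T g k α X Z) ∧
    (∀ t ∈ Set.Icc 0 T,
      MFC.HasLGradient P (MFC.valueAlong T g k α X Z t) (fun m x => Z t t m x)) ∧
    (MFC.IsMinimiser k₀ f g α →
      MFC.IsClassicalSolution P T (MFC.hamiltonian f g) k
        (MFC.valueAlong T g k α X Z)) := by
  have S : MFC.Setting P T k₀ f g k α X Z :=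
    ⟨hT, hk₀, hf, hf', hg, hg', hk, hk', hα, hfoc, hXZ, hX, hZ⟩
  exact ⟨S.valueWellDefined hΩ, S.isClassicalSolution hΩ fun _ _ _ _ => rfl,
    fun t ht => S.hasLGradient_value ht hΩ, fun hmin => S.isClassicalSolution hΩ
      fun _ _ _ hc => MFC.hamiltonian_eq_feedbackHamiltonian hmin hc⟩
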